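/- Let $(M,\eta,L_1,L_2)$ be an almost bi-Legendrian manifold: $M$ is a smooth manifold of dimension $2n+1$, $\eta$ is a contact form, i.e. $\eta\wedge(d\eta)^n\neq 0$ everywhere, and $L_1,L_2$ are two transversal Legendrian distributions, i.e. smooth rank-$n$ subbundles of $\mathcal D=\ker\eta$ with $L_1\cap L_2=0$ and $d\eta(X,X')=0$ for $X,X'\in\Gamma(L_i)$, $i=1,2$. Here $2d\eta(X,Y)=X(\eta(Y))-Y(\eta(X))-\eta([X,Y])$. Let $\xi$ be the Reeb vector field ($\eta(\xi)=1$, $i_\xi d\eta=0$), so that $TM=L_1\oplus L_2\oplus\mathbb R\xi$, with projections $X\mapsto X_{L_1}$, $X\mapsto X_{L_2}$. Let $\psi$ be the $(1,1)$-tensor field with $\psi|_{L_1}=I$, $\psi|_{L_2}=-I$, $\psi\xi=0$, and let $g(X,Y)=d\eta(X,\psi Y)+\eta(X)\eta(Y)$. Then $(\psi,\xi,\eta,g)$ is a paracontact metric structure: $\psi$, $\xi$, $g$ are smooth, $g$ is a semi-Riemannian metric, $\eta(\xi)=1$, $\psi^2=I-\eta\otimes\xi$, the eigendistributions of $\psi|_{\mathcal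 D}$ for the eigenvalues $\pm1$ have rank $n$, $g(\psi X,\psi Y)=-g(X,Y)+\eta(X)\eta(Y)$ and $d\eta(X,Y)=g(X,\psi Y)$. It is called integrable if $N_\psi(X,Y)\in\Gamma(\mathbb R\xi)$ for all $X,Y\in\Gamma(\mathcal D)$, where $N_\psi(X,Y)=\psi^2[X,Y]+[\psi X,\psi Y]-\psi[\psi X,Y]-\psi[X,\psi Y]$. There is a unique smooth connection $\nabla^{bl}$ on $M$ (the bi-Legendrian connection), with torsion $T^{bl}$, such that (i) $\nabla^{bl}L_1\subset L_1$, $\nabla^{bl}L_2\subset L_2$, $\nabla^{bl}(\mathbb R\xi)\subset\mathbb R\xi$ and $\nabla^{bl}\xi=0$; (ii) $\nabla^{bl}d\eta=0$; (iii) $T^{bl}(X,Y)=2d\eta(X,Y)\xi$ for $X\in\Gamma(L_1)$, $Y\in\Gamma(L_2)$, and $T^{bl}(X,\xi)=[\xi,X_{L_1}]_{L_2}+[\xi,X_{L_2}]_{L_1}$ for $X\in\Gamma(TM)$. There is a unique smooth connection $\nabla^{pc}$ on $M$ (Zamkovoy's canonical paracontact connection), with torsion $T^{pc}$, such that, with $\nabla$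 the Levi-Civita connection of $g$ and $h=\frac12\mathcal L_\xi\psi$, (i) $\nabla^{pc}\eta=0$, $\nabla^{pc}\xi=0$, $\nabla^{pc}g=0$; (ii) $(\nabla^{pc}_X\psi)Y=(\nabla_X\psi)Y+g(X-hX,Y)\xi-\eta(Y)(X-hX)$; (iii) $T^{pc}(\xi,\psi Y)=-\psi T^{pc}(\xi,Y)$; (iv) $T^{pc}(X,Y)=2d\eta(X,Y)\xi$ for $X,Y\in\Gamma(\mathcal D)$. Moreover: (a) $\nabla^{bl}\psi=0$ and $\nabla^{bl}g=0$; (b) $\nabla^{bl}=\nabla^{pc}$ if and only if the induced paracontact metric structure $(\psi,\xi,\eta,g)$ is integrable. -/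

import Mathlib

open scoped Manifold ContDiff

set_option linter.unusedSectionVars false

noncomputable section

namespace BiLegendrian

section

variable {E : Type*} [NormedAddCommGroup E] [NormedSpace ℝ E] [FiniteDimensional ℝ E]
  [CompleteSpace E] {H : Type*} [TopologicalSpace H] {I : ModelWithCorners ℝ E H}
  {M : Type*} [TopologicalSpace M] [ChartedSpace H M] [IsManifold I ∞ M]

/-! ## Vector fields, one-forms, tensor fields and the exterior derivative -/

variable (I M) in
/-- (Not necessarily smooth) vector fields on `M`. -/
abbrev VField := (x : M) → TangentSpace I x

variable (I M) in
/-- Fields of endomorphisms of the tangent spaces, i.e. tensor fields of type `(1, 1)`. -/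
abbrev EndField := (x : M) → (TangentSpace I x →L[ℝ] TangentSpace I x)

variable (I M) in
/-- Fields of linear forms on the tangent spaces. -/
abbrev FormField := (x : M) → (TangentSpace I x →L[ℝ] ℝ)

variable (I M) in
/-- Fields of bilinear forms on the tangent spaces, i.e. tensor fields of type `(0, 2)`. -/
abbrev BilinField := (x : M) → (TangentSpace I x →L[ℝ] TangentSpace I x →L[ℝ] ℝ)

/-- `X` is a smooth vector field, i.e. `X ∈ Γ(TM)`. -/
def SmoothField (X : VField I M) : Prop := CMDiff ∞ (T% X)

/-- Smoothness of a tensor field of type `(1, 1)`. -/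
def SmoothEnd (A : EndField I M) : Prop :=
  ContMDiff I (I.prod 𝓘(ℝ, E →L[ℝ] E)) ∞ (fun x ↦ Bundle.TotalSpace.mk' (E →L[ℝ] E)
    (E := fun x : M ↦ (TangentSpace I x →L[ℝ] TangentSpace I x)) x (A x))

/-- Smoothness of a one-form. -/
def SmoothForm (η : FormField I M) : Prop :=
  ContMDiff I (I.prod 𝓘(ℝ, E →L[ℝ] ℝ)) ∞ (fun x ↦ Bundle.TotalSpace.mk' (E →L[ℝ] ℝ)
    (E := fun x : M ↦ (TangentSpace I x →L[ℝ] ℝ)) x (η x))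

/-- Smoothness of a tensor field of type `(0, 2)`. -/
def SmoothBilin (b : BilinField I M) : Prop :=
  ContMDiff I (I.prod 𝓘(ℝ, E →L[ℝ] E →L[ℝ] ℝ)) ∞
    (fun x ↦ Bundle.TotalSpace.mk' (E →L[ℝ] E →L[ℝ] ℝ)
      (E := fun x : M ↦ (TangentSpace I x →L[ℝ] TangentSpace I x →L[ℝ] ℝ)) x (b x))

/-- The derivative `X f` of a function along a vector field. -/
def dirDeriv (X : VField I M) (f : M → ℝ) (x : M) : ℝ := d% f x (X x)

/-- The Lie bracket `[X, Y]`. -/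
abbrev bracket (X Y : VField I M) : VField I M := VectorField.mlieBracket I X Y

variable (I M) in
/-- Smooth one-forms. -/
structure OneForm where
  /-- The value of the form at a point. -/
  toFun : FormField I M
  smooth : SmoothForm toFun

namespace OneForm

instance : CoeFun (OneForm I M) (fun _ ↦ FormField I M) := ⟨OneForm.toFun⟩

/-- The expression `(1 / 2) (X (η Y) - Y (η X) - η [X, Y])` at `x`. -/
def dAux (η : OneForm I M) (x : M) (X Y : VField I M) : ℝ :=
  (1 / 2) * (dirDeriv X (fun y ↦ η y (Y y)) x - dirDeriv Y (fun y ↦ η y (X y)) x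
    - η x (bracket X Y x))

theorem mdifferentiableAt_apply (η : OneForm I M) {x : M} {X : VField I M}
    (hX : MDiffAt (T% X) x) : MDiffAt (fun y ↦ η y (X y)) x := by
  have h : MDifferentiableAt I (I.prod 𝓘(ℝ))
      (fun y ↦ Bundle.TotalSpace.mk' ℝ (E := Bundle.Trivial M ℝ) y (η y (X y))) x := by
    apply MDifferentiableAt.clm_bundle_apply (F₁ := E)
    · exact (η.smooth.mdifferentiable (by simp)) x
    · exact hX
  simp only [mdifferentiableAt_totalSpace] at h
  exact h.2

theorem dAux_swap (η : OneForm I M) (x : M) (X Y : VField I M) :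
    η.dAux x X Y = - η.dAux x Y X := by
  unfold dAux bracket
  rw [VectorField.mlieBracket_swap_apply, map_neg]
  ring

theorem dAux_tensorial (η : OneForm I M) (x : M) (Y : VField I M) (_hY : MDiffAt (T% Y) x) :
    TensorialAt I E (fun X : VField I M ↦ η.dAux x X Y) x where
  smul {f X} hf hX := by
    have e : (fun y ↦ η y ((f • X) y)) = f * (fun y ↦ η y (X y)) := by
      ext y; simp
    simp only [dAux, dirDeriv, bracket, e, mvfderiv_mul hf (η.mdifferentiableAt_apply hX),
      VectorField.mlieBracket_smul_left hf hX]
    simp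
    ring
  add {X X'} hX hX' := by
    have e : (fun y ↦ η y ((X + X') y)) = (fun y ↦ η y (X y)) + (fun y ↦ η y (X' y)) := by
      ext y; simp
    simp only [dAux, dirDeriv, bracket, e, mvfderiv_add (η.mdifferentiableAt_apply hX)
      (η.mdifferentiableAt_apply hX'), VectorField.mlieBracket_add_left hX hX']
    simp
    ring

theorem dAux_tensorial' (η : OneForm I M) (x : M) (X : VField I M) (hX : MDiffAt (T% X) x) :
    TensorialAt I E (fun Y : VField I M ↦ η.dAux x X Y) x where
  smul {f Y} hf hY := by
    have := (η.dAux_tensorial x X hX).smul hf hY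
    rw [η.dAux_swap, this, η.dAux_swap x X Y, smul_neg]
  add {Y Y'} hY hY' := by
    have := (η.dAux_tensorial x X hX).add hY hY'
    rw [η.dAux_swap, this, η.dAux_swap x X Y, η.dAux_swap x X Y', neg_add]

/-- The exterior derivative `dη` as a tensor field, with the normalisation
`2 dη(X, Y) = X (η Y) - Y (η X) - η [X, Y]`. -/
def d (η : OneForm I M) : BilinField I M := fun x ↦
  TensorialAt.mkHom₂ (F := E) (F' := E) (I := I) (η.dAux x) x
    (η.dAux_tensorial x) (η.dAux_tensorial' x)

/-- The defining formula of `dη` on vector fields. -/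
theorem d_apply (η : OneForm I M) {x : M} {X Y : VField I M}
    (hX : MDiffAt (T% X) x) (hY : MDiffAt (T% Y) x) :
    η.d x (X x) (Y x) =
      (1 / 2) * (dirDeriv X (fun y ↦ η y (Y y)) x - dirDeriv Y (fun y ↦ η y (X y)) x
        - η x (bracket X Y x)) :=
  TensorialAt.mkHom₂_apply _ _ hX hY

end OneForm

/-! ## Contact forms, Legendrian distributions, almost bi-Legendrian manifolds -/

/-- `η ∧ (dη)ⁿ ≠ 0` at every point of a `(2 n + 1)`-dimensional manifold. The sum over all
permutations is, up to a non-zero constant, `(η ∧ (dη)ⁿ) (v₀, …, v₂ₙ)`. -/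
def IsContact (n : ℕ) (η : OneForm I M) : Prop :=
  ∀ x : M, ∃ v : Fin (2 * n + 1) → TangentSpace I x,
    ∑ σ : Equiv.Perm (Fin (2 * n + 1)), ((Equiv.Perm.sign σ : ℤ) : ℝ) * η x (v (σ 0)) *
      ∏ i : Fin n, η.d x (v (σ ⟨2 * i + 1, by omega⟩)) (v (σ ⟨2 * i + 2, by omega⟩)) ≠ 0

variable (I M) in
/-- A choice of linear subspace in every tangent space. -/
abbrev Distribution := (x : M) → Submodule ℝ (TangentSpace I x)

/-- `X ∈ Γ(L)`: a smooth vector field with values in `L`. -/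
def IsSection (L : Distribution I M) (X : VField I M) : Prop :=
  SmoothField X ∧ ∀ x, X x ∈ L x

/-- `L` is a smooth subbundle of rank `k` of `TM`: it has local smooth frames. -/
def IsSubbundle (k : ℕ) (L : Distribution I M) : Prop :=
  ∀ x : M, ∃ U : Set M, IsOpen U ∧ x ∈ U ∧ ∃ X : Fin k → VField I M,
    (∀ i, CMDiff[U] ∞ (T% (X i))) ∧
    ∀ y ∈ U, LinearIndependent ℝ (fun i ↦ X i y) ∧
      Submodule.span ℝ (Set.range fun i ↦ X i y) = L y

/-- The distribution `ker η`. -/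
def OneForm.kernel (η : OneForm I M) : Distribution I M := fun x ↦ LinearMap.ker (η x).toLinearMap

/-- The line field `ℝ ξ`. -/
def lineField (ξ : VField I M) : Distribution I M := fun x ↦ Submodule.span ℝ {ξ x}

/-- A Legendrian distribution: a rank `n` subbundle of `ker η` on which `dη` vanishes. -/
structure IsLegendrian (n : ℕ) (η : OneForm I M) (L : Distribution I M) : Prop where
  subbundle : IsSubbundle n L
  le_kernel : ∀ x, L x ≤ η.kernel x
  isotropic : ∀ x, ∀ v ∈ L x, ∀ w ∈ L x, η.d x v w = 0

variable (I M) in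
/-- An almost bi-Legendrian structure on a manifold of dimension `2 n + 1`: a contact form with
two transversal Legendrian distributions. -/
structure AlmostBiLegendrian (n : ℕ) where
  /-- The contact form. -/
  η : OneForm I M
  contact : IsContact n η
  /-- The first Legendrian distribution. -/
  L₁ : Distribution I M
  /-- The second Legendrian distribution. -/
  L₂ : Distribution I M
  legendrian₁ : IsLegendrian n η L₁
  legendrian₂ : IsLegendrian n η L₂
  transversal : ∀ x, Disjoint (L₁ x) (L₂ x)

open Classical in
/-- The Reeb vector field: the vector field `ξ` with `η(ξ) = 1` and `i_ξ dη = 0`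
(unique and everywhere defined for a contact form). -/
def OneForm.reeb (η : OneForm I M) : VField I M := fun x ↦
  if h : ∃ v : TangentSpace I x, η x v = 1 ∧ ∀ w, η.d x v w = 0 then h.choose else 0

open Classical in
/-- The projection of `T_x M` onto `p` along `q` (zero if `p` and `q` are not complementary). -/
def projAlong {x : M} (p q : Submodule ℝ (TangentSpace I x)) :
    TangentSpace I x →L[ℝ] TangentSpace I x :=
  haveI : FiniteDimensional ℝ (TangentSpace I x) := inferInstanceAs (FiniteDimensional ℝ E)
  haveI : T2Space (TangentSpace I x) := inferInstanceAs (T2Space E)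
  if h : IsCompl p q then LinearMap.toContinuousLinearMap (p.projection q h) else 0

/-- The vector field `A X`, for a field of endomorphisms `A`. -/
abbrev EndField.app (A : EndField I M) (X : VField I M) : VField I M := fun x ↦ A x (X x)

namespace AlmostBiLegendrian

variable {n : ℕ} (B : AlmostBiLegendrian I M n)

/-- The Reeb vector field of the contact form. -/
abbrev reeb : VField I M := B.η.reeb

/-- `X ↦ X_{L₁}` for the decomposition `TM = L₁ ⊕ L₂ ⊕ ℝ ξ`. -/
def proj₁ : EndField I M := fun x ↦ projAlong (B.L₁ x) (B.L₂ x ⊔ lineField B.reeb x)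

/-- `X ↦ X_{L₂}` for the decomposition `TM = L₁ ⊕ L₂ ⊕ ℝ ξ`. -/
def proj₂ : EndField I M := fun x ↦ projAlong (B.L₂ x) (B.L₁ x ⊔ lineField B.reeb x)

end AlmostBiLegendrian

/-! ## Connections -/

variable (I M) in
/-- Affine connections on `M`; `∇ Y x (X x)` is the value of `∇_X Y` at `x`. -/
abbrev Connection := CovariantDerivative I E (fun x : M ↦ TangentSpace I x)

namespace Connection

/-- `∇_X Y`. -/
def cov (D : Connection I M) (X Y : VField I M) : VField I M := fun x ↦ D Y x (X x)

/-- The connection is smooth. -/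
def Smooth (D : Connection I M) : Prop := CovariantDerivative.ContMDiffCovariantDerivative D ∞

/-- Two connections coincide: `∇_X Y = ∇'_X Y` for all smooth vector fields `X`, `Y`. -/
def Coincide (D D' : Connection I M) : Prop :=
  ∀ X Y : VField I M, SmoothField X → SmoothField Y → D.cov X Y = D'.cov X Y

/-- `(∇_X η) Y`. -/
def covForm (D : Connection I M) (η : FormField I M) (X Y : VField I M) (x : M) : ℝ :=
  dirDeriv X (fun y ↦ η y (Y y)) x - η x (D.cov X Y x)

/-- `(∇_X A) Y` for a tensor field `A` of type `(1, 1)`. -/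
def covEnd (D : Connection I M) (A : EndField I M) (X Y : VField I M) (x : M) :
    TangentSpace I x :=
  D.cov X (A.app Y) x - A x (D.cov X Y x)

/-- `(∇_X b) (Y, Z)` for a tensor field `b` of type `(0, 2)`. -/
def covBilin (D : Connection I M) (b : BilinField I M) (X Y Z : VField I M) (x : M) : ℝ :=
  dirDeriv X (fun y ↦ b y (Y y) (Z y)) x - b x (D.cov X Y x) (Z x) - b x (Y x) (D.cov X Z x)

/-- `∇ ξ = 0`. -/
def ParallelField (D : Connection I M) (ξ : VField I M) : Prop :=
  ∀ X : VField I M, SmoothField X → ∀ x, D.cov X ξ x = 0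

/-- `∇ η = 0`. -/
def ParallelForm (D : Connection I M) (η : FormField I M) : Prop :=
  ∀ X Y : VField I M, SmoothField X → SmoothField Y → ∀ x, D.covForm η X Y x = 0

/-- `∇ A = 0`. -/
def ParallelEnd (D : Connection I M) (A : EndField I M) : Prop :=
  ∀ X Y : VField I M, SmoothField X → SmoothField Y → ∀ x, D.covEnd A X Y x = 0

/-- `∇ b = 0`. -/
def ParallelBilin (D : Connection I M) (b : BilinField I M) : Prop :=
  ∀ X Y Z : VField I M, SmoothField X → SmoothField Y → SmoothField Z →
    ∀ x, D.covBilin b X Y Z x = 0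

/-- `∇ L ⊂ L`. -/
def Preserves (D : Connection I M) (L : Distribution I M) : Prop :=
  ∀ X Y : VField I M, SmoothField X → IsSection L Y → ∀ x, D.cov X Y x ∈ L x

/-- The Levi-Civita connection of a semi-Riemannian metric: metric and torsion-free. -/
structure IsLeviCivita (g : BilinField I M) (D : Connection I M) : Prop where
  smooth : D.Smooth
  metric : D.ParallelBilin g
  torsion_free : ∀ x, D.torsion x = 0

/-- `D` is the bi-Legendrian connection. -/
structure IsBiLegendrian {n : ℕ} (B : AlmostBiLegendrian I M n) (D : Connection I M) : Prop where
  smooth : D.Smooth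
  preserves_L₁ : D.Preserves B.L₁
  preserves_L₂ : D.Preserves B.L₂
  preserves_reeb : D.Preserves (lineField B.reeb)
  parallel_reeb : D.ParallelField B.reeb
  parallel_d : D.ParallelBilin B.η.d
  torsion_L₁_L₂ : ∀ X Y : VField I M, IsSection B.L₁ X → IsSection B.L₂ Y → ∀ x,
    D.torsion x (X x) (Y x) = (2 * B.η.d x (X x) (Y x)) • B.reeb x
  torsion_reeb : ∀ X : VField I M, SmoothField X → ∀ x,
    D.torsion x (X x) (B.reeb x) =
      B.proj₂ x (bracket B.reeb (B.proj₁.app X) x) + B.proj₁ x (bracket B.reeb (B.proj₂.app X) x)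

end Connection

/-! ## Paracontact metric structures -/

variable (I M) in
/-- The data `(ψ, ξ, η, g)` underlying a paracontact metric structure. -/
structure ParacontactData where
  /-- The structure tensor of type `(1, 1)`. -/
  ψ : EndField I M
  /-- The vector field `ξ`. -/
  ξ : VField I M
  /-- The one-form `η`. -/
  η : OneForm I M
  /-- The metric. -/
  g : BilinField I M

namespace ParacontactData

/-- `(ψ, ξ, η, g)` is a paracontact metric structure on a manifold of dimension `2 n + 1`. -/
structure IsParacontactMetric (n : ℕ) (P : ParacontactData I M) : Prop where
  smooth_ψ : SmoothEnd P.ψ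
  smooth_ξ : SmoothField P.ξ
  smooth_g : SmoothBilin P.g
  η_ξ : ∀ x, P.η x (P.ξ x) = 1
  ψ_sq : ∀ x v, P.ψ x (P.ψ x v) = v - P.η x v • P.ξ x
  finrank_pos : ∀ x, Module.finrank ℝ
    (Module.End.eigenspace (P.ψ x).toLinearMap 1 ⊓ P.η.kernel x : Submodule ℝ _) = n
  finrank_neg : ∀ x, Module.finrank ℝ
    (Module.End.eigenspace (P.ψ x).toLinearMap (-1) ⊓ P.η.kernel x : Submodule ℝ _) = n
  g_symm : ∀ x v w, P.g x v w = P.g x w v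
  g_nondegenerate : ∀ x v, (∀ w, P.g x v w = 0) → v = 0
  compatible : ∀ x v w, P.g x (P.ψ x v) (P.ψ x w) = - P.g x v w + P.η x v * P.η x w
  d_η : ∀ x v w, P.η.d x v w = P.g x v (P.ψ x w)

/-- `h X`, where `h = (1 / 2) L_ξ ψ`, i.e. `2 h X = [ξ, ψ X] - ψ [ξ, X]`. -/
def h (P : ParacontactData I M) (X : VField I M) : VField I M := fun x ↦
  (1 / 2 : ℝ) • (bracket P.ξ (P.ψ.app X) x - P.ψ x (bracket P.ξ X x))

/-- The Nijenhuis tensor `N_ψ(X, Y) = ψ² [X, Y] + [ψ X, ψ Y] - ψ [ψ X, Y] - ψ [X, ψ Y]`. -/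
def nijenhuis (P : ParacontactData I M) (X Y : VField I M) : VField I M := fun x ↦
  P.ψ x (P.ψ x (bracket X Y x)) + bracket (P.ψ.app X) (P.ψ.app Y) x
    - P.ψ x (bracket (P.ψ.app X) Y x) - P.ψ x (bracket X (P.ψ.app Y) x)

/-- Integrability: `N_ψ(X, Y) ∈ Γ(ℝ ξ)` for all `X, Y ∈ Γ(ker η)`. -/
def Integrable (P : ParacontactData I M) : Prop :=
  ∀ X Y : VField I M, IsSection P.η.kernel X → IsSection P.η.kernel Y →
    ∀ x, P.nijenhuis X Y x ∈ lineField P.ξ x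

/-- `D` is the canonical paracontact connection. -/
structure IsCanonicalConnection (P : ParacontactData I M) (D : Connection I M) : Prop where
  smooth : D.Smooth
  parallel_η : D.ParallelForm P.η
  parallel_ξ : D.ParallelField P.ξ
  parallel_g : D.ParallelBilin P.g
  cov_ψ : ∃ D₀ : Connection I M, D₀.IsLeviCivita P.g ∧
    ∀ X Y : VField I M, SmoothField X → SmoothField Y → ∀ x,
      D.covEnd P.ψ X Y x = D₀.covEnd P.ψ X Y x
        + P.g x (X x - P.h X x) (Y x) • P.ξ x - P.η x (Y x) • (X x - P.h X x)
  torsion_ξ : ∀ x v, D.torsion x (P.ξ x) (P.ψ x v) = - P.ψ x (D.torsion x (P.ξ x) v)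
  torsion_kernel : ∀ x, ∀ v ∈ P.η.kernel x, ∀ w ∈ P.η.kernel x,
    D.torsion x v w = (2 * P.η.d x v w) • P.ξ x

end ParacontactData

/-- The paracontact metric structure induced by an almost bi-Legendrian structure:
`ψ = I` on `L₁`, `ψ = - I` on `L₂`, `ψ ξ = 0` and `g(X, Y) = dη(X, ψ Y) + η(X) η(Y)`. -/
def AlmostBiLegendrian.paracontact {n : ℕ} (B : AlmostBiLegendrian I M n) :
    ParacontactData I M where
  ψ := fun x ↦ B.proj₁ x - B.proj₂ x
  ξ := B.reeb
  η := B.η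
  g := fun x ↦ (ContinuousLinearMap.precomp ℝ (B.proj₁ x - B.proj₂ x)).comp (B.η.d x)
    + (B.η x).smulRight (B.η x)

/-- `g(X, Y) = dη(X, ψ Y) + η(X) η(Y)`. -/
theorem AlmostBiLegendrian.paracontact_g_apply {n : ℕ} (B : AlmostBiLegendrian I M n) (x : M)
    (v w : TangentSpace I x) :
    B.paracontact.g x v w = B.η.d x v (B.paracontact.ψ x w) + B.η x v * B.η x w := rfl

end

end BiLegendrian

end

/-!
Both connections are built from the Levi-Civita connection `∇` of the induced metric
`g = dη(·, ψ ·) + η ⊗ η`, which is constructed from the Koszul formula.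

Write `X₁`, `X₂` for the parts of `X` in `L₁`, `L₂`. The connections are
`∇ᵇˡ_X Y = (∇_X Y₁)₁ + (∇_X Y₂)₂ + X(η Y) ξ + η(X) ψ Y` (`biLegendrianConnection`) and
`∇ᵖᶜ_X Y = ∇_X Y + η(X) ψ Y - η(Y) ∇_X ξ + g(Y, ∇_X ξ) ξ` (`canonicalConnection`).

The axioms reduce to a few identities for `∇`, which follow from the facts that `∇` is metric and
torsion-free and that `dη` is closed (`OneForm.d_closed`):
* `∇ dη` vanishes on `L₁ × L₂`, since there `dη = - g` (`IsAdapted.d₁₂`);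
* `(∇_X Y)₁ = 0` for `X` in `L₁ ⊕ ℝ ξ` and `Y` in `L₂`, and the same with `L₁` and `L₂` exchanged
  (`IsAdapted.proj₁_cov₁₂`, `IsAdapted.proj₁_cov_reeb₂`);
* `A X = ∇_X ξ` satisfies `ψ A + A ψ = - 2 ψ²`, and `∇_ξ ψ = 0` (`IsLeviCivita.ψ_cov_reeb`,
  `IsLeviCivita.cov_reeb_ψ`). Consequently `h = ψ A + ψ²` (`IsLeviCivita.h_eq`), which gives the
  formula for `∇ᵖᶜ ψ`.

For uniqueness, the axioms of the bi-Legendrian connection force `∇_X Y = [X, Y]₁` for `X` in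
`L₂ ⊕ ℝ ξ` and `Y` in `L₁`, and the symmetric formula; then `∇ dη = 0` determines
`dη(∇_X Y, Z)` for `X`, `Y` in `L₁` and `Z` in `L₂`. The canonical connection is metric, so that it
is determined by its torsion (`IsSemiRiemannian.coincide`), and the torsion is determined on
`ker η`; the formula for `∇ᵖᶜ_ξ ψ` and the condition that `T(ξ, ·)` anticommutes with `ψ` determine
the rest.

Finally `∇ᵖᶜ_X Y - ∇ᵇˡ_X Y` is `(∇_X Y)₂` for `Y` in `L₁` and `(∇_X Y)₁` for `Y` in `L₂`. For
`X`, `Y`, `Z` in `L₁` the expression `dη(∇_X Y, Z)` is skew in `Y`, `Z`, so that it vanishes as soon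
as it is symmetric in `X`, `Y`, i.e. as soon as `[X, Y]₂ = 0` for `X`, `Y` in `L₁`. Together with the
analogous condition on `L₂` this is integrability: modulo `ξ`, the Nijenhuis tensor on `ker η` is
`4 [X₂, Y₂]₁ + 4 [X₁, Y₁]₂` (`proj_nijenhuis`).
-/

noncomputable section

namespace BiLegendrian

open Bundle Filter Topology Module

/-! ### Smoothness via local frames -/

section Frames

variable {E : Type*} [NormedAddCommGroup E] [NormedSpace ℝ E]
  {H : Type*} [TopologicalSpace H] {I : ModelWithCorners ℝ E H}
  {M : Type*} [TopologicalSpace M] [ChartedSpace H M]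
  {F : Type*} [NormedAddCommGroup F] [NormedSpace ℝ F] [FiniteDimensional ℝ F]
  {V : M → Type*} [TopologicalSpace (TotalSpace F V)]
  [∀ x, AddCommGroup (V x)] [∀ x, Module ℝ (V x)] [∀ x, TopologicalSpace (V x)]
  [FiberBundle F V] [VectorBundle ℝ F V] {k : ℕ∞ω}
  [ContMDiffVectorBundle k F V I]

/-- The coefficients of a smooth section in a smooth local frame are smooth: in a trivialization,
they are obtained by inverting the matrix of the frame. -/
theorem contMDiffAt_frame_coeff {ι : Type*} [Fintype ι] {s : ι → (x : M) → V x} {u : Set M}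
    (hs : IsLocalFrameOn I F k s u) {x : M} (hu : u ∈ 𝓝 x) {W : (x : M) → V x}
    (hW : CMDiffAt k (T% W) x) (i : ι) : CMDiffAt k (fun y ↦ hs.coeff i y (W y)) x := by
  classical
  let e := trivializationAt F V x
  have hxe : x ∈ e.baseSet := FiberBundle.mem_baseSet_trivializationAt F V x
  -- the map sending a coefficient vector to the section it describes, in the trivialization
  let S : M → (ι → ℝ) →L[ℝ] F := fun y ↦
    ∑ j, (ContinuousLinearMap.proj (R := ℝ) (φ := fun _ : ι ↦ ℝ) j).smulRight (e ⟨y, s j y⟩).2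
  have hsj (j) : CMDiffAt k (fun y ↦ (e ⟨y, s j y⟩).2) x :=
    (contMDiffAt_section x).1 ((hs.contMDiffOn j).contMDiffAt hu)
  have hS : CMDiffAt k S x := by
    have h1 : CMDiffAt k (fun y ↦ ∑ j, (ContinuousLinearMap.smulRightL ℝ (ι → ℝ) F
        (ContinuousLinearMap.proj (R := ℝ) (φ := fun _ : ι ↦ ℝ) j)) (e ⟨y, s j y⟩).2) x :=
      contMDiffAt_finsetSum fun j _ ↦ (ContinuousLinearMap.contMDiff _).contMDiffAt.comp x (hsj j)
    exact h1
  have key (y : M) (hy : y ∈ u) (hye : y ∈ e.baseSet) : ∃ φ : (ι → ℝ) ≃L[ℝ] F, S y = φ ∧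
      ∀ j, hs.coeff j y (W y) = φ.symm (e ⟨y, W y⟩).2 j := by
    let φ₀ : (ι → ℝ) ≃ₗ[ℝ] F :=
      (hs.toBasisAt hy).equivFun.symm.trans (e.linearEquivAt ℝ y hye)
    refine ⟨φ₀.toContinuousLinearEquiv, ?_, ?_⟩
    · ext c
      have h1 : φ₀ c = e.linearEquivAt ℝ y hye ((hs.toBasisAt hy).equivFun.symm c) := rfl
      have h2 (v : V y) : e.linearEquivAt ℝ y hye v = (e ⟨y, v⟩).2 := rfl
      change S y c = φ₀ c
      rw [h1, Basis.equivFun_symm_apply, map_sum]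
      simp_rw [LinearEquiv.map_smul, h2, IsLocalFrameOn.toBasisAt_coe]
      simp [S]
    · intro j
      have h1 : φ₀.symm (e ⟨y, W y⟩).2 = (hs.toBasisAt hy).equivFun
        ((e.linearEquivAt ℝ y hye).symm (e.linearEquivAt ℝ y hye (W y))) := rfl
      change _ = φ₀.symm (e ⟨y, W y⟩).2 j
      rw [h1, LinearEquiv.symm_apply_apply, hs.coeff_apply_of_mem hy]
      rfl
  obtain ⟨φ, hφ, -⟩ := key x (mem_of_mem_nhds hu) hxe
  have hinv : ContDiffAt ℝ k ContinuousLinearMap.inverse (S x) := by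
    rw [hφ]; exact contDiffAt_map_inverse φ
  have h1 : CMDiffAt k (fun y ↦ (S y).inverse) x := hinv.contMDiffAt.comp x hS
  have h2 : ContMDiffAt I 𝓘(ℝ, ι → ℝ) k (fun y ↦ (S y).inverse (e ⟨y, W y⟩).2) x :=
    h1.clm_apply ((contMDiffAt_section x).1 hW)
  have h3 : CMDiffAt k (fun y ↦ (S y).inverse (e ⟨y, W y⟩).2 i) x :=
    (ContinuousLinearMap.proj (R := ℝ) (φ := fun _ : ι ↦ ℝ) i).contMDiff.contMDiffAt.comp x h2
  refine h3.congr_of_eventuallyEq ?_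
  filter_upwards [hu, e.open_baseSet.mem_nhds hxe] with y hy hye
  obtain ⟨φ', hφ', h⟩ := key y hy hye
  rw [h, hφ']
  simp

end Frames

section Hom

variable {E : Type*} [NormedAddCommGroup E] [NormedSpace ℝ E]
  {H : Type*} [TopologicalSpace H] {I : ModelWithCorners ℝ E H}
  {M : Type*} [TopologicalSpace M] [ChartedSpace H M]
  {F : Type*} [NormedAddCommGroup F] [NormedSpace ℝ F] [FiniteDimensional ℝ F]
  {V : M → Type*} [TopologicalSpace (TotalSpace F V)]
  [∀ x, AddCommGroup (V x)] [∀ x, Module ℝ (V x)] [∀ x, TopologicalSpace (V x)]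
  [FiberBundle F V] [VectorBundle ℝ F V]
  {F' : Type*} [NormedAddCommGroup F'] [NormedSpace ℝ F']
  {V' : M → Type*} [TopologicalSpace (TotalSpace F' V')]
  [∀ x, AddCommGroup (V' x)] [∀ x, Module ℝ (V' x)] [∀ x, TopologicalSpace (V' x)]
  [∀ x, IsTopologicalAddGroup (V' x)] [∀ x, ContinuousSMul ℝ (V' x)]
  [FiberBundle F' V'] [VectorBundle ℝ F' V'] {k : ℕ∞ω}
  [ContMDiffVectorBundle k F V I] [ContMDiffVectorBundle k F' V' I]

/-- A field of linear maps is smooth as soon as it maps the sections of the local frame of a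
trivialization to smooth sections. -/
theorem contMDiffAt_hom_of_localFrame {ι : Type*} [Fintype ι] (b : Basis ι ℝ F) {x : M}
    {A : (y : M) → V y →L[ℝ] V' y}
    (h : ∀ i, CMDiffAt k (T% fun y ↦ A y ((trivializationAt F V x).localFrame b i y)) x) :
    ContMDiffAt I (I.prod 𝓘(ℝ, F →L[ℝ] F')) k
      (fun y ↦ TotalSpace.mk' (F →L[ℝ] F') (E := fun y ↦ V y →L[ℝ] V' y) y (A y)) x := by
  rw [contMDiffAt_hom_bundle]
  refine ⟨contMDiffAt_id, ?_⟩
  let e := trivializationAt F V x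
  let e' := trivializationAt F' V' x
  have hxe : x ∈ e.baseSet := FiberBundle.mem_baseSet_trivializationAt F V x
  have hxe' : x ∈ e'.baseSet := FiberBundle.mem_baseSet_trivializationAt F' V' x
  have h1 : CMDiffAt k (fun y ↦ ∑ j, ContinuousLinearMap.smulRightL ℝ F F'
      (LinearMap.toContinuousLinearMap (b.coord j)) (e' ⟨y, A y (e.localFrame b j y)⟩).2) x :=
    contMDiffAt_finsetSum fun j _ ↦ (ContinuousLinearMap.contMDiff _).contMDiffAt.comp x
      ((contMDiffAt_section x).1 (h j))
  refine h1.congr_of_eventuallyEq ?_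
  filter_upwards [e.open_baseSet.mem_nhds hxe, e'.open_baseSet.mem_nhds hxe'] with y hy hy'
  rw [ContinuousLinearMap.inCoordinates_eq hy hy']
  refine ContinuousLinearMap.coe_injective (b.ext fun i ↦ ?_)
  classical
  simp [Finsupp.single_apply, hy, Bundle.Trivialization.basisAt, e, e', ite_smul]

end Hom

section Extension

variable {E : Type*} [NormedAddCommGroup E] [NormedSpace ℝ E] [FiniteDimensional ℝ E]
  {H : Type*} [TopologicalSpace H] {I : ModelWithCorners ℝ E H}
  {M : Type*} [TopologicalSpace M] [T2Space M] [ChartedSpace H M] [IsManifold I ∞ M]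
  {F : Type*} [NormedAddCommGroup F] [NormedSpace ℝ F]
  {V : M → Type*} [TopologicalSpace (TotalSpace F V)]
  [∀ x, AddCommGroup (V x)] [∀ x, Module ℝ (V x)] [∀ x, TopologicalSpace (V x)]
  [FiberBundle F V] [VectorBundle ℝ F V]

/-- A section which is smooth on a neighbourhood of `x` agrees near `x` with a global smooth
section. -/
theorem exists_contMDiff_eventuallyEq {u : Set M} {x : M} (hu : u ∈ 𝓝 x) {s : (x : M) → V x}
    (hs : CMDiff[u] ∞ (T% s)) :
    ∃ s' : (x : M) → V x, CMDiff ∞ (T% s') ∧ ∀ᶠ y in 𝓝 x, s' y = s y := by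
  -- multiply by a bump function supported in `u`
  obtain ⟨v, hvu, hv, hxv⟩ := mem_nhds_iff.1 hu
  obtain ⟨f, hf, -⟩ := (SmoothBumpFunction.nhds_basis_support (I := I)
    (hv.mem_nhds hxv)).mem_iff.1 (hv.mem_nhds hxv)
  refine ⟨(f : M → ℝ) • s, ?_, ?_⟩
  · exact ContMDiffOn.smul_section_of_tsupport (u := v) f.contMDiff.contMDiffOn hv hf (hs.mono hvu)
  · filter_upwards [f.eventuallyEq_one] with y hy
    simp [hy]

end Extension

/-! ### Smooth vector fields and tensor fields -/

section Smoothness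

variable {E : Type*} [NormedAddCommGroup E] [NormedSpace ℝ E] [FiniteDimensional ℝ E]
  [CompleteSpace E] {H : Type*} [TopologicalSpace H] {I : ModelWithCorners ℝ E H}
  {M : Type*} [TopologicalSpace M] [ChartedSpace H M] [IsManifold I ∞ M]

instance (x : M) : FiniteDimensional ℝ (TangentSpace I x) :=
  inferInstanceAs (FiniteDimensional ℝ E)

instance (x : M) : T2Space (TangentSpace I x) := inferInstanceAs (T2Space E)

theorem SmoothField.mdiff {X : VField I M} (hX : SmoothField X) (x : M) : MDiffAt (T% X) x :=
  (hX x).mdifferentiableAt (by simp)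

theorem mdiff_of_smooth {f : M → ℝ} (hf : CMDiff ∞ f) (x : M) : MDiffAt f x :=
  (hf x).mdifferentiableAt (by simp)

theorem SmoothField.add {X Y : VField I M} (hX : SmoothField X) (hY : SmoothField Y) :
    SmoothField (fun x ↦ X x + Y x) := ContMDiff.add_section hX hY

theorem SmoothField.sub {X Y : VField I M} (hX : SmoothField X) (hY : SmoothField Y) :
    SmoothField (fun x ↦ X x - Y x) := ContMDiff.sub_section hX hY

theorem SmoothField.smul {X : VField I M} {f : M → ℝ} (hf : CMDiff ∞ f) (hX : SmoothField X) :
    SmoothField (fun x ↦ f x • X x) := ContMDiff.smul_section hf hX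

theorem SmoothEnd.app {A : EndField I M} {X : VField I M} (hA : SmoothEnd A)
    (hX : SmoothField X) : SmoothField (A.app X) := by
  intro x
  exact ContMDiffAt.clm_bundle_apply (F₁ := E) (F₂ := E) (hA x) (hX x)

theorem SmoothForm.app {η : FormField I M} {X : VField I M} (hη : SmoothForm η)
    (hX : SmoothField X) : CMDiff ∞ (fun x ↦ η x (X x)) := by
  intro x
  have h : ContMDiffAt I (I.prod 𝓘(ℝ)) ∞
      (fun y ↦ Bundle.TotalSpace.mk' ℝ (E := Bundle.Trivial M ℝ) y (η y (X y))) x := by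
    apply ContMDiffAt.clm_bundle_apply (F₁ := E)
    · exact hη x
    · exact hX x
  simp only [contMDiffAt_totalSpace] at h
  exact h.2

theorem SmoothBilin.form {b : BilinField I M} {X : VField I M} (hb : SmoothBilin b)
    (hX : SmoothField X) : SmoothForm (fun x ↦ b x (X x)) := by
  intro x
  exact ContMDiffAt.clm_bundle_apply (F₁ := E) (F₂ := E →L[ℝ] ℝ) (hb x) (hX x)

theorem SmoothBilin.app {b : BilinField I M} {X Y : VField I M} (hb : SmoothBilin b)
    (hX : SmoothField X) (hY : SmoothField Y) : CMDiff ∞ (fun x ↦ b x (X x) (Y x)) :=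
  (hb.form hX).app hY

theorem dirDeriv_smooth {X : VField I M} {f : M → ℝ} (hX : SmoothField X) (hf : CMDiff ∞ f) :
    CMDiff ∞ (dirDeriv X f) := by
  have h1 : ContMDiff I 𝓘(ℝ, ℝ).tangent ∞ (fun x ↦ tangentMap I 𝓘(ℝ, ℝ) f (T% X x)) :=
    (hf.contMDiff_tangentMap (m := ∞) (by simp)).comp hX
  exact (contMDiff_snd_tangentBundle_modelSpace ℝ 𝓘(ℝ, ℝ)).comp h1

theorem bracket_smooth {X Y : VField I M} (hX : SmoothField X) (hY : SmoothField Y) :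
    SmoothField (bracket X Y) := by
  intro x
  have : IsManifold I (((⊤ : ℕ∞) : ℕ∞ω) + 1) M := by simpa using! ‹IsManifold I ∞ M›
  have : IsManifold I (minSmoothness ℝ 2) M := by
    rw [minSmoothness_of_isRCLikeNormedField]
    exact IsManifold.of_le (n := ∞) (by exact WithTop.coe_le_coe.2 le_top)
  exact ContMDiffAt.mlieBracket_vectorField (n := ⊤) (m := ⊤) (hX x) (hY x) (by simp)

variable [T2Space M]

/-- Every tangent vector extends to a smooth vector field. -/
theorem exists_smoothField (x : M) (v : TangentSpace I x) :
    ∃ X : VField I M, SmoothField X ∧ X x = v := by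
  obtain ⟨s, hs, h⟩ := FiberBundle.exists_contMDiffOn_extend (k := ∞) I E v
  obtain ⟨X, hX, hXe⟩ := exists_contMDiff_eventuallyEq hs h
  exact ⟨X, hX, by simpa using hXe.self_of_nhds⟩

section Criterion

variable {F' : Type*} [NormedAddCommGroup F'] [NormedSpace ℝ F']
  {V' : M → Type*} [TopologicalSpace (TotalSpace F' V')]
  [∀ x, AddCommGroup (V' x)] [∀ x, Module ℝ (V' x)] [∀ x, TopologicalSpace (V' x)]
  [∀ x, IsTopologicalAddGroup (V' x)] [∀ x, ContinuousSMul ℝ (V' x)]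
  [FiberBundle F' V'] [VectorBundle ℝ F' V'] [ContMDiffVectorBundle ∞ F' V' I]

/-- A field of linear maps on the tangent bundle is smooth at `x` if it maps smooth vector fields
to sections which are smooth at `x`. -/
theorem contMDiffAt_hom_of_forall_smoothField {x : M} {A : (y : M) → TangentSpace I y →L[ℝ] V' y}
    (h : ∀ X : VField I M, SmoothField X → CMDiffAt ∞ (T% fun y ↦ A y (X y)) x) :
    ContMDiffAt I (I.prod 𝓘(ℝ, E →L[ℝ] F')) ∞
      (fun y ↦ TotalSpace.mk' (E →L[ℝ] F') (E := fun y ↦ TangentSpace I y →L[ℝ] V' y) y (A y))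
      x := by
  refine contMDiffAt_hom_of_localFrame (finBasis ℝ E) fun i ↦ ?_
  let e := trivializationAt E (TangentSpace I : M → Type _) x
  have hxe : e.baseSet ∈ 𝓝 x :=
    e.open_baseSet.mem_nhds (FiberBundle.mem_baseSet_trivializationAt _ _ _)
  obtain ⟨X, hX, hXe⟩ := exists_contMDiff_eventuallyEq hxe
    (e.contMDiffOn_localFrame_baseSet (I := I) ∞ (finBasis ℝ E) i)
  refine (h X hX).congr_of_eventuallyEq ?_
  filter_upwards [hXe] with y hy
  rw [hy]

variable [FiniteDimensional ℝ F']

/-- If `A` is a smooth field of invertible maps and `A W` is smooth, then so is `W`: a local frame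
of the tangent bundle is mapped to a local frame, and `A W` has smooth coefficients in it. -/
theorem smoothField_of_bijective {A : (y : M) → TangentSpace I y →L[ℝ] V' y}
    (hA : ContMDiff I (I.prod 𝓘(ℝ, E →L[ℝ] F')) ∞ (fun y ↦ TotalSpace.mk' (E →L[ℝ] F')
      (E := fun y ↦ TangentSpace I y →L[ℝ] V' y) y (A y)))
    (hbij : ∀ y, Function.Bijective (A y)) {W : VField I M}
    (hW : CMDiff ∞ (T% fun y ↦ A y (W y))) : SmoothField W := by
  intro x
  let e := trivializationAt E (TangentSpace I : M → Type _) x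
  have hxe : e.baseSet ∈ 𝓝 x :=
    e.open_baseSet.mem_nhds (FiberBundle.mem_baseSet_trivializationAt _ _ _)
  let b := finBasis ℝ E
  have hs : IsLocalFrameOn I E ∞ (e.localFrame b) e.baseSet :=
    e.isLocalFrameOn_localFrame_baseSet I ∞ b
  let φ (y : M) : TangentSpace I y ≃ₗ[ℝ] V' y := .ofBijective (A y).toLinearMap (hbij y)
  have hs' : IsLocalFrameOn I F' ∞ (fun i y ↦ A y (e.localFrame b i y)) e.baseSet :=
    { linearIndependent := fun {y} hy ↦
        (hs.linearIndependent hy).map' (φ y).toLinearMap (φ y).ker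
      generating := fun {y} hy ↦ by
        have h : Set.range (fun i ↦ A y (e.localFrame b i y)) =
          (φ y) '' Set.range fun i ↦ e.localFrame b i y := by
          rw [← Set.range_comp]; rfl
        have h2 := Submodule.map_span (φ y).toLinearMap (Set.range fun i ↦ e.localFrame b i y)
        rw [h]
        change _ ≤ Submodule.span ℝ ((φ y).toLinearMap '' _)
        rw [← h2, top_le_iff.1 (hs.generating hy)]
        simp
      contMDiffOn := fun i y hy ↦
        (ContMDiffWithinAt.clm_bundle_apply (F₁ := E) (F₂ := F') (hA y).contMDiffWithinAt
          (hs.contMDiffOn i y hy)) }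
  have hc := fun i ↦ contMDiffAt_frame_coeff hs' hxe (hW x) i
  have h1 : CMDiffAt ∞ (T% fun y ↦ ∑ i, hs'.coeff i y (A y (W y)) • e.localFrame b i y) x :=
    .sum_section fun i _ ↦ (hc i).smul_section ((hs.contMDiffOn i).contMDiffAt hxe)
  refine h1.congr_of_eventuallyEq ?_
  filter_upwards [hxe] with y hy
  congr 1
  apply (hbij y).1
  rw [map_sum]
  simp_rw [map_smul]
  exact hs'.coeff_sum_eq (fun y ↦ A y (W y)) hy

end Criterion

theorem smoothEnd_of_forall {A : EndField I M}
    (h : ∀ X : VField I M, SmoothField X → SmoothField (A.app X)) : SmoothEnd A := fun x ↦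
  contMDiffAt_hom_of_forall_smoothField (F' := E) fun X hX ↦ h X hX x

theorem smoothForm_of_forall {η : FormField I M}
    (h : ∀ X : VField I M, SmoothField X → CMDiff ∞ (fun x ↦ η x (X x))) : SmoothForm η := fun x ↦
  contMDiffAt_hom_of_forall_smoothField (F' := ℝ) (V' := Bundle.Trivial M ℝ) fun X hX ↦ by
    simp only [contMDiffAt_totalSpace]
    exact ⟨contMDiffAt_id, h X hX x⟩

theorem smoothBilin_of_forall {b : BilinField I M}
    (h : ∀ X Y : VField I M, SmoothField X → SmoothField Y → CMDiff ∞ (fun x ↦ b x (X x) (Y x))) :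
    SmoothBilin b := fun x ↦
  contMDiffAt_hom_of_forall_smoothField (F' := E →L[ℝ] ℝ)
    (V' := fun x : M ↦ (TangentSpace I x →L[ℝ] ℝ)) fun X hX ↦
      smoothForm_of_forall (fun Y hY ↦ h X Y hX hY) x

/-- For a nondegenerate smooth bilinear form `b`, a vector field `W` is smooth if all the functions
`b(W, Z)` are. -/
theorem smoothField_of_bilin {b : BilinField I M} (hb : SmoothBilin b)
    (hnd : ∀ x v, (∀ w, b x v w = 0) → v = 0) {W : VField I M}
    (hW : ∀ Z : VField I M, SmoothField Z → CMDiff ∞ (fun x ↦ b x (W x) (Z x))) :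
    SmoothField W := by
  refine smoothField_of_bijective (F' := E →L[ℝ] ℝ)
    (V' := fun x : M ↦ (TangentSpace I x →L[ℝ] ℝ)) (A := b) hb (fun x ↦ ?_)
    (smoothForm_of_forall hW)
  have hinj : Function.Injective (b x).toLinearMap := by
    rw [← LinearMap.ker_eq_bot, LinearMap.ker_eq_bot']
    intro v hv
    exact hnd x v fun w ↦ by
      have := congrArg (fun f : TangentSpace I x →L[ℝ] ℝ ↦ f w) hv
      simpa using this
  have hfr : finrank ℝ (TangentSpace I x) = finrank ℝ (TangentSpace I x →L[ℝ] ℝ) := by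
    rw [← LinearEquiv.finrank_eq (LinearMap.toContinuousLinearMap (𝕜 := ℝ)
      (E := TangentSpace I x) (F' := ℝ))]
    exact (Subspace.dual_finrank_eq).symm
  exact ⟨hinj, (LinearMap.injective_iff_surjective_of_finrank_eq_finrank hfr).1 hinj⟩

end Smoothness

/-! ### Derivatives of functions and closedness of the exterior derivative -/

section Calculus

variable {E : Type*} [NormedAddCommGroup E] [NormedSpace ℝ E] [FiniteDimensional ℝ E]
  [CompleteSpace E] {H : Type*} [TopologicalSpace H] {I : ModelWithCorners ℝ E H}
  {M : Type*} [TopologicalSpace M] [ChartedSpace H M] [IsManifold I ∞ M]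

theorem dirDeriv_add (X : VField I M) {f f' : M → ℝ} {x : M} (hf : MDiffAt f x)
    (hf' : MDiffAt f' x) :
    dirDeriv X (fun y ↦ f y + f' y) x = dirDeriv X f x + dirDeriv X f' x := by
  simp [dirDeriv, mvfderiv_fun_add hf hf']

theorem dirDeriv_sub (X : VField I M) {f f' : M → ℝ} {x : M} (hf : MDiffAt f x)
    (hf' : MDiffAt f' x) :
    dirDeriv X (fun y ↦ f y - f' y) x = dirDeriv X f x - dirDeriv X f' x := by
  simp [dirDeriv, mvfderiv_fun_sub hf hf']

theorem dirDeriv_neg (X : VField I M) (f : M → ℝ) (x : M) :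
    dirDeriv X (fun y ↦ - f y) x = - dirDeriv X f x := by
  simp [dirDeriv, mvfderiv_fun_neg]

theorem dirDeriv_mul (X : VField I M) {f f' : M → ℝ} {x : M} (hf : MDiffAt f x)
    (hf' : MDiffAt f' x) :
    dirDeriv X (fun y ↦ f y * f' y) x = f x * dirDeriv X f' x + f' x * dirDeriv X f x := by
  simp [dirDeriv, mvfderiv_fun_mul hf hf']

theorem dirDeriv_const (X : VField I M) (c : ℝ) (x : M) : dirDeriv X (fun _ ↦ c) x = 0 := by
  rw [dirDeriv, mvfderiv_const]
  rfl

theorem dirDeriv_const_mul (X : VField I M) {f : M → ℝ} {x : M} (c : ℝ) (hf : MDiffAt f x) :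
    dirDeriv X (fun y ↦ c * f y) x = c * dirDeriv X f x := by
  rw [dirDeriv_mul X mdifferentiableAt_const hf, dirDeriv_const]
  ring

variable [T2Space M]

/-- The Lie bracket acts on functions as the commutator. This follows from the Jacobi identity for
`X`, `Y` and `f Z`, where `Z` does not vanish at the point. -/
theorem dirDeriv_bracket {X Y : VField I M} {f : M → ℝ} (hX : SmoothField X) (hY : SmoothField Y)
    (hf : CMDiff ∞ f) (x : M) :
    dirDeriv (bracket X Y) f x = dirDeriv X (dirDeriv Y f) x - dirDeriv Y (dirDeriv X f) x := by
  rcases subsingleton_or_nontrivial E with hE | hE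
  · have h0 (v : TangentSpace I x) : v = 0 := hE.elim (α := E) v 0
    simp only [dirDeriv, h0, map_zero]
    simp
  have hE' : Nontrivial (TangentSpace I x) := hE
  obtain ⟨v, hv⟩ := exists_ne (0 : TangentSpace I x)
  obtain ⟨Z, hZ, rfl⟩ := exists_smoothField x v
  have : IsManifold I (minSmoothness ℝ 3) M := by
    rw [minSmoothness_of_isRCLikeNormedField]
    exact IsManifold.of_le (n := ∞) (by exact WithTop.coe_le_coe.2 le_top)
  have le2 : minSmoothness ℝ 2 ≤ ∞ := by
    rw [minSmoothness_of_isRCLikeNormedField]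
    exact WithTop.coe_le_coe.2 le_top
  have hJ {U V W : VField I M} (hU : SmoothField U) (hV : SmoothField V) (hW : SmoothField W) :=
    VectorField.leibniz_identity_mlieBracket_apply (x := x) ((hU x).of_le le2) ((hV x).of_le le2)
      ((hW x).of_le le2)
  have sm {U : VField I M} (hU : SmoothField U) (W : VField I M) {f : M → ℝ}
      (hf : CMDiff ∞ f) : bracket W (f • U) = dirDeriv W f • U + f • bracket W U := by
    ext y
    simp only [bracket, VectorField.mlieBracket_smul_right (V := W) (mdiff_of_smooth hf y)
      (hU.mdiff y), dirDeriv, Pi.add_apply, Pi.smul_apply']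
  have addr {U U' : VField I M} (hU : SmoothField U) (hU' : SmoothField U') (W : VField I M) :
      bracket W (U + U') x = bracket W U x + bracket W U' x :=
    VectorField.mlieBracket_add_right (hU.mdiff x) (hU'.mdiff x)
  have e1 := hJ hX hY (SmoothField.smul hf hZ)
  have e2 := hJ hX hY hZ
  have dX := dirDeriv_smooth hX hf
  have dY := dirDeriv_smooth hY hf
  have key (U W : VField I M) (hU : SmoothField U) (hW : SmoothField W) :
      bracket U (bracket W (f • Z)) x = dirDeriv U (dirDeriv W f) x • Z x
        + dirDeriv W f x • bracket U Z x + (dirDeriv U f x • bracket W Z x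
        + f x • bracket U (bracket W Z) x) := by
    rw [sm hZ W hf, addr (U := dirDeriv W f • Z) (U' := f • bracket W Z)
      (SmoothField.smul (dirDeriv_smooth hW hf) hZ)
      (SmoothField.smul hf (bracket_smooth hW hZ)), sm hZ U (dirDeriv_smooth hW hf),
      sm (bracket_smooth hW hZ) U hf]
    rfl
  change bracket X (bracket Y (f • Z)) x = bracket (bracket X Y) (f • Z) x +
    bracket Y (bracket X (f • Z)) x at e1
  change bracket X (bracket Y Z) x = bracket (bracket X Y) Z x +
    bracket Y (bracket X Z) x at e2
  rw [key X Y hX hY, key Y X hY hX, e2, sm hZ (bracket X Y) hf] at e1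
  have e3 : (dirDeriv X (dirDeriv Y f) x - dirDeriv Y (dirDeriv X f) x
      - dirDeriv (bracket X Y) f x) • Z x = 0 := by
    simp only [Pi.add_apply, Pi.smul_apply'] at e1
    refine Eq.trans ?_ (sub_eq_zero.2 e1)
    module
  have := (smul_eq_zero.1 e3).resolve_right hv
  linarith

namespace OneForm

theorem d_smooth (η : OneForm I M) : SmoothBilin η.d := by
  refine smoothBilin_of_forall fun X Y hX hY ↦ ?_
  have e : (fun x ↦ η.d x (X x) (Y x)) = fun x ↦ (1 / 2) * (dirDeriv X (fun y ↦ η y (Y y)) x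
      - dirDeriv Y (fun y ↦ η y (X y)) x - η x (bracket X Y x)) := by
    ext x
    exact η.d_apply (hX.mdiff x) (hY.mdiff x)
  rw [e]
  exact contMDiff_const.mul (((dirDeriv_smooth hX (η.smooth.app hY)).sub
    (dirDeriv_smooth hY (η.smooth.app hX))).sub (η.smooth.app (bracket_smooth hX hY)))

theorem d_swap (η : OneForm I M) (x : M) (v w : TangentSpace I x) :
    η.d x v w = - η.d x w v := by
  obtain ⟨X, hX, rfl⟩ := exists_smoothField x v
  obtain ⟨Y, hY, rfl⟩ := exists_smoothField x w
  have h1 : η.d x (X x) (Y x) = η.dAux x X Y := η.d_apply (hX.mdiff x) (hY.mdiff x)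
  have h2 : η.d x (Y x) (X x) = η.dAux x Y X := η.d_apply (hY.mdiff x) (hX.mdiff x)
  rw [h1, h2, dAux_swap]

/-- The exterior derivative is closed: the terms with second derivatives cancel because the bracket
is the commutator of derivatives, and the terms with double brackets by the Jacobi identity. -/
theorem d_closed (η : OneForm I M) {X Y Z : VField I M} (hX : SmoothField X)
    (hY : SmoothField Y) (hZ : SmoothField Z) (x : M) :
    dirDeriv X (fun y ↦ η.d y (Y y) (Z y)) x + dirDeriv Y (fun y ↦ η.d y (Z y) (X y)) x
      + dirDeriv Z (fun y ↦ η.d y (X y) (Y y)) x - η.d x (bracket X Y x) (Z x)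
      - η.d x (bracket Y Z x) (X x) - η.d x (bracket Z X x) (Y x) = 0 := by
  have e {Y Z : VField I M} (hY : SmoothField Y) (hZ : SmoothField Z) (X : VField I M) :
      dirDeriv X (fun y ↦ η.d y (Y y) (Z y)) x =
      (1 / 2) * (dirDeriv X (dirDeriv Y fun y ↦ η y (Z y)) x
        - dirDeriv X (dirDeriv Z fun y ↦ η y (Y y)) x
        - dirDeriv X (fun y ↦ η y (bracket Y Z y)) x) := by
    have h1 := mdiff_of_smooth (dirDeriv_smooth hY (η.smooth.app hZ)) x
    have h2 := mdiff_of_smooth (dirDeriv_smooth hZ (η.smooth.app hY)) x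
    have h3 := mdiff_of_smooth (η.smooth.app (bracket_smooth hY hZ)) x
    have h4 : MDiffAt (fun y ↦ dirDeriv Y (fun y ↦ η y (Z y)) y
      - dirDeriv Z (fun y ↦ η y (Y y)) y) x := h1.sub h2
    have h5 : MDiffAt (fun y ↦ dirDeriv Y (fun y ↦ η y (Z y)) y
      - dirDeriv Z (fun y ↦ η y (Y y)) y - η y (bracket Y Z y)) x := h4.sub h3
    rw [← dirDeriv_sub X h1 h2, ← dirDeriv_sub X h4 h3, ← dirDeriv_const_mul X _ h5]
    congr 1
    ext y
    exact η.d_apply (hY.mdiff y) (hZ.mdiff y)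
  have f {Y Z : VField I M} (hY : SmoothField Y) (hZ : SmoothField Z) {X : VField I M}
      (hX : SmoothField X) : η.d x (bracket X Y x) (Z x) =
      (1 / 2) * (dirDeriv X (dirDeriv Y fun y ↦ η y (Z y)) x
        - dirDeriv Y (dirDeriv X fun y ↦ η y (Z y)) x
        - dirDeriv Z (fun y ↦ η y (bracket X Y y)) x - η x (bracket (bracket X Y) Z x)) := by
    rw [η.d_apply ((bracket_smooth hX hY).mdiff x) (hZ.mdiff x),
      dirDeriv_bracket hX hY (η.smooth.app hZ)]
  have : IsManifold I (minSmoothness ℝ 3) M := by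
    rw [minSmoothness_of_isRCLikeNormedField]
    exact IsManifold.of_le (n := ∞) (by exact WithTop.coe_le_coe.2 le_top)
  have le2 : minSmoothness ℝ 2 ≤ ∞ := by
    rw [minSmoothness_of_isRCLikeNormedField]
    exact WithTop.coe_le_coe.2 le_top
  have hJ : bracket X (bracket Y Z) x = bracket (bracket X Y) Z x + bracket Y (bracket X Z) x :=
    VectorField.leibniz_identity_mlieBracket_apply (x := x) ((hX x).of_le le2) ((hY x).of_le le2)
      ((hZ x).of_le le2)
  have s1 : bracket (bracket Y Z) X x = - bracket X (bracket Y Z) x :=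
    VectorField.mlieBracket_swap_apply
  have s2 : bracket (bracket Z X) Y x = bracket Y (bracket X Z) x := by
    rw [show bracket (bracket Z X) Y x = - bracket Y (bracket Z X) x from
      VectorField.mlieBracket_swap_apply, show bracket Z X = - bracket X Z from
      VectorField.mlieBracket_swap]
    have h := VectorField.mlieBracket_const_smul_right (I := I) (V := Y) (c := (-1 : ℝ))
      ((bracket_smooth hX hZ).mdiff x)
    simp only [neg_smul, one_smul] at h
    rw [bracket, h, neg_neg]
  have hη := congrArg (η x) hJ
  rw [map_add] at hη
  rw [e hY hZ, e hZ hX, e hX hY, f hY hZ hX, f hZ hX hY, f hX hY hZ, s1, s2, map_neg]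
  linear_combination (-1 / 2) * hη

end OneForm

end Calculus

/-! ### The Levi-Civita connection of a semi-Riemannian metric -/

section LeviCivita

variable {E : Type*} [NormedAddCommGroup E] [NormedSpace ℝ E] [FiniteDimensional ℝ E]
  [CompleteSpace E] {H : Type*} [TopologicalSpace H] {I : ModelWithCorners ℝ E H}
  {M : Type*} [TopologicalSpace M] [ChartedSpace H M] [IsManifold I ∞ M]

/-- A semi-Riemannian metric: a smooth symmetric nondegenerate bilinear form. -/
structure IsSemiRiemannian (g : BilinField I M) : Prop where
  smooth : SmoothBilin g
  symm : ∀ x v w, g x v w = g x w v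
  nondegenerate : ∀ x v, (∀ w, g x v w = 0) → v = 0

theorem SmoothBilin.mdifferentiableAt_apply {b : BilinField I M} (hb : SmoothBilin b) {x : M}
    {X Y : VField I M} (hX : MDiffAt (T% X) x) (hY : MDiffAt (T% Y) x) :
    MDiffAt (fun y ↦ b y (X y) (Y y)) x := by
  have h : MDifferentiableAt I (I.prod 𝓘(ℝ))
      (fun y ↦ Bundle.TotalSpace.mk' ℝ (E := Bundle.Trivial M ℝ) y (b y (X y) (Y y))) x := by
    apply MDifferentiableAt.clm_bundle_apply₂ (F₁ := E) (F₂ := E)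
    · exact (hb.mdifferentiable (by simp)) x
    · exact hX
    · exact hY
  simp only [mdifferentiableAt_totalSpace] at h
  exact h.2

/-- The right-hand side of the Koszul formula for `g(∇_X Y, Z)`. -/
def koszul (g : BilinField I M) (x : M) (Y X Z : VField I M) : ℝ :=
  (1 / 2) * (dirDeriv X (fun y ↦ g y (Y y) (Z y)) x + dirDeriv Y (fun y ↦ g y (X y) (Z y)) x
    - dirDeriv Z (fun y ↦ g y (X y) (Y y)) x + g x (bracket X Y x) (Z x)
    - g x (bracket Y Z x) (X x) + g x (bracket Z X x) (Y x))

theorem dirDeriv_smul_left (f : M → ℝ) (X : VField I M) (h : M → ℝ) (x : M) :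
    dirDeriv (f • X) h x = f x * dirDeriv X h x := by
  simp [dirDeriv]

theorem dirDeriv_add_left (X X' : VField I M) (h : M → ℝ) (x : M) :
    dirDeriv (X + X') h x = dirDeriv X h x + dirDeriv X' h x := by
  simp [dirDeriv]

theorem bracket_smul_left {f : M → ℝ} {X : VField I M} {x : M} (hf : MDiffAt f x)
    (hX : MDiffAt (T% X) x) (Y : VField I M) :
    bracket (f • X) Y x = - dirDeriv Y f x • X x + f x • bracket X Y x :=
  VectorField.mlieBracket_smul_left hf hX

theorem bracket_smul_right {f : M → ℝ} {X : VField I M} {x : M} (hf : MDiffAt f x)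
    (hX : MDiffAt (T% X) x) (Y : VField I M) :
    bracket Y (f • X) x = dirDeriv Y f x • X x + f x • bracket Y X x :=
  VectorField.mlieBracket_smul_right hf hX

theorem bracket_add_left {X X' : VField I M} {x : M} (hX : MDiffAt (T% X) x)
    (hX' : MDiffAt (T% X') x) (Y : VField I M) :
    bracket (X + X') Y x = bracket X Y x + bracket X' Y x :=
  VectorField.mlieBracket_add_left hX hX'

theorem bracket_add_right {X X' : VField I M} {x : M} (hX : MDiffAt (T% X) x)
    (hX' : MDiffAt (T% X') x) (Y : VField I M) :
    bracket Y (X + X') x = bracket Y X x + bracket Y X' x :=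
  VectorField.mlieBracket_add_right hX hX'

theorem bracket_swap (X Y : VField I M) (x : M) : bracket X Y x = - bracket Y X x :=
  VectorField.mlieBracket_swap_apply

namespace IsSemiRiemannian

variable {g : BilinField I M} (hg : IsSemiRiemannian g)
include hg

/-- Derivative of `g(f X, Z)`. -/
theorem dirDeriv_smul {f : M → ℝ} {X Z : VField I M} {x : M} (hf : MDiffAt f x)
    (hX : MDiffAt (T% X) x) (hZ : MDiffAt (T% Z) x) (W : VField I M) :
    dirDeriv W (fun y ↦ g y ((f • X) y) (Z y)) x
      = f x * dirDeriv W (fun y ↦ g y (X y) (Z y)) x + g x (X x) (Z x) * dirDeriv W f x := by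
  rw [← dirDeriv_mul W hf (hg.smooth.mdifferentiableAt_apply hX hZ)]
  congr 1
  ext y
  simp

theorem dirDeriv_add {X X' Z : VField I M} {x : M}
    (hX : MDiffAt (T% X) x) (hX' : MDiffAt (T% X') x) (hZ : MDiffAt (T% Z) x) (W : VField I M) :
    dirDeriv W (fun y ↦ g y ((X + X') y) (Z y)) x
      = dirDeriv W (fun y ↦ g y (X y) (Z y)) x + dirDeriv W (fun y ↦ g y (X' y) (Z y)) x := by
  rw [← BiLegendrian.dirDeriv_add W (hg.smooth.mdifferentiableAt_apply hX hZ)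
    (hg.smooth.mdifferentiableAt_apply hX' hZ)]
  congr 1
  ext y
  simp

theorem dirDeriv_symm (X Y Z : VField I M) (x : M) : dirDeriv X (fun y ↦ g y (Y y) (Z y)) x
    = dirDeriv X (fun y ↦ g y (Z y) (Y y)) x := by
  simp_rw [hg.symm _ (Y _) (Z _)]

theorem koszul_tensorial_left {x : M} {Y : VField I M} (hY : MDiffAt (T% Y) x) (Z : VField I M)
    (hZ : MDiffAt (T% Z) x) : TensorialAt I E (fun X : VField I M ↦ koszul g x Y X Z) x where
  smul {f X} hf hX := by
    simp only [koszul, hg.dirDeriv_smul hf hX hZ, hg.dirDeriv_smul hf hX hY]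
    simp only [dirDeriv_smul_left,
      bracket_smul_left hf hX, bracket_smul_right hf hX, map_add, map_smul,
      Pi.smul_apply', smul_eq_mul, add_apply, FunLike.coe_smul, Pi.smul_apply]
    ring
  add {X X'} hX hX' := by
    simp only [koszul, hg.dirDeriv_add hX hX' hZ, hg.dirDeriv_add hX hX' hY]
    simp only [dirDeriv_add_left,
      bracket_add_left hX hX', bracket_add_right hX hX', map_add, Pi.add_apply, add_apply]
    ring

theorem koszul_tensorial_right {x : M} {Y : VField I M} (hY : MDiffAt (T% Y) x) (X : VField I M)
    (hX : MDiffAt (T% X) x) : TensorialAt I E (fun Z : VField I M ↦ koszul g x Y X Z) x where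
  smul {f Z} hf hZ := by
    simp only [koszul, hg.dirDeriv_symm _ X (f • Z), hg.dirDeriv_symm _ Y (f • Z),
      hg.dirDeriv_symm _ X Z, hg.dirDeriv_symm _ Y Z,
      hg.dirDeriv_smul hf hZ hX, hg.dirDeriv_smul hf hZ hY]
    simp only [dirDeriv_smul_left,
      bracket_smul_left hf hZ, bracket_smul_right hf hZ, map_add, map_smul,
      Pi.smul_apply', smul_eq_mul, add_apply, FunLike.coe_smul, Pi.smul_apply]
    ring
  add {Z Z'} hZ hZ' := by
    simp only [koszul, hg.dirDeriv_symm _ X (Z + Z'), hg.dirDeriv_symm _ Y (Z + Z'),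
      hg.dirDeriv_symm _ X Z, hg.dirDeriv_symm _ Y Z, hg.dirDeriv_symm _ X Z',
      hg.dirDeriv_symm _ Y Z', hg.dirDeriv_add hZ hZ' hX, hg.dirDeriv_add hZ hZ' hY]
    simp only [dirDeriv_add_left,
      bracket_add_left hZ hZ', bracket_add_right hZ hZ', map_add, Pi.add_apply, add_apply]
    ring

theorem koszul_smul {x : M} {f : M → ℝ} {X Y Z : VField I M} (hf : MDiffAt f x)
    (hX : MDiffAt (T% X) x) (hY : MDiffAt (T% Y) x) (hZ : MDiffAt (T% Z) x) :
    koszul g x (f • Y) X Z = f x * koszul g x Y X Z + dirDeriv X f x * g x (Y x) (Z x) := by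
  simp only [koszul, hg.dirDeriv_symm _ X (f • Y), hg.dirDeriv_symm _ X Y,
      hg.dirDeriv_smul hf hY hX, hg.dirDeriv_smul hf hY hZ]
  simp only [dirDeriv_smul_left,
      bracket_smul_left hf hY, bracket_smul_right hf hY, map_add, map_smul,
      Pi.smul_apply', smul_eq_mul, add_apply, FunLike.coe_smul, Pi.smul_apply]
  rw [hg.symm x (Y x) (X x)]
  ring

theorem koszul_add {x : M} {X Y Y' Z : VField I M}
    (hX : MDiffAt (T% X) x) (hY : MDiffAt (T% Y) x) (hY' : MDiffAt (T% Y') x)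
    (hZ : MDiffAt (T% Z) x) :
    koszul g x (Y + Y') X Z = koszul g x Y X Z + koszul g x Y' X Z := by
  simp only [koszul, hg.dirDeriv_symm _ X (Y + Y'), hg.dirDeriv_symm _ X Y,
      hg.dirDeriv_symm _ X Y', hg.dirDeriv_add hY hY' hX, hg.dirDeriv_add hY hY' hZ]
  simp only [dirDeriv_add_left, bracket_add_left hY hY', bracket_add_right hY hY', map_add,
      Pi.add_apply, add_apply]
  ring

/-- The musical isomorphism of the metric at a point. -/
def flat (x : M) : TangentSpace I x ≃L[ℝ] (TangentSpace I x →L[ℝ] ℝ) :=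
  (LinearEquiv.ofInjectiveOfFinrankEq (g x).toLinearMap
    (by
      rw [← LinearMap.ker_eq_bot, LinearMap.ker_eq_bot']
      intro v hv
      exact hg.nondegenerate x v fun w ↦ by
        have := congrArg (fun f : TangentSpace I x →L[ℝ] ℝ ↦ f w) hv
        simpa using this)
    (by
      rw [← LinearEquiv.finrank_eq (LinearMap.toContinuousLinearMap (𝕜 := ℝ)
        (E := TangentSpace I x) (F' := ℝ))]
      exact (Subspace.dual_finrank_eq).symm)).toContinuousLinearEquiv

theorem apply_flat_symm (x : M) (α : TangentSpace I x →L[ℝ] ℝ) (w : TangentSpace I x) :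
    g x ((hg.flat x).symm α) w = α w := by
  have h : g x ((hg.flat x).symm α) = α := (hg.flat x).apply_symm_apply α
  rw [h]

open Classical in
/-- The covariant derivative determined by the Koszul formula. It is set to zero on vector fields
which are not differentiable at the point. -/
def leviCivitaFun (Y : VField I M) (x : M) : TangentSpace I x →L[ℝ] TangentSpace I x :=
  if hY : MDiffAt (T% Y) x then
    ((hg.flat x).symm : (TangentSpace I x →L[ℝ] ℝ) →L[ℝ] TangentSpace I x).comp
      (TensorialAt.mkHom₂ (F := E) (F' := E) (I := I) (koszul g x Y) x
        (hg.koszul_tensorial_left hY) (hg.koszul_tensorial_right hY))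
  else 0

/-- The Koszul formula. -/
theorem leviCivitaFun_apply {x : M} {X Y Z : VField I M}
    (hX : MDiffAt (T% X) x) (hY : MDiffAt (T% Y) x) (hZ : MDiffAt (T% Z) x) :
    g x (hg.leviCivitaFun Y x (X x)) (Z x) = koszul g x Y X Z := by
  rw [leviCivitaFun, dif_pos hY]
  change g x ((hg.flat x).symm _) (Z x) = _
  rw [apply_flat_symm]
  exact TensorialAt.mkHom₂_apply _ _ hX hZ

variable [T2Space M]

theorem ext_apply {x : M} {v w : TangentSpace I x}
    (h : ∀ Z : VField I M, SmoothField Z → g x v (Z x) = g x w (Z x)) : v = w := by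
  rw [← sub_eq_zero]
  refine hg.nondegenerate x _ fun u ↦ ?_
  obtain ⟨Z, hZ, rfl⟩ := exists_smoothField x u
  simp [h Z hZ]

/-- The Levi-Civita connection of a semi-Riemannian metric. -/
def leviCivita : Connection I M where
  toFun := hg.leviCivitaFun
  isCovariantDerivativeOnUniv :=
    { add := fun {Y Y' x} hY hY' _ ↦ by
        ext v
        obtain ⟨X, hX, rfl⟩ := exists_smoothField x v
        refine hg.ext_apply fun Z hZ ↦ ?_
        rw [hg.leviCivitaFun_apply (hX.mdiff x) (mdifferentiableAt_add_section hY hY')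
          (hZ.mdiff x), hg.koszul_add (hX.mdiff x) hY hY' (hZ.mdiff x)]
        simp [hg.leviCivitaFun_apply (hX.mdiff x) hY (hZ.mdiff x),
          hg.leviCivitaFun_apply (hX.mdiff x) hY' (hZ.mdiff x)]
      leibniz := fun {Y f x} hY hf _ ↦ by
        ext v
        obtain ⟨X, hX, rfl⟩ := exists_smoothField x v
        refine hg.ext_apply fun Z hZ ↦ ?_
        rw [hg.leviCivitaFun_apply (hX.mdiff x) (hf.smul_section hY)
          (hZ.mdiff x), hg.koszul_smul hf (hX.mdiff x) hY (hZ.mdiff x)]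
        simp [hg.leviCivitaFun_apply (hX.mdiff x) hY (hZ.mdiff x), dirDeriv] }

theorem leviCivita_apply {x : M} {X Y Z : VField I M}
    (hX : SmoothField X) (hY : SmoothField Y) (hZ : SmoothField Z) :
    g x (hg.leviCivita.cov X Y x) (Z x) = koszul g x Y X Z :=
  hg.leviCivitaFun_apply (hX.mdiff x) (hY.mdiff x) (hZ.mdiff x)

end IsSemiRiemannian

variable [T2Space M]

namespace Connection

/-- A connection is smooth as soon as `∇_X Y` is smooth for smooth `X` and `Y`. -/
theorem smooth_of_forall {D : Connection I M}
    (h : ∀ X Y : VField I M, SmoothField X → SmoothField Y → SmoothField (D.cov X Y)) :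
    D.Smooth where
  contMDiff :=
    { contMDiff := fun {Y} hY ↦ by
        have hY' : SmoothField Y := by
          rw [contMDiffOn_univ] at hY
          exact hY
        intro x _
        exact (contMDiffAt_hom_of_forall_smoothField (F' := E)
          fun X hX ↦ h X Y hX hY' x).contMDiffWithinAt }

theorem Smooth.cov {D : Connection I M} (hD : D.Smooth) {X Y : VField I M} (hX : SmoothField X)
    (hY : SmoothField Y) : SmoothField (D.cov X Y) := by
  intro x
  have h := hD.contMDiff.contMDiff (σ := Y) (by
    rw [contMDiffOn_univ]
    exact hY)
  exact ContMDiffAt.clm_bundle_apply (F₁ := E) (F₂ := E)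
    ((h x trivial).contMDiffAt univ_mem) (hX x)

end Connection

theorem IsSemiRiemannian.isLeviCivita {g : BilinField I M} (hg : IsSemiRiemannian g) :
    hg.leviCivita.IsLeviCivita g where
  smooth := by
    refine Connection.smooth_of_forall fun X Y hX hY ↦ ?_
    refine smoothField_of_bilin hg.smooth hg.nondegenerate fun Z hZ ↦ ?_
    have e : (fun x ↦ g x (hg.leviCivita.cov X Y x) (Z x)) = fun x ↦ koszul g x Y X Z := by
      ext x
      exact hg.leviCivita_apply hX hY hZ
    have hs := hg.smooth
    rw [e]
    exact contMDiff_const.mul ((((((dirDeriv_smooth hX (hs.app hY hZ)).add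
      (dirDeriv_smooth hY (hs.app hX hZ))).sub (dirDeriv_smooth hZ (hs.app hX hY))).add
      (hs.app (bracket_smooth hX hY) hZ)).sub (hs.app (bracket_smooth hY hZ) hX)).add
      (hs.app (bracket_smooth hZ hX) hY))
  metric := by
    intro X Y Z hX hY hZ x
    rw [Connection.covBilin, hg.symm x (Y x), hg.leviCivita_apply hX hY hZ,
      hg.leviCivita_apply hX hZ hY]
    simp only [koszul]
    rw [hg.dirDeriv_symm Z X Y, hg.dirDeriv_symm X Z Y, hg.dirDeriv_symm Y X Z,
      hg.dirDeriv_symm Z Y X, hg.dirDeriv_symm Y Z X, bracket_swap X Z, bracket_swap Z Y,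
      bracket_swap Y X]
    simp only [map_neg, neg_apply]
    ring
  torsion_free := by
    intro x
    ext v w
    obtain ⟨X, hX, rfl⟩ := exists_smoothField x v
    obtain ⟨Y, hY, rfl⟩ := exists_smoothField x w
    refine hg.ext_apply fun Z hZ ↦ ?_
    have h1 := hg.leviCivita_apply (x := x) hX hY hZ
    have h2 := hg.leviCivita_apply (x := x) hY hX hZ
    simp only [Connection.cov] at h1 h2
    rw [CovariantDerivative.torsion_apply _ (hX.mdiff x) (hY.mdiff x)]
    simp only [map_sub, sub_apply, h1, h2, zero_apply, map_zero]
    simp only [koszul]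
    rw [hg.dirDeriv_symm Z X Y, bracket_swap X Z, bracket_swap Z Y, bracket_swap Y X]
    simp only [map_neg, neg_apply]
    change _ - g x (bracket X Y x) (Z x) = 0
    ring

end LeviCivita

/-! ### Linear algebra of contact forms -/

section ContactAlgebra

variable {V : Type*} [AddCommGroup V] [Module ℝ V] [FiniteDimensional ℝ V] {n : ℕ}

/-- The multilinear map `(v₀, …, v₂ₙ) ↦ η(v₀) Ω(v₁, v₂) ⋯ Ω(v₂ₙ₋₁, v₂ₙ)`, whose alternatization is
`η ∧ Ωⁿ` up to a factor. -/
def contactMultilinear (n : ℕ) (η : V →ₗ[ℝ] ℝ) (Ω : V →ₗ[ℝ] V →ₗ[ℝ] ℝ) :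
    MultilinearMap ℝ (fun _ : Fin (2 * n + 1) ↦ V) ℝ :=
  -- only one factor depends on any given argument
  have key (v : Fin (2 * n + 1) → V) (i : Fin (2 * n + 1)) : ∃ f : V →ₗ[ℝ] ℝ, ∀ x,
      η (Function.update v i x 0) * ∏ k : Fin n, Ω (Function.update v i x ⟨2 * k + 1, by omega⟩)
        (Function.update v i x ⟨2 * k + 2, by omega⟩) = f x := by
    obtain ⟨i, hi⟩ := i
    rcases Nat.eq_zero_or_pos i with rfl | h0
    · refine ⟨(∏ k : Fin n, Ω (v ⟨2 * k + 1, by omega⟩) (v ⟨2 * k + 2, by omega⟩)) • η,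
        fun x ↦ ?_⟩
      simp [Fin.ext_iff, mul_comm]
    · have hi0 : (0 : Fin (2 * n + 1)) ≠ ⟨i, hi⟩ := by
        simp only [ne_eq, Fin.ext_iff, Fin.val_zero]; omega
      let k₀ : Fin n := ⟨(i - 1) / 2, by omega⟩
      let c : ℝ := η (v 0) * ∏ k ∈ Finset.univ.erase k₀,
        Ω (v ⟨2 * k + 1, by omega⟩) (v ⟨2 * k + 2, by omega⟩)
      have h1 (x : V) : η (Function.update v ⟨i, hi⟩ x 0) * ∏ k : Fin n,
          Ω (Function.update v ⟨i, hi⟩ x ⟨2 * k + 1, by omega⟩)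
            (Function.update v ⟨i, hi⟩ x ⟨2 * k + 2, by omega⟩) =
          c * Ω (Function.update v ⟨i, hi⟩ x ⟨2 * k₀ + 1, by omega⟩)
            (Function.update v ⟨i, hi⟩ x ⟨2 * k₀ + 2, by omega⟩) := by
        rw [← Finset.mul_prod_erase Finset.univ _ (Finset.mem_univ k₀),
          Function.update_of_ne hi0]
        have h2 : ∏ k ∈ Finset.univ.erase k₀,
            Ω (Function.update v ⟨i, hi⟩ x ⟨2 * k + 1, by omega⟩)
              (Function.update v ⟨i, hi⟩ x ⟨2 * k + 2, by omega⟩) =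
            ∏ k ∈ Finset.univ.erase k₀,
              Ω (v ⟨2 * k + 1, by omega⟩) (v ⟨2 * k + 2, by omega⟩) := by
          refine Finset.prod_congr rfl fun k hk ↦ ?_
          have hk' : (k : ℕ) ≠ (i - 1) / 2 := fun h ↦
            (Finset.ne_of_mem_erase hk) (Fin.ext h)
          rw [Function.update_of_ne (by simp only [ne_eq, Fin.mk.injEq]; omega),
            Function.update_of_ne (by simp only [ne_eq, Fin.mk.injEq]; omega)]
        rw [h2]
        ring
      rcases Nat.even_or_odd' i with ⟨m, rfl | rfl⟩
      · have e1 : (⟨2 * k₀ + 2, by omega⟩ : Fin (2 * n + 1)) = ⟨2 * m, hi⟩ := by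
          simp only [k₀, Fin.mk.injEq]; omega
        refine ⟨c • Ω (v ⟨2 * k₀ + 1, by omega⟩), fun x ↦ ?_⟩
        rw [h1 x, e1, Function.update_self, Function.update_of_ne
          (by simp only [k₀, ne_eq, Fin.mk.injEq]; omega)]
        rfl
      · have e1 : (⟨2 * k₀ + 1, by omega⟩ : Fin (2 * n + 1)) = ⟨2 * m + 1, hi⟩ := by
          simp only [k₀, Fin.mk.injEq]; omega
        refine ⟨c • Ω.flip (v ⟨2 * k₀ + 2, by omega⟩), fun x ↦ ?_⟩
        rw [h1 x, e1, Function.update_self, Function.update_of_ne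
          (by simp only [k₀, ne_eq, Fin.mk.injEq]; omega)]
        rfl
  { toFun := fun v ↦ η (v 0) *
      ∏ k : Fin n, Ω (v ⟨2 * k + 1, by omega⟩) (v ⟨2 * k + 2, by omega⟩)
    map_update_add' := fun {hd} v i x y ↦ by
      obtain rfl : hd = instDecidableEqFin _ := Subsingleton.elim _ _
      obtain ⟨f, hf⟩ := key v i
      simp only [hf, map_add]
    map_update_smul' := fun {hd} v i c x ↦ by
      obtain rfl : hd = instDecidableEqFin _ := Subsingleton.elim _ _
      obtain ⟨f, hf⟩ := key v i
      simp only [hf, map_smul] }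

theorem contactMultilinear_eq_zero {η : V →ₗ[ℝ] ℝ} {Ω : V →ₗ[ℝ] V →ₗ[ℝ] ℝ}
    (hΩ : ∀ v w, Ω v w = - Ω w v) {w : V} (h1 : η w = 0) (h2 : ∀ v, Ω w v = 0)
    {v : Fin (2 * n + 1) → V} (i : Fin (2 * n + 1)) (hi : v i = w) :
    contactMultilinear n η Ω v = 0 := by
  have h3 (v : V) : Ω v w = 0 := by rw [hΩ, h2, neg_zero]
  change η (v 0) * ∏ k : Fin n, Ω (v ⟨2 * k + 1, by omega⟩) (v ⟨2 * k + 2, by omega⟩) = 0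
  obtain ⟨i, hi'⟩ := i
  rcases Nat.eq_zero_or_pos i with rfl | h0
  · have : v 0 = w := hi
    rw [this, h1, zero_mul]
  · rw [Finset.prod_eq_zero (Finset.mem_univ (⟨(i - 1) / 2, by omega⟩ : Fin n)), mul_zero]
    rcases Nat.even_or_odd' i with ⟨m, rfl | rfl⟩
    · have e1 : (⟨2 * ((2 * m - 1) / 2) + 2, by omega⟩ : Fin (2 * n + 1)) = ⟨2 * m, hi'⟩ := by
        simp only [Fin.mk.injEq]; omega
      simp only [e1, hi, h3]
    · have e1 : (⟨2 * ((2 * m + 1 - 1) / 2) + 1, by omega⟩ : Fin (2 * n + 1)) =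
        ⟨2 * m + 1, hi'⟩ := by
        simp only [Fin.mk.injEq]; omega
      simp only [e1, hi, h2]

/-- If `η ∧ Ωⁿ ≠ 0` in dimension `2 n + 1`, then `ker η ∩ ker Ω = 0`: otherwise the form
`η ∧ Ωⁿ` of top degree would vanish on a basis. -/
theorem eq_zero_of_contact (hV : finrank ℝ V = 2 * n + 1) {η : V →ₗ[ℝ] ℝ}
    {Ω : V →ₗ[ℝ] V →ₗ[ℝ] ℝ} (hΩ : ∀ v w, Ω v w = - Ω w v) {v : Fin (2 * n + 1) → V}
    (hv : ∑ σ : Equiv.Perm (Fin (2 * n + 1)), ((Equiv.Perm.sign σ : ℤ) : ℝ) * η (v (σ 0)) *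
      ∏ i : Fin n, Ω (v (σ ⟨2 * i + 1, by omega⟩)) (v (σ ⟨2 * i + 2, by omega⟩)) ≠ 0)
    {w : V} (h1 : η w = 0) (h2 : ∀ v, Ω w v = 0) : w = 0 := by
  set Φ := MultilinearMap.alternatization (contactMultilinear n η Ω) with hΦ
  have happ (u : Fin (2 * n + 1) → V) : Φ u = ∑ σ : Equiv.Perm (Fin (2 * n + 1)),
      ((Equiv.Perm.sign σ : ℤ) : ℝ) * contactMultilinear n η Ω (u ∘ σ) := by
    rw [hΦ, MultilinearMap.alternatization_apply]
    refine Finset.sum_congr rfl fun σ _ ↦ ?_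
    rw [Units.smul_def, zsmul_eq_mul]
    rfl
  have hne : Φ ≠ 0 := by
    intro h0
    apply hv
    have := happ v
    rw [h0, AlternatingMap.zero_apply] at this
    rw [this]
    refine Finset.sum_congr rfl fun σ _ ↦ ?_
    rw [mul_assoc]
    rfl
  let b : Basis (Fin (2 * n + 1)) ℝ V := finBasisOfFinrankEq ℝ V hV
  have hb : Φ b ≠ 0 := (AlternatingMap.map_basis_ne_zero_iff b Φ).2 hne
  refine b.ext_elem fun j ↦ ?_
  -- replacing the `j`-th basis vector by `w` multiplies `Φ b` by the `j`-th coordinate of `w`,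
  -- but gives `0`, because every term contains `η w` or `Ω w`
  have h0 : Φ (Function.update b j w) = 0 := by
    rw [happ]
    refine Finset.sum_eq_zero fun σ _ ↦ ?_
    rw [contactMultilinear_eq_zero hΩ h1 h2 (σ⁻¹ j) (by simp), mul_zero]
  have h3 : Φ (Function.update b j w) = b.repr w j * Φ b := by
    conv_lhs => rw [← b.sum_repr w]
    rw [AlternatingMap.map_update_sum]
    rw [Finset.sum_eq_single j]
    · rw [AlternatingMap.map_update_smul, Function.update_eq_self, smul_eq_mul]
    · intro i _ hij
      rw [AlternatingMap.map_update_smul, AlternatingMap.map_update_self _ _ hij.symm, smul_zero]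
    · simp
  rw [h0] at h3
  simpa using (mul_eq_zero.1 h3.symm).resolve_right hb

/-- A skew-symmetric form on a space of odd dimension is degenerate. -/
theorem exists_ne_zero_of_skew (hV : finrank ℝ V = 2 * n + 1)
    {Ω : V →ₗ[ℝ] V →ₗ[ℝ] ℝ} (hΩ : ∀ v w, Ω v w = - Ω w v) : ∃ w : V, w ≠ 0 ∧ ∀ v, Ω w v = 0 := by
  let b : Basis (Fin (2 * n + 1)) ℝ V := finBasisOfFinrankEq ℝ V hV
  let A : Matrix (Fin (2 * n + 1)) (Fin (2 * n + 1)) ℝ := Matrix.of fun i j ↦ Ω (b i) (b j)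
  have hA : A.transpose = -A := by
    ext i j
    simp [A, hΩ (b j) (b i)]
  have hdet : A.det = 0 := by
    have h := A.det_transpose
    rw [hA, Matrix.det_neg, Fintype.card_fin, Odd.neg_one_pow ⟨n, rfl⟩] at h
    linarith
  obtain ⟨c, hc, hcA⟩ := Matrix.exists_vecMul_eq_zero_iff.2 hdet
  refine ⟨∑ i, c i • b i, fun h ↦ hc ?_, fun v ↦ ?_⟩
  · ext i
    exact Fintype.linearIndependent_iff.1 b.linearIndependent c h i
  · have : Ω (∑ i, c i • b i) = 0 := b.ext fun j ↦ by
      have := congrFun hcA j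
      simpa [Matrix.vecMul, dotProduct, A] using this
    rw [this, LinearMap.zero_apply]

end ContactAlgebra

/-! ### The Reeb field and the projections of an almost bi-Legendrian structure -/

section Structure

variable {E : Type*} [NormedAddCommGroup E] [NormedSpace ℝ E] [FiniteDimensional ℝ E]
  [CompleteSpace E] {H : Type*} [TopologicalSpace H] {I : ModelWithCorners ℝ E H}
  {M : Type*} [TopologicalSpace M] [ChartedSpace H M] [IsManifold I ∞ M] [T2Space M] {n : ℕ}

theorem IsLegendrian.finrank_eq {η : OneForm I M} {L : Distribution I M}
    (h : IsLegendrian n η L) (x : M) : finrank ℝ (L x) = n := by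
  obtain ⟨U, -, hx, X, -, hX⟩ := h.subbundle x
  rw [← (hX x hx).2, finrank_span_eq_card (hX x hx).1, Fintype.card_fin]

namespace AlmostBiLegendrian

/-- The same structure with the two Legendrian distributions exchanged. -/
def swap (B : AlmostBiLegendrian I M n) : AlmostBiLegendrian I M n where
  η := B.η
  contact := B.contact
  L₁ := B.L₂
  L₂ := B.L₁
  legendrian₁ := B.legendrian₂
  legendrian₂ := B.legendrian₁
  transversal x := (B.transversal x).symm

variable [hE : Fact (finrank ℝ E = 2 * n + 1)] (B : AlmostBiLegendrian I M n)
include hE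

theorem finrank_tangentSpace (x : M) : finrank ℝ (TangentSpace I x) = 2 * n + 1 := hE.out

/-- The form `dη` is nondegenerate on `ker η`. -/
theorem eq_zero_of_contact {x : M} {w : TangentSpace I x} (h1 : B.η x w = 0)
    (h2 : ∀ v, B.η.d x w v = 0) : w = 0 := by
  obtain ⟨v, hv⟩ := B.contact x
  let Ω : TangentSpace I x →ₗ[ℝ] TangentSpace I x →ₗ[ℝ] ℝ :=
    ContinuousLinearMap.coeLM ℝ ∘ₗ (B.η.d x).toLinearMap
  exact BiLegendrian.eq_zero_of_contact (η := (B.η x).toLinearMap) (Ω := Ω)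
    (finrank_tangentSpace x) (B.η.d_swap x) hv h1 h2

/-- A vector in the kernel of the degenerate form `dη` can be normalised, because it is not
in `ker η`. -/
theorem exists_reeb (x : M) : ∃ v : TangentSpace I x, B.η x v = 1 ∧ ∀ w, B.η.d x v w = 0 := by
  let Ω : TangentSpace I x →ₗ[ℝ] TangentSpace I x →ₗ[ℝ] ℝ :=
    ContinuousLinearMap.coeLM ℝ ∘ₗ (B.η.d x).toLinearMap
  obtain ⟨w, hw, h⟩ := exists_ne_zero_of_skew (Ω := Ω) (finrank_tangentSpace (n := n) x) (B.η.d_swap x)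
  have hη : B.η x w ≠ 0 := fun h0 ↦ hw (B.eq_zero_of_contact h0 h)
  refine ⟨(B.η x w)⁻¹ • w, ?_, fun v ↦ ?_⟩
  · rw [map_smul, smul_eq_mul, inv_mul_cancel₀ hη]
  · rw [map_smul]
    change (B.η x w)⁻¹ * Ω w v = 0
    rw [h, mul_zero]

@[simp]
theorem η_reeb (x : M) : B.η x (B.reeb x) = 1 := by
  rw [reeb, OneForm.reeb, dif_pos (B.exists_reeb x)]
  exact (B.exists_reeb x).choose_spec.1

@[simp]
theorem d_reeb_left (x : M) (w : TangentSpace I x) : B.η.d x (B.reeb x) w = 0 := by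
  rw [reeb, OneForm.reeb, dif_pos (B.exists_reeb x)]
  exact (B.exists_reeb x).choose_spec.2 w

@[simp]
theorem d_reeb_right (x : M) (w : TangentSpace I x) : B.η.d x w (B.reeb x) = 0 := by
  rw [OneForm.d_swap, d_reeb_left, neg_zero]

/-- The form `dη + η ⊗ η` is nondegenerate and `ξ` is the vector field dual to `η`. -/
theorem reeb_smooth : SmoothField B.reeb := by
  have hb : SmoothBilin (fun x ↦ B.η.d x + (B.η x).smulRight (B.η x)) := by
    refine smoothBilin_of_forall fun X Y hX hY ↦ ?_
    exact (B.η.d_smooth.app hX hY).add ((B.η.smooth.app hX).mul (B.η.smooth.app hY))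
  refine smoothField_of_bilin hb (fun x v hv ↦ ?_) fun Z hZ ↦ ?_
  · have h1 : B.η x v = 0 := by simpa using hv (B.reeb x)
    refine B.eq_zero_of_contact h1 fun w ↦ ?_
    simpa [h1] using hv w
  · simpa using B.η.smooth.app hZ

theorem η_L₁ {x : M} {v : TangentSpace I x} (hv : v ∈ B.L₁ x) : B.η x v = 0 :=
  B.legendrian₁.le_kernel x hv

theorem η_L₂ {x : M} {v : TangentSpace I x} (hv : v ∈ B.L₂ x) : B.η x v = 0 :=
  B.swap.η_L₁ hv

theorem isCompl₁ (x : M) : IsCompl (B.L₁ x) (B.L₂ x ⊔ lineField B.reeb x) := by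
  have h1 : ∀ v ∈ lineField B.reeb x, B.η x v = 0 → v = 0 := by
    intro v hv h0
    obtain ⟨c, rfl⟩ := Submodule.mem_span_singleton.1 hv
    have : c = 0 := by simpa using h0
    rw [this, zero_smul]
  have hd : Disjoint (B.L₁ x) (B.L₂ x ⊔ lineField B.reeb x) := by
    rw [Submodule.disjoint_def]
    intro v hv hv'
    obtain ⟨w, hw, u, hu, rfl⟩ := Submodule.mem_sup.1 hv'
    have h0 : B.η x u = 0 := by
      have := B.η_L₁ hv
      rwa [map_add, B.η_L₂ hw, zero_add] at this
    rw [h1 u hu h0, add_zero] at hv ⊢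
    exact Submodule.disjoint_def.1 (B.transversal x) w hv hw
  have hd' : B.L₂ x ⊓ lineField B.reeb x = ⊥ := by
    rw [← disjoint_iff, Submodule.disjoint_def]
    intro v hv hv'
    exact h1 v hv' (B.η_L₂ hv)
  rw [Submodule.isCompl_iff_disjoint _ _ ?_]
  · exact hd
  · have h2 := Submodule.finrank_sup_add_finrank_inf_eq (B.L₂ x) (lineField B.reeb x)
    have hne : B.reeb x ≠ 0 := fun h ↦ by simpa [h] using B.η_reeb x
    rw [hd', finrank_bot, lineField, finrank_span_singleton hne] at h2
    rw [finrank_tangentSpace (n := n) x, lineField, B.legendrian₁.finrank_eq]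
    rw [B.legendrian₂.finrank_eq] at h2
    omega

theorem proj₁_apply (x : M) (v : TangentSpace I x) :
    B.proj₁ x v = (B.L₁ x).projection _ (B.isCompl₁ x) v := by
  rw [proj₁, projAlong, dif_pos (B.isCompl₁ x)]
  rfl

theorem proj₁_mem (x : M) (v : TangentSpace I x) : B.proj₁ x v ∈ B.L₁ x := by
  rw [proj₁_apply]
  exact Submodule.projection_apply_mem _ _

theorem proj₂_mem (x : M) (v : TangentSpace I x) : B.proj₂ x v ∈ B.L₂ x := B.swap.proj₁_mem x v

theorem proj₁_L₁ {x : M} {v : TangentSpace I x} (hv : v ∈ B.L₁ x) : B.proj₁ x v = v := by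
  rw [proj₁_apply, Submodule.projection_apply_of_mem_left _ hv]

theorem proj₂_L₂ {x : M} {v : TangentSpace I x} (hv : v ∈ B.L₂ x) : B.proj₂ x v = v :=
  B.swap.proj₁_L₁ hv

theorem proj₁_L₂ {x : M} {v : TangentSpace I x} (hv : v ∈ B.L₂ x) : B.proj₁ x v = 0 := by
  rw [proj₁_apply, Submodule.projection_apply_eq_zero_iff]
  exact Submodule.mem_sup_left hv

theorem proj₂_L₁ {x : M} {v : TangentSpace I x} (hv : v ∈ B.L₁ x) : B.proj₂ x v = 0 :=
  B.swap.proj₁_L₂ hv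

@[simp]
theorem proj₁_reeb (x : M) : B.proj₁ x (B.reeb x) = 0 := by
  rw [proj₁_apply, Submodule.projection_apply_eq_zero_iff]
  exact Submodule.mem_sup_right (Submodule.mem_span_singleton_self _)

@[simp]
theorem proj₂_reeb (x : M) : B.proj₂ x (B.reeb x) = 0 := B.swap.proj₁_reeb x

@[simp]
theorem proj₁_proj₁ (x : M) (v : TangentSpace I x) : B.proj₁ x (B.proj₁ x v) = B.proj₁ x v :=
  B.proj₁_L₁ (B.proj₁_mem x v)

@[simp]
theorem proj₂_proj₂ (x : M) (v : TangentSpace I x) : B.proj₂ x (B.proj₂ x v) = B.proj₂ x v :=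
  B.proj₂_L₂ (B.proj₂_mem x v)

@[simp]
theorem proj₁_proj₂ (x : M) (v : TangentSpace I x) : B.proj₁ x (B.proj₂ x v) = 0 :=
  B.proj₁_L₂ (B.proj₂_mem x v)

@[simp]
theorem proj₂_proj₁ (x : M) (v : TangentSpace I x) : B.proj₂ x (B.proj₁ x v) = 0 :=
  B.proj₂_L₁ (B.proj₁_mem x v)

@[simp]
theorem η_proj₁ (x : M) (v : TangentSpace I x) : B.η x (B.proj₁ x v) = 0 :=
  B.η_L₁ (B.proj₁_mem x v)

@[simp]
theorem η_proj₂ (x : M) (v : TangentSpace I x) : B.η x (B.proj₂ x v) = 0 :=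
  B.η_L₂ (B.proj₂_mem x v)

@[simp]
theorem d_proj₁_proj₁ (x : M) (v w : TangentSpace I x) :
    B.η.d x (B.proj₁ x v) (B.proj₁ x w) = 0 :=
  B.legendrian₁.isotropic x _ (B.proj₁_mem x v) _ (B.proj₁_mem x w)

@[simp]
theorem d_proj₂_proj₂ (x : M) (v w : TangentSpace I x) :
    B.η.d x (B.proj₂ x v) (B.proj₂ x w) = 0 :=
  B.legendrian₂.isotropic x _ (B.proj₂_mem x v) _ (B.proj₂_mem x w)

theorem decomp (x : M) (v : TangentSpace I x) :
    v = B.proj₁ x v + B.proj₂ x v + B.η x v • B.reeb x := by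
  have h : v - B.proj₁ x v ∈ B.L₂ x ⊔ lineField B.reeb x := by
    rw [proj₁_apply]
    exact Submodule.sub_projection_mem _ _
  obtain ⟨w, hw, u, hu, h⟩ := Submodule.mem_sup.1 h
  obtain ⟨c, rfl⟩ := Submodule.mem_span_singleton.1 hu
  have hv : v = B.proj₁ x v + w + c • B.reeb x := by
    rw [add_assoc, h]; abel
  have h1 := congrArg (B.η x) hv
  have h2 := congrArg (B.proj₂ x) hv
  simp only [map_add, map_smul, η_proj₁, B.η_L₂ hw, η_reeb, zero_add, smul_eq_mul, mul_one] at h1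
  simp only [map_add, map_smul, proj₂_proj₁, B.proj₂_L₂ hw, proj₂_reeb, zero_add, smul_zero,
    add_zero] at h2
  rw [h1, h2]
  exact hv

/-- In a smooth frame adapted to `TM = L₁ ⊕ L₂ ⊕ ℝ ξ`, the projection to `L₁` only keeps the
coefficients of the frame of `L₁`. -/
theorem proj₁_smooth : SmoothEnd B.proj₁ := by
  refine smoothEnd_of_forall fun W hW x ↦ ?_
  obtain ⟨U₁, hU₁, hx₁, X, hXs, hX⟩ := B.legendrian₁.subbundle x
  obtain ⟨U₂, hU₂, hx₂, Y, hYs, hY⟩ := B.legendrian₂.subbundle x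
  -- the adapted frame: frames of `L₁` and `L₂`, and `ξ`
  let s : (Fin n ⊕ Fin n) ⊕ Unit → VField I M :=
    Sum.elim (Sum.elim X Y) (fun _ ↦ B.reeb)
  have hgen {y : M} (hy : y ∈ U₁ ∩ U₂) : ⊤ ≤ Submodule.span ℝ (Set.range fun i ↦ s i y) := by
    have hr : (Set.range fun i ↦ s i y) =
        ((Set.range fun i ↦ X i y) ∪ (Set.range fun i ↦ Y i y)) ∪ {B.reeb y} := by
      have : (fun i ↦ s i y) =
          Sum.elim (Sum.elim (fun i ↦ X i y) (fun i ↦ Y i y)) (fun _ ↦ B.reeb y) := by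
        ext i
        rcases i with (i | i) | i <;> rfl
      rw [this, Set.Sum.elim_range, Set.Sum.elim_range]
      simp
    rw [hr, Submodule.span_union, Submodule.span_union, (hX y hy.1).2, (hY y hy.2).2, sup_assoc]
    exact (B.isCompl₁ y).sup_eq_top.ge
  have hs : IsLocalFrameOn I E ∞ s (U₁ ∩ U₂) :=
    { linearIndependent := fun {y} hy ↦
        linearIndependent_of_top_le_span_of_card_eq_finrank (hgen hy) (by
          rw [finrank_tangentSpace (n := n) y]
          simp
          omega)
      generating := hgen
      contMDiffOn := by
        rintro ((i | i) | i)
        · exact (hXs i).mono Set.inter_subset_left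
        · exact (hYs i).mono Set.inter_subset_right
        · exact (B.reeb_smooth.contMDiffOn (s := U₁ ∩ U₂)) }
  have hU : U₁ ∩ U₂ ∈ 𝓝 x := (hU₁.inter hU₂).mem_nhds ⟨hx₁, hx₂⟩
  have hc := fun i ↦ contMDiffAt_frame_coeff hs hU (hW x) i
  have h1 : CMDiffAt ∞ (T% fun y ↦ ∑ i : Fin n,
      hs.coeff (Sum.inl (Sum.inl i)) y (W y) • X i y) x :=
    .sum_section fun i _ ↦ (hc _).smul_section
      ((hXs i).contMDiffAt (hU₁.mem_nhds hx₁))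
  refine h1.congr_of_eventuallyEq ?_
  filter_upwards [hU] with y hy
  congr 1
  have hX' (i) : B.proj₁ y (X i y) = X i y := B.proj₁_L₁ (by
    rw [← (hX y hy.1).2]; exact Submodule.subset_span ⟨i, rfl⟩)
  have hY' (i) : B.proj₁ y (Y i y) = 0 := B.proj₁_L₂ (by
    rw [← (hY y hy.2).2]; exact Submodule.subset_span ⟨i, rfl⟩)
  change B.proj₁ y (W y) = _
  have hW' := congrArg (B.proj₁ y) (hs.coeff_sum_eq W hy)
  rw [hW', map_sum]
  simp only [map_smul, Fintype.sum_sum_type, s, Sum.elim_inl, Sum.elim_inr, hX', hY', proj₁_reeb,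
    smul_zero, Finset.sum_const_zero, add_zero]

theorem proj₂_smooth : SmoothEnd B.proj₂ := B.swap.proj₁_smooth

end AlmostBiLegendrian

end Structure

/-! ### The induced paracontact metric structure -/

section Paracontact

variable {E : Type*} [NormedAddCommGroup E] [NormedSpace ℝ E] [FiniteDimensional ℝ E]
  [CompleteSpace E] {H : Type*} [TopologicalSpace H] {I : ModelWithCorners ℝ E H}
  {M : Type*} [TopologicalSpace M] [ChartedSpace H M] [IsManifold I ∞ M] [T2Space M] {n : ℕ}

namespace AlmostBiLegendrian

variable [hE : Fact (finrank ℝ E = 2 * n + 1)] (B : AlmostBiLegendrian I M n)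
include hE

theorem d_left_L₁ {x : M} (v : TangentSpace I x) {w : TangentSpace I x} (hw : w ∈ B.L₁ x) :
    B.η.d x v w = B.η.d x (B.proj₂ x v) w := by
  have h := congrArg (fun u ↦ B.η.d x u w) (B.decomp x v)
  simpa [B.legendrian₁.isotropic x _ (B.proj₁_mem x v) _ hw] using h

theorem d_left_L₂ {x : M} (v : TangentSpace I x) {w : TangentSpace I x} (hw : w ∈ B.L₂ x) :
    B.η.d x v w = B.η.d x (B.proj₁ x v) w := B.swap.d_left_L₁ v hw

/-- Since `dη` is nondegenerate on `ker η`, its restriction to `L₂ × L₁` is nondegenerate. -/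
theorem proj₂_eq_zero {x : M} {v : TangentSpace I x} (h : ∀ w ∈ B.L₁ x, B.η.d x v w = 0) :
    B.proj₂ x v = 0 := by
  refine B.eq_zero_of_contact (B.η_proj₂ x v) fun w ↦ ?_
  have h1 := congrArg (B.η.d x (B.proj₂ x v)) (B.decomp x w)
  rw [map_add, map_add, ← B.d_left_L₁ v (B.proj₁_mem x w), h _ (B.proj₁_mem x w)] at h1
  simpa using h1

theorem proj₁_eq_zero {x : M} {v : TangentSpace I x} (h : ∀ w ∈ B.L₂ x, B.η.d x v w = 0) :
    B.proj₁ x v = 0 := B.swap.proj₂_eq_zero h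

theorem isSection_proj₁ {W : VField I M} (hW : SmoothField W) :
    IsSection B.L₁ (B.proj₁.app W) :=
  ⟨B.proj₁_smooth.app hW, fun x ↦ B.proj₁_mem x _⟩

theorem isSection_proj₂ {W : VField I M} (hW : SmoothField W) :
    IsSection B.L₂ (B.proj₂.app W) := B.swap.isSection_proj₁ hW

theorem exists_section₁ {x : M} {v : TangentSpace I x} (hv : v ∈ B.L₁ x) :
    ∃ X : VField I M, IsSection B.L₁ X ∧ X x = v := by
  obtain ⟨W, hW, rfl⟩ := exists_smoothField x v
  exact ⟨_, B.isSection_proj₁ hW, B.proj₁_L₁ hv⟩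

theorem exists_section₂ {x : M} {v : TangentSpace I x} (hv : v ∈ B.L₂ x) :
    ∃ X : VField I M, IsSection B.L₂ X ∧ X x = v := B.swap.exists_section₁ hv

theorem proj₁_app_section {X : VField I M} (hX : IsSection B.L₁ X) : B.proj₁.app X = X := by
  ext x
  exact B.proj₁_L₁ (hX.2 x)

theorem proj₂_app_section {X : VField I M} (hX : IsSection B.L₂ X) : B.proj₂.app X = X :=
  B.swap.proj₁_app_section hX

theorem proj₂_app_section₁ {X : VField I M} (hX : IsSection B.L₁ X) : B.proj₂.app X = 0 := by
  ext x
  exact B.proj₂_L₁ (hX.2 x)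

theorem proj₁_app_section₂ {X : VField I M} (hX : IsSection B.L₂ X) : B.proj₁.app X = 0 :=
  B.swap.proj₂_app_section₁ hX

theorem ψ_apply (x : M) (v : TangentSpace I x) :
    B.paracontact.ψ x v = B.proj₁ x v - B.proj₂ x v := rfl

theorem ψ_L₁ {x : M} {v : TangentSpace I x} (hv : v ∈ B.L₁ x) : B.paracontact.ψ x v = v := by
  rw [ψ_apply, B.proj₁_L₁ hv, B.proj₂_L₁ hv, sub_zero]

theorem ψ_L₂ {x : M} {v : TangentSpace I x} (hv : v ∈ B.L₂ x) : B.paracontact.ψ x v = - v := by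
  rw [ψ_apply, B.proj₁_L₂ hv, B.proj₂_L₂ hv, zero_sub]

@[simp]
theorem ψ_reeb (x : M) : B.paracontact.ψ x (B.reeb x) = 0 := by
  simp [ψ_apply]

@[simp]
theorem proj₁_ψ (x : M) (v : TangentSpace I x) :
    B.proj₁ x (B.paracontact.ψ x v) = B.proj₁ x v := by
  simp [ψ_apply]

@[simp]
theorem proj₂_ψ (x : M) (v : TangentSpace I x) :
    B.proj₂ x (B.paracontact.ψ x v) = - B.proj₂ x v := by
  simp [ψ_apply]

@[simp]
theorem η_ψ (x : M) (v : TangentSpace I x) : B.η x (B.paracontact.ψ x v) = 0 := by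
  simp [ψ_apply]

theorem ψ_ψ (x : M) (v : TangentSpace I x) :
    B.paracontact.ψ x (B.paracontact.ψ x v) = v - B.η x v • B.reeb x := by
  rw [ψ_apply, proj₁_ψ, proj₂_ψ, sub_neg_eq_add, eq_sub_iff_add_eq]
  exact (B.decomp x v).symm

theorem d_decomp (x : M) (v w : TangentSpace I x) : B.η.d x v w =
    B.η.d x (B.proj₁ x v) (B.proj₂ x w) + B.η.d x (B.proj₂ x v) (B.proj₁ x w) := by
  have h := congrArg₂ (fun a b ↦ B.η.d x a b) (B.decomp x v) (B.decomp x w)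
  simp only [map_add, add_apply, map_smul, FunLike.coe_smul, Pi.smul_apply, smul_eq_mul,
    d_proj₁_proj₁, d_proj₂_proj₂, d_reeb_left, d_reeb_right] at h
  linarith

theorem d_ψ_left (x : M) (v w : TangentSpace I x) :
    B.η.d x (B.paracontact.ψ x v) w = - B.η.d x v (B.paracontact.ψ x w) := by
  rw [d_decomp, B.d_decomp x v]
  simp [add_comm]

theorem g_ψ_left (x : M) (v w : TangentSpace I x) :
    B.paracontact.g x (B.paracontact.ψ x v) w = - B.paracontact.g x v (B.paracontact.ψ x w) := by
  simp only [paracontact_g_apply, d_ψ_left, η_ψ]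
  ring

theorem g_symm (x : M) (v w : TangentSpace I x) :
    B.paracontact.g x v w = B.paracontact.g x w v := by
  rw [paracontact_g_apply, paracontact_g_apply, B.η.d_swap, d_ψ_left]
  ring

@[simp]
theorem g_reeb (x : M) (v : TangentSpace I x) : B.paracontact.g x v (B.reeb x) = B.η x v := by
  simp [paracontact_g_apply]

theorem g_L₁ {x : M} (v : TangentSpace I x) {w : TangentSpace I x} (hw : w ∈ B.L₁ x) :
    B.paracontact.g x v w = B.η.d x v w := by
  rw [paracontact_g_apply, B.ψ_L₁ hw, B.η_L₁ hw, mul_zero, add_zero]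

theorem g_L₂ {x : M} (v : TangentSpace I x) {w : TangentSpace I x} (hw : w ∈ B.L₂ x) :
    B.paracontact.g x v w = - B.η.d x v w := by
  rw [paracontact_g_apply, B.ψ_L₂ hw, B.η_L₂ hw, mul_zero, add_zero, map_neg]

theorem ψ_smooth : SmoothEnd B.paracontact.ψ :=
  smoothEnd_of_forall fun _ hX ↦ (B.proj₁_smooth.app hX).sub (B.proj₂_smooth.app hX)

/-- The metric of the induced paracontact structure is semi-Riemannian. -/
theorem isSemiRiemannian : IsSemiRiemannian B.paracontact.g where
  smooth := smoothBilin_of_forall fun _ _ hX hY ↦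
    (B.η.d_smooth.app hX (B.ψ_smooth.app hY)).add ((B.η.smooth.app hX).mul (B.η.smooth.app hY))
  symm := B.g_symm
  nondegenerate := by
    intro x v hv
    have h1 : B.η x v = 0 := by rw [← g_reeb, hv]
    refine B.eq_zero_of_contact h1 fun w ↦ ?_
    have h2 := hv (B.paracontact.ψ x w)
    rw [paracontact_g_apply, ψ_ψ, η_ψ] at h2
    simpa using h2

theorem eigenspace_one (x : M) : (Module.End.eigenspace (B.paracontact.ψ x).toLinearMap 1 ⊓
    B.paracontact.η.kernel x : Submodule ℝ (TangentSpace I x)) = B.L₁ x := by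
  ext v
  simp only [Submodule.mem_inf, Module.End.mem_eigenspace_iff]
  constructor
  · rintro ⟨h1, -⟩
    have h1 : B.paracontact.ψ x v = (1 : ℝ) • v := h1
    have h2 := congrArg (B.proj₂ x) h1
    have h3 := congrArg (B.η x) h1
    rw [one_smul, proj₂_ψ, neg_eq_iff_add_eq_zero, ← two_smul ℝ, smul_eq_zero_iff_right
      two_ne_zero] at h2
    rw [one_smul, η_ψ] at h3
    rw [B.decomp x v, h2, ← h3, zero_smul, add_zero, add_zero]
    exact B.proj₁_mem x v
  · intro hv
    exact ⟨(B.ψ_L₁ hv).trans (one_smul ℝ v).symm, B.η_L₁ hv⟩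

theorem eigenspace_neg_one (x : M) :
    (Module.End.eigenspace (B.paracontact.ψ x).toLinearMap (-1) ⊓
      B.paracontact.η.kernel x : Submodule ℝ (TangentSpace I x)) = B.L₂ x := by
  ext v
  simp only [Submodule.mem_inf, Module.End.mem_eigenspace_iff]
  constructor
  · rintro ⟨h1, -⟩
    have h1 : B.paracontact.ψ x v = (-1 : ℝ) • v := h1
    have h2 := congrArg (B.proj₁ x) h1
    have h3 := congrArg (B.η x) h1
    rw [neg_one_smul, proj₁_ψ, map_neg, eq_neg_iff_add_eq_zero, ← two_smul ℝ,
      smul_eq_zero_iff_right two_ne_zero] at h2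
    rw [neg_one_smul, η_ψ, map_neg, zero_eq_neg] at h3
    rw [B.decomp x v, h2, h3, zero_smul, zero_add, add_zero]
    exact B.proj₂_mem x v
  · intro hv
    exact ⟨(B.ψ_L₂ hv).trans (neg_one_smul ℝ v).symm, B.η_L₂ hv⟩

/-- The structure induced by an almost bi-Legendrian structure is paracontact metric. -/
theorem isParacontactMetric : B.paracontact.IsParacontactMetric n where
  smooth_ψ := B.ψ_smooth
  smooth_ξ := B.reeb_smooth
  smooth_g := B.isSemiRiemannian.smooth
  η_ξ := B.η_reeb
  ψ_sq := B.ψ_ψ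
  finrank_pos x := by rw [eigenspace_one, B.legendrian₁.finrank_eq]
  finrank_neg x := by rw [eigenspace_neg_one, B.legendrian₂.finrank_eq]
  g_symm := B.g_symm
  g_nondegenerate := B.isSemiRiemannian.nondegenerate
  compatible x v w := by
    rw [g_ψ_left, ψ_ψ, map_sub, map_smul, g_reeb, smul_eq_mul]
    change _ = _ + B.η x v * B.η x w
    ring
  d_η x v w := by
    change B.η.d x v w = _
    rw [paracontact_g_apply, ψ_ψ, η_ψ]
    simp

end AlmostBiLegendrian

end Paracontact

/-! ### Identities for the Levi-Civita connection of the induced metric -/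

section Adapted

variable {E : Type*} [NormedAddCommGroup E] [NormedSpace ℝ E] [FiniteDimensional ℝ E]
  [CompleteSpace E] {H : Type*} [TopologicalSpace H] {I : ModelWithCorners ℝ E H}
  {M : Type*} [TopologicalSpace M] [ChartedSpace H M] [IsManifold I ∞ M]

namespace Connection

variable (D : Connection I M)

theorem cov_add (X : VField I M) {Y Y' : VField I M} {x : M} (hY : MDiffAt (T% Y) x)
    (hY' : MDiffAt (T% Y') x) :
    D.cov X (fun y ↦ Y y + Y' y) x = D.cov X Y x + D.cov X Y' x := by
  have h := D.isCovariantDerivativeOnUniv.add hY hY'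
  exact congrArg (fun A : TangentSpace I x →L[ℝ] TangentSpace I x ↦ A (X x)) h

theorem cov_smul (X : VField I M) {Y : VField I M} {f : M → ℝ} {x : M} (hf : MDiffAt f x)
    (hY : MDiffAt (T% Y) x) :
    D.cov X (fun y ↦ f y • Y y) x = f x • D.cov X Y x + dirDeriv X f x • Y x := by
  have h := D.isCovariantDerivativeOnUniv.leibniz hY hf
  exact congrArg (fun A : TangentSpace I x →L[ℝ] TangentSpace I x ↦ A (X x)) h

theorem cov_neg (X : VField I M) {Y : VField I M} {x : M} (hY : MDiffAt (T% Y) x) :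
    D.cov X (fun y ↦ - Y y) x = - D.cov X Y x := by
  have h := D.cov_smul X (f := fun _ ↦ -1) mdifferentiableAt_const hY
  simpa [dirDeriv_const] using h

theorem cov_zero (X : VField I M) (x : M) : D.cov X 0 x = 0 := by
  have h0 : MDiffAt (T% (0 : VField I M)) x := mdifferentiableAt_zeroSection ..
  have h := D.cov_smul X (f := fun _ ↦ 0) mdifferentiableAt_const h0
  simp only [zero_smul, dirDeriv_const, zero_add] at h
  exact h

theorem torsion_field {X Y : VField I M} (hX : SmoothField X) (hY : SmoothField Y) (x : M) :
    D.torsion x (X x) (Y x) = D.cov X Y x - D.cov Y X x - bracket X Y x :=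
  D.torsion_apply (hX.mdiff x) (hY.mdiff x)

end Connection

variable [T2Space M] {n : ℕ}

theorem IsSection.neg {L : Distribution I M} {X : VField I M} (hX : IsSection L X) :
    IsSection L (fun x ↦ - X x) :=
  ⟨by simpa using SmoothField.smul (f := fun _ ↦ (-1 : ℝ)) contMDiff_const hX.1,
    fun x ↦ neg_mem (hX.2 x)⟩

/-- The properties of the Levi-Civita connection `D` of the induced metric that are symmetric in
the two Legendrian distributions: `D` is torsion-free, `(∇_X dη)(Y, Z) = 0` for `Y` in `L₁` and
`Z` in `L₂`, `dη(∇_X Y, Z)` is skew in `Y`, `Z` in the same `Lᵢ`, `dη(∇_Y ξ, Z)` is symmetric in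
such `Y`, `Z`, and `∇_X ξ` lies in `ker η`. Exchanging `L₁` and `L₂` changes the induced metric, but
not these properties, so that their consequences need to be proved for one of the two only. -/
structure Connection.IsAdapted (B : AlmostBiLegendrian I M n) (D : Connection I M) : Prop where
  torsion_free : ∀ x, D.torsion x = 0
  d₁₁ : ∀ X Y Z : VField I M, SmoothField X → IsSection B.L₁ Y → IsSection B.L₁ Z → ∀ x,
    B.η.d x (D.cov X Y x) (Z x) + B.η.d x (D.cov X Z x) (Y x) = 0
  d₂₂ : ∀ X Y Z : VField I M, SmoothField X → IsSection B.L₂ Y → IsSection B.L₂ Z → ∀ x,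
    B.η.d x (D.cov X Y x) (Z x) + B.η.d x (D.cov X Z x) (Y x) = 0
  d₁₂ : ∀ X Y Z : VField I M, SmoothField X → IsSection B.L₁ Y → IsSection B.L₂ Z → ∀ x,
    dirDeriv X (fun y ↦ B.η.d y (Y y) (Z y)) x =
      B.η.d x (D.cov X Y x) (Z x) + B.η.d x (Y x) (D.cov X Z x)
  reeb₁₁ : ∀ Y Z : VField I M, IsSection B.L₁ Y → IsSection B.L₁ Z → ∀ x,
    B.η.d x (D.cov Y B.reeb x) (Z x) = B.η.d x (D.cov Z B.reeb x) (Y x)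
  reeb₂₂ : ∀ Y Z : VField I M, IsSection B.L₂ Y → IsSection B.L₂ Z → ∀ x,
    B.η.d x (D.cov Y B.reeb x) (Z x) = B.η.d x (D.cov Z B.reeb x) (Y x)
  η_cov_reeb : ∀ X : VField I M, SmoothField X → ∀ x, B.η x (D.cov X B.reeb x) = 0

theorem OneForm.two_d (η : OneForm I M) {X Y : VField I M} (hX : SmoothField X)
    (hY : SmoothField Y) (x : M) : 2 * η.d x (X x) (Y x) =
      dirDeriv X (fun y ↦ η y (Y y)) x - dirDeriv Y (fun y ↦ η y (X y)) x
        - η x (bracket X Y x) := by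
  rw [η.d_apply (hX.mdiff x) (hY.mdiff x)]
  ring

/-- On `ker η`, `2 dη(X, Y) = - η [X, Y]`. -/
theorem OneForm.η_bracket (η : OneForm I M) {X Y : VField I M} (hX : SmoothField X)
    (hY : SmoothField Y) (hX0 : ∀ x, η x (X x) = 0) (hY0 : ∀ x, η x (Y x) = 0) (x : M) :
    η x (bracket X Y x) = - (2 * η.d x (X x) (Y x)) := by
  rw [η.two_d hX hY]
  simp only [hX0, hY0, dirDeriv_const]
  ring

namespace Connection

theorem bracket_of_torsion_free {D : Connection I M} (hD : ∀ x, D.torsion x = 0) {X Y : VField I M}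
    (hX : SmoothField X) (hY : SmoothField Y) (x : M) :
    bracket X Y x = D.cov X Y x - D.cov Y X x := by
  have h := D.torsion_field hX hY x
  rw [hD x] at h
  exact (sub_eq_zero.1 h.symm).symm

variable [hE : Fact (finrank ℝ E = 2 * n + 1)] {B : AlmostBiLegendrian I M n}
  {D : Connection I M}
include hE

section Metric

variable (hD : D.IsLeviCivita B.paracontact.g)
include hD

theorem IsLeviCivita.η_cov₁ {X Y : VField I M} (hX : SmoothField X) (hY : IsSection B.L₁ Y)
    (x : M) : B.η x (D.cov X Y x) = - B.η.d x (D.cov X B.reeb x) (Y x) := by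
  have h := hD.metric X Y B.reeb hX hY.1 B.reeb_smooth x
  simp only [covBilin, B.g_reeb, B.η_L₁ (hY.2 _), dirDeriv_const] at h
  rw [B.g_symm, B.g_L₁ _ (hY.2 x)] at h
  linarith

theorem IsLeviCivita.η_cov₂ {X Y : VField I M} (hX : SmoothField X) (hY : IsSection B.L₂ Y)
    (x : M) : B.η x (D.cov X Y x) = B.η.d x (D.cov X B.reeb x) (Y x) := by
  have h := hD.metric X Y B.reeb hX hY.1 B.reeb_smooth x
  simp only [covBilin, B.g_reeb, B.η_L₂ (hY.2 _), dirDeriv_const] at h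
  rw [B.g_symm, B.g_L₂ _ (hY.2 x)] at h
  linarith

/-- The Levi-Civita connection of the induced metric is adapted. -/
theorem IsLeviCivita.isAdapted : D.IsAdapted B where
  torsion_free := hD.torsion_free
  d₁₁ X Y Z hX hY hZ x := by
    have h := hD.metric X Y Z hX hY.1 hZ.1 x
    simp only [covBilin, B.g_L₁ _ (hZ.2 _),
      B.legendrian₁.isotropic _ _ (hY.2 _) _ (hZ.2 _), dirDeriv_const] at h
    rw [B.g_symm x (Y x), B.g_L₁ _ (hY.2 x)] at h
    linarith
  d₂₂ X Y Z hX hY hZ x := by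
    have h := hD.metric X Y Z hX hY.1 hZ.1 x
    simp only [covBilin, B.g_L₂ _ (hZ.2 _),
      B.legendrian₂.isotropic _ _ (hY.2 _) _ (hZ.2 _), neg_zero, dirDeriv_const] at h
    rw [B.g_symm x (Y x), B.g_L₂ _ (hY.2 x)] at h
    linarith
  d₁₂ X Y Z hX hY hZ x := by
    have h := hD.metric X Y Z hX hY.1 hZ.1 x
    simp only [covBilin, B.g_L₂ _ (hZ.2 _), dirDeriv_neg] at h
    rw [B.g_symm x (Y x), B.g_L₁ _ (hY.2 x), B.η.d_swap x _ (Y x)] at h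
    linarith
  reeb₁₁ Y Z hY hZ x := by
    have h := B.η.η_bracket hY.1 hZ.1 (fun x ↦ B.η_L₁ (hY.2 x)) (fun x ↦ B.η_L₁ (hZ.2 x)) x
    rw [bracket_of_torsion_free hD.torsion_free hY.1 hZ.1, map_sub, hD.η_cov₁ hY.1 hZ,
      hD.η_cov₁ hZ.1 hY, B.legendrian₁.isotropic _ _ (hY.2 _) _ (hZ.2 _)] at h
    linarith
  reeb₂₂ Y Z hY hZ x := by
    have h := B.η.η_bracket hY.1 hZ.1 (fun x ↦ B.η_L₂ (hY.2 x)) (fun x ↦ B.η_L₂ (hZ.2 x)) x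
    rw [bracket_of_torsion_free hD.torsion_free hY.1 hZ.1, map_sub, hD.η_cov₂ hY.1 hZ,
      hD.η_cov₂ hZ.1 hY, B.legendrian₂.isotropic _ _ (hY.2 _) _ (hZ.2 _)] at h
    linarith
  η_cov_reeb X hX x := by
    have h := hD.metric X B.reeb B.reeb hX B.reeb_smooth B.reeb_smooth x
    simp only [covBilin, B.g_reeb, B.η_reeb, dirDeriv_const] at h
    rw [B.g_symm, B.g_reeb] at h
    linarith

end Metric

namespace IsAdapted

variable (hD : D.IsAdapted B)
include hD

theorem bracket_eq {X Y : VField I M} (hX : SmoothField X) (hY : SmoothField Y) (x : M) :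
    bracket X Y x = D.cov X Y x - D.cov Y X x :=
  bracket_of_torsion_free hD.torsion_free hX hY x

theorem swap : D.IsAdapted B.swap where
  torsion_free := hD.torsion_free
  d₁₁ := hD.d₂₂
  d₂₂ := hD.d₁₁
  d₁₂ X Y Z hX hY hZ x := by
    change dirDeriv X (fun y ↦ B.η.d y (Y y) (Z y)) x =
      B.η.d x (D.cov X Y x) (Z x) + B.η.d x (Y x) (D.cov X Z x)
    have h := hD.d₁₂ X Z Y hX hZ hY x
    simp only [B.η.d_swap _ (Z _), dirDeriv_neg] at h
    rw [B.η.d_swap x _ (Y x)] at h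
    linarith
  reeb₁₁ := hD.reeb₂₂
  reeb₂₂ := hD.reeb₁₁
  η_cov_reeb := hD.η_cov_reeb

/-- By closedness of `dη`, `dη(∇_X Y, Z)` is both symmetric and skew in sections `Y`, `Z`
of `L₂` when `X` is a section of `L₁`. -/
theorem proj₁_cov₁₂ {X Y : VField I M} (hX : IsSection B.L₁ X) (hY : IsSection B.L₂ Y) (x : M) :
    B.proj₁ x (D.cov X Y x) = 0 := by
  refine B.proj₁_eq_zero fun w hw ↦ ?_
  obtain ⟨Z, hZ, rfl⟩ := B.exists_section₂ hw
  have h := B.η.d_closed hX.1 hY.1 hZ.1 x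
  have h1 := hD.d₁₂ Z X Y hZ.1 hX hY x
  have h2 := hD.d₁₂ Y X Z hY.1 hX hZ x
  have h3 := hD.d₂₂ X Y Z hX.1 hY hZ x
  simp only [B.legendrian₂.isotropic _ _ (hY.2 _) _ (hZ.2 _), dirDeriv_const] at h
  rw [h1] at h
  simp only [B.η.d_swap _ (Z _) (X _), dirDeriv_neg] at h
  rw [h2, hD.bracket_eq hX.1 hY.1, hD.bracket_eq hY.1 hZ.1, hD.bracket_eq hZ.1 hX.1] at h
  simp only [map_sub, sub_apply] at h
  rw [B.η.d_swap x (X x), B.η.d_swap x (X x)] at h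
  linarith

theorem proj₂_cov₂₁ {X Y : VField I M} (hX : IsSection B.L₂ X) (hY : IsSection B.L₁ Y) (x : M) :
    B.proj₂ x (D.cov X Y x) = 0 := hD.swap.proj₁_cov₁₂ hX hY x

/-- By closedness of `dη`, `dη(∇_ξ Y, Z)` is symmetric in sections `Y`, `Z` of `L₁`, on which it is
also skew. -/
theorem proj₂_cov_reeb₁ {Y : VField I M} (hY : IsSection B.L₁ Y) (x : M) :
    B.proj₂ x (D.cov B.reeb Y x) = 0 := by
  refine B.proj₂_eq_zero fun w hw ↦ ?_
  obtain ⟨Z, hZ, rfl⟩ := B.exists_section₁ hw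
  have h := B.η.d_closed B.reeb_smooth hY.1 hZ.1 x
  have h1 := hD.d₁₁ B.reeb Y Z B.reeb_smooth hY hZ x
  have h2 := hD.reeb₁₁ Y Z hY hZ x
  simp only [B.legendrian₁.isotropic _ _ (hY.2 _) _ (hZ.2 _), B.d_reeb_left, B.d_reeb_right,
    dirDeriv_const] at h
  rw [hD.bracket_eq B.reeb_smooth hY.1, hD.bracket_eq hZ.1 B.reeb_smooth] at h
  simp only [map_sub, sub_apply] at h
  linarith

theorem proj₁_cov_reeb₂ {Y : VField I M} (hY : IsSection B.L₂ Y) (x : M) :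
    B.proj₁ x (D.cov B.reeb Y x) = 0 := hD.swap.proj₂_cov_reeb₁ hY x

theorem η_cov_reeb_left {Y : VField I M} (hY : SmoothField Y) (hY0 : ∀ x, B.η x (Y x) = 0)
    (x : M) : B.η x (D.cov B.reeb Y x) = 0 := by
  have h := B.η.two_d B.reeb_smooth hY x
  simp only [B.d_reeb_left, B.η_reeb, hY0, dirDeriv_const] at h
  rw [hD.bracket_eq B.reeb_smooth hY, map_sub, hD.η_cov_reeb Y hY] at h
  linarith

/-- Closedness of `dη` on `ξ`, `Y`, `Z`. -/
theorem d_cov_reeb_symm {Y Z : VField I M} (hY : IsSection B.L₁ Y) (hZ : IsSection B.L₂ Z)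
    (x : M) : B.η.d x (D.cov Y B.reeb x) (Z x) = B.η.d x (D.cov Z B.reeb x) (Y x) := by
  have h := B.η.d_closed B.reeb_smooth hY.1 hZ.1 x
  have h1 := hD.d₁₂ B.reeb Y Z B.reeb_smooth hY hZ x
  simp only [B.d_reeb_left, B.d_reeb_right, dirDeriv_const] at h
  rw [h1, hD.bracket_eq B.reeb_smooth hY.1, hD.bracket_eq hZ.1 B.reeb_smooth] at h
  simp only [map_sub, sub_apply] at h
  rw [B.η.d_swap x (Y x)] at h
  linarith

end IsAdapted

namespace IsLeviCivita

variable (hD : D.IsLeviCivita B.paracontact.g)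
include hD

/-- The form `dη(∇_Y ξ, Z)` is symmetric, and its skew part is determined by
`2 dη(Y, Z) = - η [Y, Z]`. -/
theorem d_cov_reeb₁ {Y Z : VField I M} (hY : IsSection B.L₁ Y) (hZ : IsSection B.L₂ Z) (x : M) :
    B.η.d x (D.cov Y B.reeb x) (Z x) = - B.η.d x (Y x) (Z x) := by
  have h := B.η.η_bracket hY.1 hZ.1 (fun x ↦ B.η_L₁ (hY.2 x)) (fun x ↦ B.η_L₂ (hZ.2 x)) x
  rw [bracket_of_torsion_free hD.torsion_free hY.1 hZ.1, map_sub, hD.η_cov₂ hY.1 hZ,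
    hD.η_cov₁ hZ.1 hY, ← hD.isAdapted.d_cov_reeb_symm hY hZ] at h
  linarith

theorem proj₁_cov_reeb {Y : VField I M} (hY : IsSection B.L₁ Y) (x : M) :
    B.proj₁ x (D.cov Y B.reeb x) = - Y x := by
  have h : B.proj₁ x (D.cov Y B.reeb x + Y x) = 0 := by
    refine B.proj₁_eq_zero fun w hw ↦ ?_
    obtain ⟨Z, hZ, rfl⟩ := B.exists_section₂ hw
    rw [map_add, add_apply, hD.d_cov_reeb₁ hY hZ, neg_add_cancel]
  rwa [map_add, B.proj₁_L₁ (hY.2 x), add_eq_zero_iff_eq_neg] at h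

theorem proj₂_cov_reeb {Z : VField I M} (hZ : IsSection B.L₂ Z) (x : M) :
    B.proj₂ x (D.cov Z B.reeb x) = Z x := by
  have h : B.proj₂ x (D.cov Z B.reeb x - Z x) = 0 := by
    refine B.proj₂_eq_zero fun w hw ↦ ?_
    obtain ⟨Y, hY, rfl⟩ := B.exists_section₁ hw
    rw [map_sub, sub_apply, ← hD.isAdapted.d_cov_reeb_symm hY hZ, hD.d_cov_reeb₁ hY hZ,
      B.η.d_swap x (Z x), sub_self]
  rwa [map_sub, B.proj₂_L₂ (hZ.2 x), sub_eq_zero] at h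

/-- The integral curves of the Reeb field are geodesics. -/
theorem cov_reeb_reeb (x : M) : D.cov B.reeb B.reeb x = 0 := by
  have h1 : B.proj₁ x (D.cov B.reeb B.reeb x) = 0 := B.proj₁_eq_zero fun w hw ↦ by
    obtain ⟨Z, hZ, rfl⟩ := B.exists_section₂ hw
    rw [← hD.η_cov₂ B.reeb_smooth hZ, hD.isAdapted.η_cov_reeb_left hZ.1 fun x ↦ B.η_L₂ (hZ.2 x)]
  have h2 : B.proj₂ x (D.cov B.reeb B.reeb x) = 0 := B.proj₂_eq_zero fun w hw ↦ by
    obtain ⟨Z, hZ, rfl⟩ := B.exists_section₁ hw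
    rw [← neg_eq_zero, ← hD.η_cov₁ B.reeb_smooth hZ, hD.isAdapted.η_cov_reeb_left hZ.1 fun x ↦ B.η_L₁ (hZ.2 x)]
  rw [B.decomp x (D.cov _ _ x), h1, h2, hD.isAdapted.η_cov_reeb _ B.reeb_smooth]
  simp

/-- `ψ A + A ψ = - 2 ψ²` for `A X = ∇_X ξ`. -/
theorem ψ_cov_reeb (x : M) (v : TangentSpace I x) :
    B.paracontact.ψ x (D B.reeb x v) + D B.reeb x (B.paracontact.ψ x v) =
      - (2 : ℝ) • (v - B.η x v • B.reeb x) := by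
  obtain ⟨X, hX, hXv⟩ := B.exists_section₁ (B.proj₁_mem x v)
  obtain ⟨Y, hY, hYv⟩ := B.exists_section₂ (B.proj₂_mem x v)
  have h1 : B.proj₁ x (D B.reeb x (X x)) = - X x := hD.proj₁_cov_reeb hX x
  have h2 : B.proj₂ x (D B.reeb x (Y x)) = Y x := hD.proj₂_cov_reeb hY x
  have h3 : B.η x (D B.reeb x (X x)) = 0 := hD.isAdapted.η_cov_reeb X hX.1 x
  have h4 : B.η x (D B.reeb x (Y x)) = 0 := hD.isAdapted.η_cov_reeb Y hY.1 x
  have h5 : D B.reeb x (B.reeb x) = 0 := hD.cov_reeb_reeb x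
  have h6 := B.decomp x (D B.reeb x (X x))
  have h7 := B.decomp x (D B.reeb x (Y x))
  have h8 : D B.reeb x v = D B.reeb x (X x) + D B.reeb x (Y x) := by
    conv_lhs => rw [B.decomp x v, map_add, map_add, map_smul, h5, ← hXv, ← hYv]
    simp
  have h9 : v - B.η x v • B.reeb x = X x + Y x := by
    rw [hXv, hYv, sub_eq_iff_eq_add]
    exact B.decomp x v
  rw [h9, h8, B.ψ_apply x v, ← hXv, ← hYv, map_sub, B.ψ_apply, map_add, map_add, h1, h2]
  rw [h1, h3] at h6
  rw [h2, h4] at h7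
  generalize D B.reeb x (X x) = a at *
  generalize D B.reeb x (Y x) = b at *
  have e1 : B.proj₂ x a = a + X x := by
    rw [zero_smul, add_zero] at h6
    nth_rewrite 2 [h6]
    abel
  have e2 : B.proj₁ x b = b - Y x := by
    rw [zero_smul, add_zero] at h7
    nth_rewrite 2 [h7]
    abel
  -- `a = ∇_X ξ` has the part `- X` in `L₁`, and `b = ∇_Y ξ` has the part `Y` in `L₂`
  rw [e1, e2]
  module

/-- `∇_ξ ψ = 0`. -/
theorem cov_reeb_ψ {Y : VField I M} (hY : SmoothField Y) (x : M) :
    D.cov B.reeb (B.paracontact.ψ.app Y) x = B.paracontact.ψ x (D.cov B.reeb Y x) := by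
  have hY₁ := B.isSection_proj₁ hY
  have hY₂ := B.isSection_proj₂ hY
  have hη : CMDiff ∞ fun y ↦ B.η y (Y y) := B.η.smooth.app hY
  have e1 : Y = fun y ↦ (B.proj₁.app Y y + B.proj₂.app Y y) + B.η y (Y y) • B.reeb y := by
    ext y
    exact B.decomp y (Y y)
  have e2 : B.paracontact.ψ.app Y = fun y ↦ B.proj₁.app Y y + - B.proj₂.app Y y := by
    ext y
    rw [← sub_eq_add_neg]
    rfl
  have h1 : D.cov B.reeb Y x = D.cov B.reeb (B.proj₁.app Y) x + D.cov B.reeb (B.proj₂.app Y) x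
      + dirDeriv B.reeb (fun y ↦ B.η y (Y y)) x • B.reeb x := by
    conv_lhs => rw [e1]
    rw [D.cov_add _ ((hY₁.1.add hY₂.1).mdiff x) ((B.reeb_smooth.smul hη).mdiff x),
      D.cov_add _ (hY₁.1.mdiff x) (hY₂.1.mdiff x),
      D.cov_smul _ (mdiff_of_smooth hη x) (B.reeb_smooth.mdiff x), hD.cov_reeb_reeb,
      smul_zero, zero_add]
  have h3 := B.decomp x (D.cov B.reeb (B.proj₁.app Y) x)
  have h4 := B.decomp x (D.cov B.reeb (B.proj₂.app Y) x)
  rw [hD.isAdapted.proj₂_cov_reeb₁ hY₁, hD.isAdapted.η_cov_reeb_left hY₁.1 fun y ↦ B.η_L₁ (hY₁.2 y), zero_smul, add_zero,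
    add_zero] at h3
  rw [hD.isAdapted.proj₁_cov_reeb₂ hY₂, hD.isAdapted.η_cov_reeb_left hY₂.1 fun y ↦ B.η_L₂ (hY₂.2 y), zero_smul, zero_add,
    add_zero] at h4
  rw [h1, e2, D.cov_add _ (hY₁.1.mdiff x) (hY₂.neg.1.mdiff x), D.cov_neg _ (hY₂.1.mdiff x),
    map_add, map_add, map_smul, B.ψ_reeb, smul_zero, add_zero]
  rw [h3, h4, B.ψ_L₁ (B.proj₁_mem x _), B.ψ_L₂ (B.proj₂_mem x _)]

/-- `h = ψ A + ψ²` for `A X = ∇_X ξ`. -/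
theorem h_eq {X : VField I M} (hX : SmoothField X) (x : M) :
    B.paracontact.h X x =
      B.paracontact.ψ x (D.cov X B.reeb x) + (X x - B.η x (X x) • B.reeb x) := by
  have h1 := hD.ψ_cov_reeb x (X x)
  have h2 := hD.cov_reeb_ψ hX x
  change (1 / 2 : ℝ) • (bracket B.reeb (B.paracontact.ψ.app X) x -
    B.paracontact.ψ x (bracket B.reeb X x)) = _
  rw [bracket_of_torsion_free hD.torsion_free B.reeb_smooth (B.ψ_smooth.app hX),
    bracket_of_torsion_free hD.torsion_free B.reeb_smooth hX, h2, map_sub]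
  rw [← eq_sub_iff_add_eq'] at h1
  have h3 : D.cov (B.paracontact.ψ.app X) B.reeb x =
    -(2 : ℝ) • (X x - B.η x (X x) • B.reeb x) - B.paracontact.ψ x (D.cov X B.reeb x) := h1
  rw [h3]
  module

end IsLeviCivita

end Connection

end Adapted

/-! ### The bi-Legendrian and the canonical paracontact connection -/

section Existence

variable {E : Type*} [NormedAddCommGroup E] [NormedSpace ℝ E] [FiniteDimensional ℝ E]
  [CompleteSpace E] {H : Type*} [TopologicalSpace H] {I : ModelWithCorners ℝ E H}
  {M : Type*} [TopologicalSpace M] [ChartedSpace H M] [IsManifold I ∞ M]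

theorem SmoothEnd.mdifferentiableAt_app {A : EndField I M} (hA : SmoothEnd A) {X : VField I M}
    {x : M} (hX : MDiffAt (T% X) x) : MDiffAt (T% (A.app X)) x := by
  apply MDifferentiableAt.clm_bundle_apply (F₁ := E) (F₂ := E)
  · exact (hA.mdifferentiable (by simp)) x
  · exact hX

variable [T2Space M] {n : ℕ} [hE : Fact (finrank ℝ E = 2 * n + 1)]

namespace AlmostBiLegendrian

variable (B : AlmostBiLegendrian I M n) (D : Connection I M)

/-- The connection `X, Y ↦ (∇_X Y_{L₁})_{L₁} + (∇_X Y_{L₂})_{L₂} + X(η Y) ξ + η(X) ψ Y` built from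
a connection `∇`. It is the bi-Legendrian connection if `∇` is the Levi-Civita connection of the
induced metric. -/
def biLegendrianConnection : Connection I M where
  toFun Y x := (B.proj₁ x).comp (D (B.proj₁.app Y) x) + (B.proj₂ x).comp (D (B.proj₂.app Y) x)
    + (d% (fun y ↦ B.η y (Y y)) x).smulRight (B.reeb x)
    + (B.η x).smulRight (B.paracontact.ψ x (Y x))
  isCovariantDerivativeOnUniv :=
    { add := fun {Y Y' x} hY hY' _ ↦ by
        have e₁ : B.proj₁.app (Y + Y') = B.proj₁.app Y + B.proj₁.app Y' := by
          ext y; simp [EndField.app]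
        have e₂ : B.proj₂.app (Y + Y') = B.proj₂.app Y + B.proj₂.app Y' := by
          ext y; simp [EndField.app]
        have e₃ : (fun y ↦ B.η y ((Y + Y') y)) = (fun y ↦ B.η y (Y y)) + fun y ↦ B.η y (Y' y) := by
          ext y; simp
        rw [e₁, e₂, e₃, D.isCovariantDerivativeOnUniv.add
          (B.proj₁_smooth.mdifferentiableAt_app hY) (B.proj₁_smooth.mdifferentiableAt_app hY'),
          D.isCovariantDerivativeOnUniv.add (B.proj₂_smooth.mdifferentiableAt_app hY)
          (B.proj₂_smooth.mdifferentiableAt_app hY'),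
          mvfderiv_add (B.η.mdifferentiableAt_apply hY) (B.η.mdifferentiableAt_apply hY')]
        ext v
        simp
        module
      leibniz := fun {Y f x} hY hf _ ↦ by
        have e₁ : B.proj₁.app (f • Y) = f • B.proj₁.app Y := by
          ext y; simp [EndField.app]
        have e₂ : B.proj₂.app (f • Y) = f • B.proj₂.app Y := by
          ext y; simp [EndField.app]
        have e₃ : (fun y ↦ B.η y ((f • Y) y)) = f * fun y ↦ B.η y (Y y) := by
          ext y; simp
        rw [e₁, e₂, e₃, D.isCovariantDerivativeOnUniv.leibniz
          (B.proj₁_smooth.mdifferentiableAt_app hY) hf,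
          D.isCovariantDerivativeOnUniv.leibniz (B.proj₂_smooth.mdifferentiableAt_app hY) hf,
          mvfderiv_mul hf (B.η.mdifferentiableAt_apply hY)]
        ext v
        have h := B.decomp x (Y x)
        simp
        -- the three derivatives of `f` add up to the decomposition of `Y x`
        linear_combination (norm := module) (- d% f x v) • h }

theorem biLegendrianConnection_cov (X Y : VField I M) (x : M) :
    (B.biLegendrianConnection D).cov X Y x =
      B.proj₁ x (D.cov X (B.proj₁.app Y) x) + B.proj₂ x (D.cov X (B.proj₂.app Y) x)
        + dirDeriv X (fun y ↦ B.η y (Y y)) x • B.reeb x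
        + B.η x (X x) • B.paracontact.ψ x (Y x) := rfl

/-- The connection `X, Y ↦ ∇_X Y + η(X) ψ Y - η(Y) ∇_X ξ + g(Y, ∇_X ξ) ξ` built from a connection
`∇`. It is the canonical paracontact connection if `∇` is the Levi-Civita connection of the
induced metric. -/
def canonicalConnection : Connection I M where
  toFun Y x := D Y x + (B.η x).smulRight (B.paracontact.ψ x (Y x)) - B.η x (Y x) • D B.reeb x
    + ((B.paracontact.g x (Y x)).comp (D B.reeb x)).smulRight (B.reeb x)
  isCovariantDerivativeOnUniv :=
    { add := fun {Y Y' x} hY hY' _ ↦ by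
        rw [D.isCovariantDerivativeOnUniv.add hY hY']
        ext v
        simp
        module
      leibniz := fun {Y f x} hY hf _ ↦ by
        rw [D.isCovariantDerivativeOnUniv.leibniz hY hf]
        ext v
        simp
        module }

theorem canonicalConnection_cov (X Y : VField I M) (x : M) :
    (B.canonicalConnection D).cov X Y x =
      D.cov X Y x + B.η x (X x) • B.paracontact.ψ x (Y x) - B.η x (Y x) • D.cov X B.reeb x
        + B.paracontact.g x (Y x) (D.cov X B.reeb x) • B.reeb x := rfl

theorem η_biLegendrianConnection (X Y : VField I M) (x : M) :
    B.η x ((B.biLegendrianConnection D).cov X Y x) = dirDeriv X (fun y ↦ B.η y (Y y)) x := by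
  simp [biLegendrianConnection_cov]

theorem proj₁_biLegendrianConnection (X Y : VField I M) (x : M) :
    B.proj₁ x ((B.biLegendrianConnection D).cov X Y x) =
      B.proj₁ x (D.cov X (B.proj₁.app Y) x) + B.η x (X x) • B.proj₁ x (Y x) := by
  simp [biLegendrianConnection_cov]

theorem proj₂_biLegendrianConnection (X Y : VField I M) (x : M) :
    B.proj₂ x ((B.biLegendrianConnection D).cov X Y x) =
      B.proj₂ x (D.cov X (B.proj₂.app Y) x) - B.η x (X x) • B.proj₂ x (Y x) := by
  simp [biLegendrianConnection_cov, sub_eq_add_neg]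

theorem ext_proj {x : M} {v w : TangentSpace I x} (h₁ : B.proj₁ x v = B.proj₁ x w)
    (h₂ : B.proj₂ x v = B.proj₂ x w) (h₃ : B.η x v = B.η x w) : v = w := by
  rw [B.decomp x v, h₁, h₂, h₃]
  exact (B.decomp x w).symm

theorem d_left_proj₂ (x : M) (v w : TangentSpace I x) :
    B.η.d x v (B.proj₂ x w) = B.η.d x (B.proj₁ x v) (B.proj₂ x w) :=
  B.d_left_L₂ v (B.proj₂_mem x w)

theorem d_right_proj₁ (x : M) (v w : TangentSpace I x) :
    B.η.d x (B.proj₁ x v) w = B.η.d x (B.proj₁ x v) (B.proj₂ x w) := by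
  rw [B.η.d_swap, B.d_left_L₁ _ (B.proj₁_mem x v), ← B.η.d_swap]

theorem biLegendrianConnection_reeb (X : VField I M) (x : M) :
    (B.biLegendrianConnection D).cov X B.reeb x = 0 := by
  have e₁ : B.proj₁.app B.reeb = 0 := by
    ext y
    simp [EndField.app]
  have e₂ : B.proj₂.app B.reeb = 0 := by
    ext y
    simp [EndField.app]
  rw [biLegendrianConnection_cov, e₁, e₂, D.cov_zero]
  simp [dirDeriv_const]

theorem bracket_reeb_decomp {X : VField I M} (hX : SmoothField X) (x : M) :
    bracket B.reeb X x = bracket B.reeb (B.proj₁.app X) x + bracket B.reeb (B.proj₂.app X) x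
      + dirDeriv B.reeb (fun y ↦ B.η y (X y)) x • B.reeb x := by
  have h₁ := (B.proj₁_smooth.app hX).mdiff x
  have h₂ := (B.proj₂_smooth.app hX).mdiff x
  have hη : CMDiff ∞ fun y ↦ B.η y (X y) := B.η.smooth.app hX
  have e : X = B.proj₁.app X + B.proj₂.app X + (fun y ↦ B.η y (X y)) • B.reeb := by
    ext y
    exact B.decomp y (X y)
  have h0 : bracket B.reeb B.reeb x = 0 := by
    rw [bracket, VectorField.mlieBracket_self]
    rfl
  conv_lhs => rw [e]
  rw [bracket_add_right (mdifferentiableAt_add_section h₁ h₂)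
    ((mdiff_of_smooth hη x).smul_section (B.reeb_smooth.mdiff x)), bracket_add_right h₁ h₂,
    bracket_smul_right (mdiff_of_smooth hη x) (B.reeb_smooth.mdiff x), h0, smul_zero, add_zero]

variable {D} (hD : D.IsLeviCivita B.paracontact.g)
include hD

theorem biLegendrianConnection_smooth : (B.biLegendrianConnection D).Smooth := by
  refine Connection.smooth_of_forall fun X Y hX hY ↦ ?_
  have e := funext (B.biLegendrianConnection_cov D X Y)
  rw [e]
  exact (((B.proj₁_smooth.app (hD.smooth.cov hX (B.proj₁_smooth.app hY))).add
    (B.proj₂_smooth.app (hD.smooth.cov hX (B.proj₂_smooth.app hY)))).add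
    (B.reeb_smooth.smul (dirDeriv_smooth hX (B.η.smooth.app hY)))).add
    ((B.ψ_smooth.app hY).smul (B.η.smooth.app hX))

theorem canonicalConnection_smooth : (B.canonicalConnection D).Smooth := by
  refine Connection.smooth_of_forall fun X Y hX hY ↦ ?_
  have hA := hD.smooth.cov hX B.reeb_smooth
  have e := funext (B.canonicalConnection_cov D X Y)
  rw [e]
  exact (((hD.smooth.cov hX hY).add ((B.ψ_smooth.app hY).smul (B.η.smooth.app hX))).sub
    (hA.smul (B.η.smooth.app hY))).add
    (B.reeb_smooth.smul (B.isSemiRiemannian.smooth.app hY hA))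

theorem biLegendrianConnection_parallel_d :
    (B.biLegendrianConnection D).ParallelBilin B.η.d := by
  have h {X Y Z : VField I M} (hX : SmoothField X) (hY : SmoothField Y) (hZ : SmoothField Z)
      (x : M) : dirDeriv X (fun y ↦ B.η.d y (B.proj₁ y (Y y)) (B.proj₂ y (Z y))) x =
        B.η.d x (B.proj₁ x ((B.biLegendrianConnection D).cov X Y x)) (B.proj₂ x (Z x)) +
        B.η.d x (B.proj₁ x (Y x)) (B.proj₂ x ((B.biLegendrianConnection D).cov X Z x)) := by
    have h1 := hD.isAdapted.d₁₂ X _ _ hX (B.isSection_proj₁ hY) (B.isSection_proj₂ hZ) x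
    rw [B.d_left_proj₂, B.d_right_proj₁ x (Y x)] at h1
    rw [h1, proj₁_biLegendrianConnection, proj₂_biLegendrianConnection]
    simp
  intro X Y Z hX hY hZ x
  have h1 := h hX hY hZ x
  have h2 := h hX hZ hY x
  have s₁ := B.η.d_smooth.app (B.proj₁_smooth.app hY) (B.proj₂_smooth.app hZ)
  have s₂ := B.η.d_smooth.app (B.proj₂_smooth.app hY) (B.proj₁_smooth.app hZ)
  rw [Connection.covBilin, B.d_decomp x _ (Z x), B.d_decomp x (Y x)]
  have e : (fun y ↦ B.η.d y (Y y) (Z y)) = fun y ↦ B.η.d y (B.proj₁.app Y y) (B.proj₂.app Z y) +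
      B.η.d y (B.proj₂.app Y y) (B.proj₁.app Z y) := by
    ext y
    exact B.d_decomp y _ _
  rw [e, dirDeriv_add X (mdiff_of_smooth s₁ x) (mdiff_of_smooth s₂ x)]
  simp only [B.η.d_swap _ (B.proj₁ _ (Z _)), dirDeriv_neg,
    B.η.d_swap _ (B.proj₁ _ ((B.biLegendrianConnection D).cov X Z _))] at h2
  linarith

theorem isBiLegendrian : (B.biLegendrianConnection D).IsBiLegendrian B where
  smooth := B.biLegendrianConnection_smooth hD
  preserves_L₁ X Y hX hY x := by
    rw [biLegendrianConnection_cov, B.proj₁_app_section hY, B.proj₂_app_section₁ hY, D.cov_zero,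
      B.ψ_L₁ (hY.2 x)]
    simp only [B.η_L₁ (hY.2 _), dirDeriv_const, map_zero, zero_smul, add_zero]
    exact add_mem (B.proj₁_mem x _) (Submodule.smul_mem _ _ (hY.2 x))
  preserves_L₂ X Y hX hY x := by
    rw [biLegendrianConnection_cov, B.proj₂_app_section hY, B.proj₁_app_section₂ hY, D.cov_zero,
      B.ψ_L₂ (hY.2 x)]
    simp only [B.η_L₂ (hY.2 _), dirDeriv_const, map_zero, zero_smul, add_zero, zero_add]
    exact add_mem (B.proj₂_mem x _) (Submodule.smul_mem _ _ (neg_mem (hY.2 x)))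
  preserves_reeb X Y hX hY x := by
    have h (y) : ∃ c : ℝ, c • B.reeb y = Y y := Submodule.mem_span_singleton.1 (hY.2 y)
    have e₁ : B.proj₁.app Y = 0 := by
      ext y
      obtain ⟨c, hc⟩ := h y
      simp [EndField.app, ← hc]
    have e₂ : B.proj₂.app Y = 0 := by
      ext y
      obtain ⟨c, hc⟩ := h y
      simp [EndField.app, ← hc]
    have e₃ : B.paracontact.ψ x (Y x) = 0 := by
      obtain ⟨c, hc⟩ := h x
      simp [← hc]
    rw [biLegendrianConnection_cov, e₁, e₂, e₃, D.cov_zero]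
    simp only [map_zero, smul_zero, add_zero, zero_add]
    exact Submodule.smul_mem _ _ (Submodule.mem_span_singleton_self _)
  parallel_reeb X _ := B.biLegendrianConnection_reeb D X
  parallel_d := B.biLegendrianConnection_parallel_d hD
  torsion_L₁_L₂ X Y hX hY x := by
    have hb := Connection.bracket_of_torsion_free hD.torsion_free hX.1 hY.1 x
    have hη := B.η.η_bracket hX.1 hY.1 (fun x ↦ B.η_L₁ (hX.2 x)) (fun x ↦ B.η_L₂ (hY.2 x)) x
    rw [Connection.torsion_field _ hX.1 hY.1]
    have h₁ := hD.isAdapted.proj₁_cov₁₂ hX hY x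
    have h₂ := hD.isAdapted.proj₂_cov₂₁ hY hX x
    refine B.ext_proj ?_ ?_ ?_
    · rw [map_sub, map_sub, proj₁_biLegendrianConnection, proj₁_biLegendrianConnection,
        B.proj₁_app_section₂ hY, B.proj₁_app_section hX, D.cov_zero, hb, map_sub, h₁,
        B.η_L₁ (hX.2 x), B.η_L₂ (hY.2 x)]
      simp
    · rw [map_sub, map_sub, proj₂_biLegendrianConnection, proj₂_biLegendrianConnection,
        B.proj₂_app_section₁ hX, B.proj₂_app_section hY, D.cov_zero, hb, map_sub, h₂,
        B.η_L₁ (hX.2 x), B.η_L₂ (hY.2 x)]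
      simp
    · rw [map_sub, map_sub, η_biLegendrianConnection, η_biLegendrianConnection, hη]
      simp [B.η_L₁ (hX.2 _), B.η_L₂ (hY.2 _), dirDeriv_const]
  torsion_reeb X hX x := by
    have hX₁ := B.isSection_proj₁ hX
    have hX₂ := B.isSection_proj₂ hX
    have hb {Y : VField I M} (hY : SmoothField Y) :
        bracket B.reeb Y x = D.cov B.reeb Y x - D.cov Y B.reeb x :=
      Connection.bracket_of_torsion_free hD.torsion_free B.reeb_smooth hY x
    have hη := B.η.two_d B.reeb_smooth hX x
    simp only [B.d_reeb_left, B.η_reeb, dirDeriv_const] at hη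
    rw [Connection.torsion_field _ hX B.reeb_smooth, biLegendrianConnection_reeb, bracket_swap X]
    -- the part of `[ξ, X₁]` in `L₁` is `(∇_ξ X₁)₁ + X₁`, as `(∇_{X₁} ξ)₁ = - X₁`; similarly on `L₂`
    refine B.ext_proj ?_ ?_ ?_
    · rw [map_sub, map_sub, map_neg, proj₁_biLegendrianConnection, B.bracket_reeb_decomp hX,
        map_add, map_add, hb hX₁.1, map_sub, hD.proj₁_cov_reeb hX₁]
      simp
    · rw [map_sub, map_sub, map_neg, proj₂_biLegendrianConnection, B.bracket_reeb_decomp hX,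
        map_add, map_add, hb hX₂.1, map_sub, hD.proj₂_cov_reeb hX₂]
      simp
    · rw [map_sub, map_sub, map_neg, η_biLegendrianConnection, map_add, η_proj₁, η_proj₂,
        map_zero]
      linarith

theorem biLegendrianConnection_parallel_ψ :
    (B.biLegendrianConnection D).ParallelEnd B.paracontact.ψ := by
  intro X Y hX hY x
  have e₁ : B.proj₁.app (B.paracontact.ψ.app Y) = B.proj₁.app Y := by
    ext y
    simp [EndField.app]
  have e₂ : B.proj₂.app (B.paracontact.ψ.app Y) = fun y ↦ - B.proj₂.app Y y := by
    ext y
    simp [EndField.app]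
  rw [Connection.covEnd, sub_eq_zero]
  refine B.ext_proj ?_ ?_ ?_
  · rw [proj₁_ψ, proj₁_biLegendrianConnection, proj₁_biLegendrianConnection, e₁]
    simp [EndField.app]
  · rw [proj₂_ψ, proj₂_biLegendrianConnection, proj₂_biLegendrianConnection, e₂,
      D.cov_neg _ ((B.proj₂_smooth.app hY).mdiff x)]
    simp [EndField.app, sub_eq_add_neg, add_comm]
  · rw [η_ψ, η_biLegendrianConnection]
    simp [EndField.app, dirDeriv_const]

theorem biLegendrianConnection_parallel_g :
    (B.biLegendrianConnection D).ParallelBilin B.paracontact.g := by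
  intro X Y Z hX hY hZ x
  have hψ := sub_eq_zero.1 (B.biLegendrianConnection_parallel_ψ hD X Z hX hZ x)
  have hd := B.biLegendrianConnection_parallel_d hD X Y _ hX hY (B.ψ_smooth.app hZ) x
  have s₁ := B.η.d_smooth.app hY (B.ψ_smooth.app hZ)
  have sY := B.η.smooth.app hY
  have sZ := B.η.smooth.app hZ
  have e : (fun y ↦ B.paracontact.g y (Y y) (Z y)) = fun y ↦
      B.η.d y (Y y) (B.paracontact.ψ.app Z y) + B.η y (Y y) * B.η y (Z y) := by
    ext y
    exact B.paracontact_g_apply y _ _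
  have sYZ : CMDiff ∞ fun y ↦ B.η y (Y y) * B.η y (Z y) := sY.mul sZ
  rw [Connection.covBilin, hψ] at hd
  rw [Connection.covBilin, e, dirDeriv_add X (mdiff_of_smooth s₁ x)
    (mdiff_of_smooth sYZ x), dirDeriv_mul X (mdiff_of_smooth sY x)
    (mdiff_of_smooth sZ x), paracontact_g_apply, paracontact_g_apply, η_biLegendrianConnection,
    η_biLegendrianConnection]
  linarith

/-- `(∇_X η) Y = g(∇_X ξ, Y)` for the Levi-Civita connection. -/
theorem dirDeriv_η {X Y : VField I M} (hX : SmoothField X) (hY : SmoothField Y) (x : M) :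
    dirDeriv X (fun y ↦ B.η y (Y y)) x =
      B.η x (D.cov X Y x) + B.paracontact.g x (Y x) (D.cov X B.reeb x) := by
  have h := hD.metric X Y B.reeb hX hY B.reeb_smooth x
  simp only [Connection.covBilin, B.g_reeb] at h
  linarith

theorem canonicalConnection_reeb {X : VField I M} (hX : SmoothField X) (x : M) :
    (B.canonicalConnection D).cov X B.reeb x = 0 := by
  rw [canonicalConnection_cov, B.ψ_reeb, B.η_reeb, B.g_symm, B.g_reeb,
    hD.isAdapted.η_cov_reeb X hX]
  simp

/-- The torsion of the canonical connection: `T(ξ, Y) = ψ Y + ∇_Y ξ`, and `T = 2 dη ⊗ ξ` on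
`ker η`. -/
theorem canonicalConnection_torsion (x : M) (v w : TangentSpace I x) :
    (B.canonicalConnection D).torsion x v w = B.η x v • (B.paracontact.ψ x w + D B.reeb x w)
      - B.η x w • (B.paracontact.ψ x v + D B.reeb x v) + (2 * B.η.d x v w) • B.reeb x := by
  obtain ⟨X, hX, rfl⟩ := exists_smoothField x v
  obtain ⟨Y, hY, rfl⟩ := exists_smoothField x w
  have h := B.η.two_d hX hY x
  have hb := Connection.bracket_of_torsion_free hD.torsion_free hX hY x
  rw [B.dirDeriv_η hD hX hY, B.dirDeriv_η hD hY hX, hb, map_sub] at h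
  rw [Connection.torsion_field _ hX hY, hb, h, canonicalConnection_cov, canonicalConnection_cov]
  simp only [Connection.cov]
  module

theorem isCanonicalConnection :
    B.paracontact.IsCanonicalConnection (B.canonicalConnection D) where
  smooth := B.canonicalConnection_smooth hD
  parallel_η X Y hX hY x := by
    change dirDeriv X (fun y ↦ B.η y (Y y)) x - B.η x _ = 0
    rw [B.dirDeriv_η hD hX hY, canonicalConnection_cov]
    simp only [map_add, map_sub, map_smul, η_ψ, η_reeb, hD.isAdapted.η_cov_reeb X hX, smul_eq_mul]
    ring
  parallel_ξ X hX := B.canonicalConnection_reeb hD hX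
  parallel_g X Y Z hX hY hZ x := by
    have h := hD.metric X Y Z hX hY hZ x
    rw [Connection.covBilin] at h ⊢
    rw [canonicalConnection_cov, canonicalConnection_cov]
    simp only [map_add, map_sub, map_smul, add_apply, sub_apply, FunLike.coe_smul, Pi.smul_apply,
      smul_eq_mul, g_ψ_left, g_reeb, B.g_symm x (B.reeb x), B.g_symm x (D.cov X B.reeb x)]
    linarith
  cov_ψ := by
    refine ⟨D, hD, fun X Y hX hY x ↦ ?_⟩
    have h : X x - B.paracontact.h X x =
        B.η x (X x) • B.reeb x - B.paracontact.ψ x (D.cov X B.reeb x) := by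
      rw [hD.h_eq hX]
      abel
    rw [h, Connection.covEnd, Connection.covEnd, canonicalConnection_cov, canonicalConnection_cov]
    change D.cov X (B.paracontact.ψ.app Y) x + B.η x (X x) • B.paracontact.ψ x
      (B.paracontact.ψ x (Y x)) - B.η x (B.paracontact.ψ x (Y x)) • D.cov X B.reeb x +
      B.paracontact.g x (B.paracontact.ψ x (Y x)) (D.cov X B.reeb x) • B.reeb x - _ =
      D.cov X (B.paracontact.ψ.app Y) x - _ + _ • B.reeb x - B.η x (Y x) • _
    simp only [map_add, map_sub, map_smul, sub_apply, FunLike.coe_smul, Pi.smul_apply,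
      smul_eq_mul, g_ψ_left, g_reeb, B.g_symm x (B.reeb x), η_ψ, ψ_reeb, B.g_symm x (B.paracontact.ψ x (D.cov X B.reeb x))]
    module
  torsion_ξ x v := by
    change (B.canonicalConnection D).torsion x (B.reeb x) _ =
      - B.paracontact.ψ x ((B.canonicalConnection D).torsion x (B.reeb x) v)
    have h := hD.ψ_cov_reeb x v
    have h0 : D B.reeb x (B.reeb x) = 0 := hD.cov_reeb_reeb x
    rw [B.canonicalConnection_torsion hD, B.canonicalConnection_torsion hD]
    simp only [η_reeb, η_ψ, ψ_reeb, d_reeb_left, h0, map_add, map_sub, map_smul, ψ_ψ]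
    rw [← eq_sub_iff_add_eq'] at h
    rw [h]
    simp only [map_zero, smul_zero, zero_smul, one_smul, mul_zero, add_zero, sub_zero]
    module
  torsion_kernel x v hv w hw := by
    rw [B.canonicalConnection_torsion hD, show B.η x v = 0 from hv, show B.η x w = 0 from hw]
    simp only [zero_smul, sub_zero, zero_add]
    rfl

end AlmostBiLegendrian

end Existence

/-! ### Uniqueness, and comparison of the two connections -/

section Uniqueness

variable {E : Type*} [NormedAddCommGroup E] [NormedSpace ℝ E] [FiniteDimensional ℝ E]
  [CompleteSpace E] {H : Type*} [TopologicalSpace H] {I : ModelWithCorners ℝ E H}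
  {M : Type*} [TopologicalSpace M] [ChartedSpace H M] [IsManifold I ∞ M] [T2Space M] {n : ℕ}

theorem bracket_expand {X₁ X₂ Y₁ Y₂ : VField I M} (hX₁ : SmoothField X₁) (hX₂ : SmoothField X₂)
    (hY₁ : SmoothField Y₁) (hY₂ : SmoothField Y₂) (x : M) (a b : ℝ) :
    bracket (fun y ↦ X₁ y + a • X₂ y) (fun y ↦ Y₁ y + b • Y₂ y) x =
      bracket X₁ Y₁ x + b • bracket X₁ Y₂ x + a • bracket X₂ Y₁ x
        + (a * b) • bracket X₂ Y₂ x := by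
  have hc (c : ℝ) {Z : VField I M} (hZ : SmoothField Z) :
      MDiffAt (T% ((fun _ : M ↦ c) • Z)) x := (SmoothField.smul contMDiff_const hZ).mdiff x
  have e1 : (fun y ↦ X₁ y + a • X₂ y) = X₁ + (fun _ : M ↦ a) • X₂ := rfl
  have e2 : (fun y ↦ Y₁ y + b • Y₂ y) = Y₁ + (fun _ : M ↦ b) • Y₂ := rfl
  rw [e1, e2, bracket_add_left (hX₁.mdiff x) (hc a hX₂), bracket_add_right (hY₁.mdiff x) (hc b hY₂),
    bracket_add_right (hY₁.mdiff x) (hc b hY₂),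
    bracket_smul_right mdifferentiableAt_const (hY₂.mdiff x),
    bracket_smul_right mdifferentiableAt_const (hY₂.mdiff x),
    bracket_smul_left mdifferentiableAt_const (hX₂.mdiff x),
    bracket_smul_left mdifferentiableAt_const (hX₂.mdiff x)]
  simp only [dirDeriv_const]
  module

/-- A trilinear expression that is symmetric in the first two and skew in the last two arguments
vanishes. -/
theorem eq_zero_of_symm_of_skew {α : Type*} {c : α → α → α → ℝ} {p : α → Prop}
    (h1 : ∀ a b d, p a → p b → p d → c a b d = c b a d)
    (h2 : ∀ a b d, p a → p b → p d → c a b d = - c a d b)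
    {a b d : α} (ha : p a) (hb : p b) (hd : p d) : c a b d = 0 := by
  have e1 := h2 a b d ha hb hd
  have e2 := h1 a d b ha hd hb
  have e3 := h2 d a b hd ha hb
  have e4 := h1 d b a hd hb ha
  have e5 := h2 b d a hb hd ha
  have e6 := h1 b a d hb ha hd
  linarith

/-- Two metric connections with the same torsion coincide. -/
theorem IsSemiRiemannian.coincide {g : BilinField I M} (hg : IsSemiRiemannian g)
    {D D' : Connection I M} (hD : D.ParallelBilin g) (hD' : D'.ParallelBilin g)
    (hT : ∀ x v w, D.torsion x v w = D'.torsion x v w) : D.Coincide D' := by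
  intro X Y hX hY
  ext x
  rw [← sub_eq_zero]
  refine hg.nondegenerate x _ fun w ↦ ?_
  obtain ⟨Z, hZ, rfl⟩ := exists_smoothField x w
  refine eq_zero_of_symm_of_skew (p := SmoothField)
    (c := fun X Y Z ↦ g x (D.cov X Y x - D'.cov X Y x) (Z x)) (fun X Y Z hX hY hZ ↦ ?_)
    (fun X Y Z hX hY hZ ↦ ?_) hX hY hZ
  · have h := hT x (X x) (Y x)
    rw [D.torsion_field hX hY, D'.torsion_field hX hY] at h
    congr 2
    linear_combination (norm := module) h
  · have h := hD X Y Z hX hY hZ x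
    have h' := hD' X Y Z hX hY hZ x
    rw [Connection.covBilin, hg.symm x (Y x)] at h h'
    simp only [map_sub, sub_apply]
    linarith

namespace Connection

variable [hE : Fact (finrank ℝ E = 2 * n + 1)] {B : AlmostBiLegendrian I M n}
  {D D' : Connection I M}
include hE

theorem cov_decomp {X Y : VField I M} {x : M} (h : D.cov X B.reeb x = 0) (hY : SmoothField Y) :
    D.cov X Y x = D.cov X (B.proj₁.app Y) x + D.cov X (B.proj₂.app Y) x
      + dirDeriv X (fun y ↦ B.η y (Y y)) x • B.reeb x := by
  have hY₁ := (B.isSection_proj₁ hY).1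
  have hY₂ := (B.isSection_proj₂ hY).1
  have hη : CMDiff ∞ fun y ↦ B.η y (Y y) := B.η.smooth.app hY
  have e : Y = fun y ↦ (B.proj₁.app Y y + B.proj₂.app Y y) + B.η y (Y y) • B.reeb y := by
    ext y
    exact B.decomp y (Y y)
  conv_lhs => rw [e]
  rw [D.cov_add _ ((hY₁.add hY₂).mdiff x) ((B.reeb_smooth.smul hη).mdiff x),
    D.cov_add _ (hY₁.mdiff x) (hY₂.mdiff x),
    D.cov_smul _ (mdiff_of_smooth hη x) (B.reeb_smooth.mdiff x), h, smul_zero, zero_add]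

namespace IsBiLegendrian

variable (hD : D.IsBiLegendrian B)
include hD

theorem swap : D.IsBiLegendrian B.swap where
  smooth := hD.smooth
  preserves_L₁ := hD.preserves_L₂
  preserves_L₂ := hD.preserves_L₁
  preserves_reeb := hD.preserves_reeb
  parallel_reeb := hD.parallel_reeb
  parallel_d := hD.parallel_d
  torsion_L₁_L₂ X Y hX hY x := by
    rw [D.torsion_antisymm, hD.torsion_L₁_L₂ Y X hY hX, ← neg_smul]
    change _ = (2 * B.η.d x (X x) (Y x)) • B.reeb x
    rw [B.η.d_swap x (X x), mul_neg]
  torsion_reeb X hX x := (hD.torsion_reeb X hX x).trans (add_comm _ _)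

theorem cov₂₁ {X Y : VField I M} (hX : IsSection B.L₂ X) (hY : IsSection B.L₁ Y) (x : M) :
    D.cov X Y x = B.proj₁ x (bracket X Y x) := by
  have h := congrArg (B.proj₁ x) (hD.torsion_L₁_L₂ Y X hY hX x)
  rw [D.torsion_field hY.1 hX.1, map_sub, map_sub, B.proj₁_L₂ (hD.preserves_L₂ Y X hY.1 hX x),
    B.proj₁_L₁ (hD.preserves_L₁ X Y hX.1 hY x), map_smul, B.proj₁_reeb, smul_zero,
    bracket_swap, map_neg] at h
  linear_combination (norm := module) - h

theorem cov₁₂ {X Y : VField I M} (hX : IsSection B.L₁ X) (hY : IsSection B.L₂ Y) (x : M) :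
    D.cov X Y x = B.proj₂ x (bracket X Y x) := hD.swap.cov₂₁ hX hY x

theorem cov_reeb₁ {Y : VField I M} (hY : IsSection B.L₁ Y) (x : M) :
    D.cov B.reeb Y x = B.proj₁ x (bracket B.reeb Y x) := by
  have h := congrArg (B.proj₁ x) (hD.torsion_reeb Y hY.1 x)
  rw [D.torsion_field hY.1 B.reeb_smooth, hD.parallel_reeb Y hY.1, B.proj₂_app_section₁ hY,
    map_sub, map_sub, B.proj₁_L₁ (hD.preserves_L₁ _ Y B.reeb_smooth hY x), bracket_swap Y,
    map_add, B.proj₁_proj₂, show bracket B.reeb 0 x = 0 from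
      congrFun (VectorField.mlieBracket_zero_right (W := B.reeb)) x] at h
  simp only [map_zero, map_neg] at h
  linear_combination (norm := module) - h

/-- On `L₁ × L₁` the connection is determined by `∇ dη = 0`, because `∇_X Z = [X, Z]_{L₂}` for
`Z` in `L₂`. -/
theorem d_cov₁₁ {X Y Z : VField I M} (hX : IsSection B.L₁ X) (hY : IsSection B.L₁ Y)
    (hZ : IsSection B.L₂ Z) (x : M) : B.η.d x (D.cov X Y x) (Z x) =
      dirDeriv X (fun y ↦ B.η.d y (Y y) (Z y)) x
        - B.η.d x (Y x) (B.proj₂ x (bracket X Z x)) := by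
  have h := hD.parallel_d X Y Z hX.1 hY.1 hZ.1 x
  rw [covBilin, hD.cov₁₂ hX hZ] at h
  linarith

theorem cov_eq₁ (hD' : D'.IsBiLegendrian B) {X Y : VField I M} (hX : SmoothField X)
    (hY : IsSection B.L₁ Y) (x : M) : D.cov X Y x = D'.cov X Y x := by
  have hX₁ := B.isSection_proj₁ hX
  have hX₂ := B.isSection_proj₂ hX
  have h₁ : D.cov (B.proj₁.app X) Y x = D'.cov (B.proj₁.app X) Y x := by
    have h := hD.preserves_L₁ _ Y hX₁.1 hY x
    have h' := hD'.preserves_L₁ _ Y hX₁.1 hY x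
    rw [← sub_eq_zero, ← B.proj₁_L₁ (sub_mem h h')]
    refine B.proj₁_eq_zero fun w hw ↦ ?_
    obtain ⟨Z, hZ, rfl⟩ := B.exists_section₂ hw
    rw [map_sub, sub_apply, hD.d_cov₁₁ hX₁ hY hZ, hD'.d_cov₁₁ hX₁ hY hZ, sub_self]
  have h₂ : D.cov (B.proj₂.app X) Y x = D'.cov (B.proj₂.app X) Y x := by
    rw [hD.cov₂₁ hX₂ hY, hD'.cov₂₁ hX₂ hY]
  have h₃ : D.cov B.reeb Y x = D'.cov B.reeb Y x := by
    rw [hD.cov_reeb₁ hY, hD'.cov_reeb₁ hY]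
  simp only [cov] at h₁ h₂ h₃ ⊢
  rw [B.decomp x (X x)]
  simp only [map_add, map_smul, h₁, h₂, h₃]

/-- The bi-Legendrian connection is unique. -/
theorem coincide (hD' : D'.IsBiLegendrian B) : D.Coincide D' := by
  intro X Y hX hY
  ext x
  have hY₁ := B.isSection_proj₁ hY
  have hY₂ := B.isSection_proj₂ hY
  rw [cov_decomp (hD.parallel_reeb X hX x) hY, cov_decomp (hD'.parallel_reeb X hX x) hY, hD.cov_eq₁ hD' hX hY₁, hD.swap.cov_eq₁ hD'.swap hX hY₂]

end IsBiLegendrian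

/-- The canonical paracontact connection is unique: the formula for `∇_ξ ψ` and the behaviour of
`T(ξ, ·)` under `ψ` determine `ψ ∇_ξ Y`, and `∇η = 0` determines `η(∇_ξ Y)`. Hence the torsion is
determined. -/
theorem coincide_of_isCanonicalConnection (hD : B.paracontact.IsCanonicalConnection D)
    (hD' : B.paracontact.IsCanonicalConnection D') : D.Coincide D' := by
  have hg := B.isSemiRiemannian
  have hξ (x : M) (v : TangentSpace I x) :
      D.torsion x (B.reeb x) v = D'.torsion x (B.reeb x) v := by
    obtain ⟨Y, hY, rfl⟩ := exists_smoothField x v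
    obtain ⟨D₀, hD₀, h⟩ := hD.cov_ψ
    obtain ⟨D₀', hD₀', h'⟩ := hD'.cov_ψ
    have hc : D₀.Coincide D₀' := hg.coincide hD₀.metric hD₀'.metric fun x v w ↦ by
      rw [hD₀.torsion_free, hD₀'.torsion_free]
    have hψY := B.ψ_smooth.app hY
    have hc' : D₀.covEnd B.paracontact.ψ B.reeb Y x = D₀'.covEnd B.paracontact.ψ B.reeb Y x := by
      rw [covEnd, covEnd, hc _ _ B.reeb_smooth hY, hc _ _ B.reeb_smooth hψY]
    have e1 : D.covEnd B.paracontact.ψ B.reeb Y x = D'.covEnd B.paracontact.ψ B.reeb Y x := by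
      rw [h _ _ B.reeb_smooth hY, h' _ _ B.reeb_smooth hY, hc']
    have t {D : Connection I M} (hD : B.paracontact.IsCanonicalConnection D) {Y : VField I M}
        (hY : SmoothField Y) :
        D.torsion x (B.reeb x) (Y x) = D.cov B.reeb Y x - bracket B.reeb Y x := by
      rw [D.torsion_field B.reeb_smooth hY]
      have h0 : D.cov Y B.reeb x = 0 := hD.parallel_ξ Y hY x
      rw [h0, sub_zero]
    have e2 := hD.torsion_ξ x (Y x)
    have e2' := hD'.torsion_ξ x (Y x)
    change D.torsion x (B.reeb x) (B.paracontact.ψ.app Y x) =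
      - B.paracontact.ψ x (D.torsion x (B.reeb x) (Y x)) at e2
    change D'.torsion x (B.reeb x) (B.paracontact.ψ.app Y x) =
      - B.paracontact.ψ x (D'.torsion x (B.reeb x) (Y x)) at e2'
    rw [t hD hY, t hD hψY, map_sub] at e2
    rw [t hD' hY, t hD' hψY, map_sub] at e2'
    rw [covEnd, covEnd] at e1
    -- `∇_ξ - ∇'_ξ` commutes with `ψ` by `e1` and anticommutes with it by `e2` and `e2'`
    have e3 : B.paracontact.ψ x (D.cov B.reeb Y x - D'.cov B.reeb Y x) = 0 := by
      rw [map_sub]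
      linear_combination (norm := module) (1 / 2 : ℝ) • (e2 - e2' - e1)
    have e4 := hD.parallel_η B.reeb Y B.reeb_smooth hY x
    have e4' := hD'.parallel_η B.reeb Y B.reeb_smooth hY x
    have e5 : B.η x (D.cov B.reeb Y x - D'.cov B.reeb Y x) = 0 := by
      change dirDeriv _ (fun y ↦ B.η y (Y y)) x - B.η x _ = 0 at e4 e4'
      rw [map_sub]
      linarith
    have e6 := B.ψ_ψ x (D.cov B.reeb Y x - D'.cov B.reeb Y x)
    rw [e3, e5, map_zero, zero_smul, sub_zero] at e6
    rw [t hD hY, t hD' hY, sub_eq_zero.1 e6.symm]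
  refine hg.coincide hD.parallel_g hD'.parallel_g fun x v w ↦ ?_
  have hk {v w : TangentSpace I x} (hv : B.η x v = 0) (hw : B.η x w = 0) :
      D.torsion x v w = D'.torsion x v w := by
    rw [hD.torsion_kernel x v hv w hw, hD'.torsion_kernel x v hv w hw]
  have hv : B.η x (v - B.η x v • B.reeb x) = 0 := by simp
  have hw : B.η x (w - B.η x w • B.reeb x) = 0 := by simp
  -- both torsions agree on the components of `v` and `w` in `ker η` and on `ξ`
  have h := hk hv hw
  simp only [map_sub, map_smul, sub_apply, FunLike.coe_smul, Pi.smul_apply,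
    CovariantDerivative.torsion_self, D.torsion_antisymm v (B.reeb x),
    D'.torsion_antisymm v (B.reeb x), hξ] at h
  linear_combination (norm := module) h

end Connection

namespace AlmostBiLegendrian

variable [hE : Fact (finrank ℝ E = 2 * n + 1)] (B : AlmostBiLegendrian I M n)
  {D : Connection I M}
include hE

/-- The difference of the two connections on sections of `L₁`. The components along `ξ` agree since
`η(∇_X Y) + g(Y, ∇_X ξ) = X(η Y) = 0`. -/
theorem canonicalConnection_sub₁ (hD : D.IsLeviCivita B.paracontact.g) {X Y : VField I M}
    (hX : SmoothField X) (hY : IsSection B.L₁ Y) (x : M) :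
    (B.canonicalConnection D).cov X Y x - (B.biLegendrianConnection D).cov X Y x =
      B.proj₂ x (D.cov X Y x) := by
  have h := B.dirDeriv_η hD hX hY.1 x
  have h' := B.decomp x (D.cov X Y x)
  simp only [B.η_L₁ (hY.2 _), dirDeriv_const] at h
  have hs := congrArg (fun c : ℝ ↦ c • B.reeb x) h
  simp only [zero_smul, add_smul] at hs
  rw [canonicalConnection_cov, biLegendrianConnection_cov, B.proj₁_app_section hY,
    B.proj₂_app_section₁ hY, D.cov_zero]
  simp only [B.η_L₁ (hY.2 _), dirDeriv_const, map_zero]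
  linear_combination (norm := module) h' - hs

theorem canonicalConnection_sub₂ (hD : D.IsLeviCivita B.paracontact.g) {X Y : VField I M}
    (hX : SmoothField X) (hY : IsSection B.L₂ Y) (x : M) :
    (B.canonicalConnection D).cov X Y x - (B.biLegendrianConnection D).cov X Y x =
      B.proj₁ x (D.cov X Y x) := by
  have h := B.dirDeriv_η hD hX hY.1 x
  have h' := B.decomp x (D.cov X Y x)
  simp only [B.η_L₂ (hY.2 _), dirDeriv_const] at h
  have hs := congrArg (fun c : ℝ ↦ c • B.reeb x) h
  simp only [zero_smul, add_smul] at hs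
  rw [canonicalConnection_cov, biLegendrianConnection_cov, B.proj₂_app_section hY,
    B.proj₁_app_section₂ hY, D.cov_zero]
  simp only [B.η_L₂ (hY.2 _), dirDeriv_const, map_zero]
  linear_combination (norm := module) h' - hs

/-- If `[X, Y]_{L₂} = 0` for all `X`, `Y` in `L₁`, then, for `X`, `Y`, `Z` in `L₁`, `dη(∇_X Y, Z)`
is symmetric in `X`, `Y` and skew in `Y`, `Z`, so that it vanishes. For `X` in `L₂ ⊕ ℝ ξ` the part
of `∇_X Y` in `L₂` vanishes anyway. -/
theorem proj₂_cov_eq_zero (hD : D.IsAdapted B)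
    (h : ∀ X Y : VField I M, IsSection B.L₁ X → IsSection B.L₁ Y → ∀ x,
      B.proj₂ x (bracket X Y x) = 0) {X Y : VField I M} (hX : SmoothField X)
    (hY : IsSection B.L₁ Y) (x : M) : B.proj₂ x (D.cov X Y x) = 0 := by
  have h₁ : B.proj₂ x (D.cov (B.proj₁.app X) Y x) = 0 := by
    refine B.proj₂_eq_zero fun w hw ↦ ?_
    obtain ⟨Z, hZ, rfl⟩ := B.exists_section₁ hw
    refine eq_zero_of_symm_of_skew (p := IsSection B.L₁)
      (c := fun X Y Z ↦ B.η.d x (D.cov X Y x) (Z x)) (fun X Y Z hX hY hZ ↦ ?_)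
      (fun X Y Z hX hY hZ ↦ ?_) (B.isSection_proj₁ hX) hY hZ
    · have hb := h X Y hX hY x
      rw [hD.bracket_eq hX.1 hY.1, map_sub, sub_eq_zero] at hb
      rw [B.d_left_L₁ _ (hZ.2 x), hb, ← B.d_left_L₁ _ (hZ.2 x)]
    · exact eq_neg_of_add_eq_zero_left (hD.d₁₁ X Y Z hX.1 hY hZ x)
  have h₂ := hD.proj₂_cov₂₁ (B.isSection_proj₂ hX) hY x
  have h₃ := hD.proj₂_cov_reeb₁ hY x
  simp only [Connection.cov] at h₁ h₂ h₃ ⊢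
  rw [B.decomp x (X x)]
  simp only [map_add, map_smul, h₁, h₂, h₃, smul_zero, add_zero]

/-- The two connections agree if and only if `[X, Y]_{L₂} = 0` for `X`, `Y` in `L₁` and
`[X, Y]_{L₁} = 0` for `X`, `Y` in `L₂`. -/
theorem coincide_iff (hD : D.IsLeviCivita B.paracontact.g) :
    (B.biLegendrianConnection D).Coincide (B.canonicalConnection D) ↔
      (∀ X Y : VField I M, IsSection B.L₁ X → IsSection B.L₁ Y → ∀ x,
        B.proj₂ x (bracket X Y x) = 0) ∧
      (∀ X Y : VField I M, IsSection B.L₂ X → IsSection B.L₂ Y → ∀ x,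
        B.proj₁ x (bracket X Y x) = 0) := by
  constructor
  · refine fun h ↦ ⟨fun X Y hX hY x ↦ ?_, fun X Y hX hY x ↦ ?_⟩
    · have h1 := B.canonicalConnection_sub₁ hD hX.1 hY x
      have h2 := B.canonicalConnection_sub₁ hD hY.1 hX x
      rw [h X Y hX.1 hY.1, sub_self] at h1
      rw [h Y X hY.1 hX.1, sub_self] at h2
      rw [hD.isAdapted.bracket_eq hX.1 hY.1, map_sub, ← h1, ← h2, sub_self]
    · have h1 := B.canonicalConnection_sub₂ hD hX.1 hY x
      have h2 := B.canonicalConnection_sub₂ hD hY.1 hX x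
      rw [h X Y hX.1 hY.1, sub_self] at h1
      rw [h Y X hY.1 hX.1, sub_self] at h2
      rw [hD.isAdapted.bracket_eq hX.1 hY.1, map_sub, ← h1, ← h2, sub_self]
  · rintro ⟨h₁, h₂⟩ X Y hX hY
    ext x
    have hY₁ := B.isSection_proj₁ hY
    have hY₂ := B.isSection_proj₂ hY
    have e₁ := B.canonicalConnection_sub₁ hD hX hY₁ x
    have e₂ := B.canonicalConnection_sub₂ hD hX hY₂ x
    rw [B.proj₂_cov_eq_zero hD.isAdapted h₁ hX hY₁, sub_eq_zero] at e₁
    rw [show B.proj₁ x (D.cov X (B.proj₂.app Y) x) = 0 from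
      B.swap.proj₂_cov_eq_zero hD.isAdapted.swap h₂ hX hY₂ x, sub_eq_zero] at e₂
    rw [Connection.cov_decomp (B.biLegendrianConnection_reeb D X x) hY,
      Connection.cov_decomp (B.canonicalConnection_reeb hD hX x) hY, e₁, e₂]

variable {B} {X Y : VField I M}

/-- For sections of `ker η`, the part of `N_ψ(X, Y)` in `L₁` is
`4 [X_{L₂}, Y_{L₂}]_{L₁}`, and its part in `L₂` is `4 [X_{L₁}, Y_{L₁}]_{L₂}`. -/
theorem proj_nijenhuis (hX : IsSection B.η.kernel X) (hY : IsSection B.η.kernel Y) (x : M) :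
    B.proj₁ x (B.paracontact.nijenhuis X Y x) =
      (4 : ℝ) • B.proj₁ x (bracket (B.proj₂.app X) (B.proj₂.app Y) x) ∧
    B.proj₂ x (B.paracontact.nijenhuis X Y x) =
      (4 : ℝ) • B.proj₂ x (bracket (B.proj₁.app X) (B.proj₁.app Y) x) := by
  have e {X : VField I M} (hX : IsSection B.η.kernel X) :
      X = fun y ↦ B.proj₁.app X y + (1 : ℝ) • B.proj₂.app X y := by
    ext y
    have h := B.decomp y (X y)
    rw [show B.η y (X y) = 0 from hX.2 y, zero_smul, add_zero] at h
    rw [one_smul]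
    exact h
  have e' (X : VField I M) :
      B.paracontact.ψ.app X = fun y ↦ B.proj₁.app X y + (-1 : ℝ) • B.proj₂.app X y := by
    ext y
    rw [neg_one_smul, ← sub_eq_add_neg]
    rfl
  have hX₁ := (B.isSection_proj₁ hX.1).1
  have hX₂ := (B.isSection_proj₂ hX.1).1
  have hY₁ := (B.isSection_proj₁ hY.1).1
  have hY₂ := (B.isSection_proj₂ hY.1).1
  have b (s t : ℝ) := bracket_expand hX₁ hX₂ hY₁ hY₂ x s t
  have b1 := b 1 1
  have b2 := b (-1) (-1)
  have b3 := b (-1) 1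
  have b4 := b 1 (-1)
  rw [← e hX, ← e hY] at b1
  rw [← e' X, ← e' Y] at b2
  rw [← e' X, ← e hY] at b3
  rw [← e hX, ← e' Y] at b4
  rw [ParacontactData.nijenhuis, b1, b2, b3, b4]
  simp only [map_add, map_sub, map_smul, proj₁_ψ, proj₂_ψ]
  constructor <;> module

/-- The induced structure is integrable if and only if `[X, Y]_{L₂} = 0` for `X`, `Y` in `L₁` and
`[X, Y]_{L₁} = 0` for `X`, `Y` in `L₂`. -/
theorem integrable_iff : B.paracontact.Integrable ↔
      (∀ X Y : VField I M, IsSection B.L₁ X → IsSection B.L₁ Y → ∀ x,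
        B.proj₂ x (bracket X Y x) = 0) ∧
      (∀ X Y : VField I M, IsSection B.L₂ X → IsSection B.L₂ Y → ∀ x,
        B.proj₁ x (bracket X Y x) = 0) := by
  have hl {x : M} {v : TangentSpace I x} :
      v ∈ lineField B.reeb x ↔ B.proj₁ x v = 0 ∧ B.proj₂ x v = 0 := by
    rw [lineField, Submodule.mem_span_singleton]
    constructor
    · rintro ⟨c, rfl⟩
      simp
    · rintro ⟨h₁, h₂⟩
      refine ⟨B.η x v, ?_⟩
      have h := B.decomp x v
      rw [h₁, h₂, add_zero, zero_add] at h
      exact h.symm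
  constructor
  · refine fun h ↦ ⟨fun X Y hX hY x ↦ ?_, fun X Y hX hY x ↦ ?_⟩
    · have hX' : IsSection B.η.kernel X := ⟨hX.1, fun y ↦ B.η_L₁ (hX.2 y)⟩
      have hY' : IsSection B.η.kernel Y := ⟨hY.1, fun y ↦ B.η_L₁ (hY.2 y)⟩
      have h1 := (hl.1 (h X Y hX' hY' x)).2
      rwa [(proj_nijenhuis hX' hY' x).2, smul_eq_zero_iff_right four_ne_zero,
        B.proj₁_app_section hX, B.proj₁_app_section hY] at h1
    · have hX' : IsSection B.η.kernel X := ⟨hX.1, fun y ↦ B.η_L₂ (hX.2 y)⟩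
      have hY' : IsSection B.η.kernel Y := ⟨hY.1, fun y ↦ B.η_L₂ (hY.2 y)⟩
      have h1 := (hl.1 (h X Y hX' hY' x)).1
      rwa [(proj_nijenhuis hX' hY' x).1, smul_eq_zero_iff_right four_ne_zero,
        B.proj₂_app_section hX, B.proj₂_app_section hY] at h1
  · rintro ⟨h₁, h₂⟩ X Y hX hY x
    refine hl.2 ⟨?_, ?_⟩
    · rw [(proj_nijenhuis hX hY x).1,
        h₂ _ _ (B.isSection_proj₂ hX.1) (B.isSection_proj₂ hY.1), smul_zero]
    · rw [(proj_nijenhuis hX hY x).2,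
        h₁ _ _ (B.isSection_proj₁ hX.1) (B.isSection_proj₁ hY.1), smul_zero]

end AlmostBiLegendrian

end Uniqueness

end BiLegendrian

end

theorem mainTheorem2 (n : ℕ) {M : Type*} [TopologicalSpace M] [T2Space M]
    [SecondCountableTopology M] [ChartedSpace (EuclideanSpace ℝ (Fin (2 * n + 1))) M]
    [IsManifold (𝓡 (2 * n + 1)) ∞ M]
    (B : BiLegendrian.AlmostBiLegendrian (𝓡 (2 * n + 1)) M n) :
    B.paracontact.IsParacontactMetric n ∧
    ∃ Dbl Dpc : BiLegendrian.Connection (𝓡 (2 * n + 1)) M,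
      (Dbl.IsBiLegendrian B ∧
        ∀ D : BiLegendrian.Connection (𝓡 (2 * n + 1)) M, D.IsBiLegendrian B → D.Coincide Dbl) ∧
      (B.paracontact.IsCanonicalConnection Dpc ∧
        ∀ D : BiLegendrian.Connection (𝓡 (2 * n + 1)) M,
          B.paracontact.IsCanonicalConnection D → D.Coincide Dpc) ∧
      (Dbl.ParallelEnd B.paracontact.ψ ∧ Dbl.ParallelBilin B.paracontact.g) ∧
      (Dbl.Coincide Dpc ↔ B.paracontact.Integrable) := by
  have : Fact (Module.finrank ℝ (EuclideanSpace ℝ (Fin (2 * n + 1))) = 2 * n + 1) := ⟨by simp⟩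
  have hD := B.isSemiRiemannian.isLeviCivita
  refine ⟨B.isParacontactMetric, _, _,
    ⟨B.isBiLegendrian hD, fun D h ↦ h.coincide (B.isBiLegendrian hD)⟩,
    ⟨B.isCanonicalConnection hD, fun D h ↦
      BiLegendrian.Connection.coincide_of_isCanonicalConnection h (B.isCanonicalConnection hD)⟩,
    ⟨B.biLegendrianConnection_parallel_ψ hD, B.biLegendrianConnection_parallel_g hD⟩, ?_⟩
  rw [B.coincide_iff hD, BiLegendrian.AlmostBiLegendrian.integrable_iff]
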